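/- Let $A\subset\mathbb R^3$ be a bounded open set of class $C^{1,1}$ with second Betti number $0$, let $\Delta\subset\mathbb R^3$ be a compact convex set containing $0$ in its interior, let $\rho_\Delta(\xi)=\inf\{t\ge 0:\ \xi\in t\Delta\}$ be its gauge function and $I_\Delta$ its indicator function ($I_\Delta=0$ on $\Delta$, $I_\Delta=+\infty$ off $\Delta$). Let $\lambda>0$ and $U_0\in L^2(A,\mathbb R^3)$. For $p>1$ let \[ X_p=\{V\in L^p(A,\mathbb R^3):\ \operatorname{curl}V\in L^p(A,\mathbb R^3),\ \operatorname{div}V=0 \text{ in } A,\ n\times V=0\text{ on }\partial A\}, \] where $\operatorname{curl}$ and $\operatorname{div}$ are taken in the sense of distributions and the boundary condition in the usual weak sense, that is, $\int_A V\cdot\operatorname{curl}\Phi\,dx=\int_A \operatorname{curl}V\cdot\Phi\,dx$ for all $\Phi\in C^\infty_c(\mathbb R^3,\mathbb R^3)$. For $V\in L^2(A,\mathbb R^3)$ and $p>3$ set \[ F_p(V)=\begin{cases}\displaystyle\int_A \tfrac1p\,\rho_\Delta(\operatorname{curl}V)^p+\lambda|V-U_0|^2\,dx,& V\in X_p,\\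 +\infty,&\text{otherwise,}\end{cases} \qquad F(V)=\begin{cases}\displaystyle\int_A I_\Delta(\operatorname{curl}V)+\lambda|V-U_0|^2\,dx,& V\in X_2,\\ +\infty,&\text{otherwise.}\end{cases} \] Then $F_p$ $\Gamma$-converges to $F$ as $p\to\infty$ in the strong topology of $L^2(A,\mathbb R^3)$, i.e.: (i) for every $V\in L^2(A,\mathbb R^3)$ there is a family $(V_p)$ in $L^2(A,\mathbb R^3)$ with $V_p\to V$ in $L^2$ and $\limsup_{p\to\infty}F_p(V_p)\le F(V)$; (ii) for every $V\in L^2(A,\mathbb R^3)$ and every family $(V_p)$ in $L^2(A,\mathbb R^3)$ with $V_p\to V$ in $L^2$ one has $F(V)\le\liminf_{p\to\infty}F_p(V_p)$. Moreover, if $V_p\to V$ in $L^2$ and $\liminf_{p\to\infty}F_p(V_p)<+\infty$, then $V\in X_2$ and $\rho_\Delta(\operatorname{curl}V)\le 1$ a.e. in $A$. -/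

import Mathlib

open MeasureTheory Filter Topology
open scoped ENNReal NNReal ContDiff

namespace HardSC

/-- Three-dimensional Euclidean space. -/
abbrev E3 : Type := EuclideanSpace ℝ (Fin 3)

/-- `IsC11 A`: the set `A` is of class `C^{1,1}`.  Around every boundary point there is a ball on
which a `C^{1,1}` diffeomorphism `ψ` onto an open set `D`, with `C^{1,1}` inverse, maps the points
of `A` into the open upper half space and the boundary points of `A` into the hyperplane. -/
def IsC11 (A : Set E3) : Prop :=
  ∀ x₀ ∈ frontier A, ∃ (r : ℝ) (ψ : OpenPartialHomeomorph E3 E3), 0 < r ∧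
    ψ.source = Metric.ball x₀ r ∧
    ContDiffOn ℝ 1 ψ ψ.source ∧ (∃ K : ℝ≥0, LipschitzOnWith K (fderiv ℝ ψ) ψ.source) ∧
    ContDiffOn ℝ 1 ψ.symm ψ.target ∧
      (∃ K : ℝ≥0, LipschitzOnWith K (fderiv ℝ ψ.symm) ψ.target) ∧
    (∀ x ∈ Metric.ball x₀ r ∩ A, 0 < ψ x 2) ∧
    (∀ x ∈ Metric.ball x₀ r ∩ frontier A, ψ x 2 = 0)

/-- The second Betti number of `A`: the dimension of its second singular homology
with rational coefficients. -/
noncomputable def secondBetti (A : Set E3) : Cardinal :=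
  Module.rank ℚ (((AlgebraicTopology.singularHomologyFunctor (ModuleCat.{0} ℚ) 2).obj
    (ModuleCat.of ℚ ℚ)).obj (TopCat.of A))

/-- The partial derivative `∂ᵢ Φⱼ` of a differentiable vector field `Φ`. -/
noncomputable def pd (i j : Fin 3) (Φ : E3 → E3) (x : E3) : ℝ :=
  (fderiv ℝ Φ x (EuclideanSpace.single i 1)) j

/-- The classical curl of a differentiable vector field. -/
noncomputable def curl (Φ : E3 → E3) (x : E3) : E3 :=
  !₂[pd 1 2 Φ x - pd 2 1 Φ x, pd 2 0 Φ x - pd 0 2 Φ x, pd 0 1 Φ x - pd 1 0 Φ x]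

/-- `J` is the distributional curl of `V` in `A`. -/
structure HasWeakCurl (A : Set E3) (V J : E3 → E3) : Prop where
  locInt : LocallyIntegrableOn V A
  locInt_curl : LocallyIntegrableOn J A
  integral_eq : ∀ Φ : E3 → E3, ContDiff ℝ ∞ Φ → HasCompactSupport Φ → tsupport Φ ⊆ A →
    ∫ x in A, inner ℝ (V x) (curl Φ x) = ∫ x in A, inner ℝ (J x) (Φ x)

/-- The distributional curl of `V` in `A` (and `0` if there is none that is a function). -/
noncomputable def weakCurl (A : Set E3) (V : E3 → E3) : E3 → E3 :=
  open Classical in if h : ∃ J, HasWeakCurl A V J then h.choose else 0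

theorem hasWeakCurl_weakCurl {A : Set E3} {V J : E3 → E3} (h : HasWeakCurl A V J) :
    HasWeakCurl A V (weakCurl A V) := by
  have h' : ∃ J, HasWeakCurl A V J := ⟨J, h⟩
  rw [weakCurl, dif_pos h']
  exact h'.choose_spec

/-- The distributional curl is unique almost everywhere. -/
theorem HasWeakCurl.ae_eq {A : Set E3} (hA : IsOpen A) {V J J' : E3 → E3}
    (h : HasWeakCurl A V J) (h' : HasWeakCurl A V J') :
    J =ᵐ[volume.restrict A] J' := by
  have key : ∀ᵐ x, x ∈ A → (J - J') x = 0 := by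
    refine hA.ae_eq_zero_of_integral_contDiff_smul_eq_zero (h.locInt_curl.sub h'.locInt_curl)
      fun g hg hgc hgA => ?_
    have hint : ∀ {f : E3 → E3}, LocallyIntegrableOn f A → Integrable fun x => g x • f x := by
      intro f hf
      have hK : IntegrableOn (fun x => g x • f x) (tsupport g) :=
        (hf.integrableOn_compact_subset hgA hgc).continuousOn_smul hg.continuous.continuousOn hgc
      refine (integrableOn_iff_integrable_of_support_subset ?_).1 hK
      exact (Function.support_smul_subset_left g f).trans (subset_tsupport g)
    have hint' := (hint h.locInt_curl).sub (hint h'.locInt_curl)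
    have hsub : (fun x => g x • (J - J') x) = (fun x => g x • J x) - fun x => g x • J' x := by
      funext x
      simp [smul_sub]
    rw [hsub]
    refine ext_inner_left ℝ fun c => ?_
    rw [← integral_inner hint' c, inner_zero_right]
    have hΦ : ContDiff ℝ ∞ fun x => g x • c := hg.smul contDiff_const
    have hΦc : HasCompactSupport fun x => g x • c := hgc.smul_right
    have hΦA : tsupport (fun x => g x • c) ⊆ A :=
      (tsupport_smul_subset_left g fun _ => c).trans hgA
    have e : ∫ x in A, inner ℝ (J x) (g x • c) = ∫ x in A, inner ℝ (J' x) (g x • c) :=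
      (h.integral_eq _ hΦ hΦc hΦA).symm.trans (h'.integral_eq _ hΦ hΦc hΦA)
    have hset : ∀ f : E3 → E3,
        ∫ x in A, inner ℝ (f x) (g x • c) = ∫ x, inner ℝ c (g x • f x) := by
      intro f
      rw [setIntegral_eq_integral_of_forall_compl_eq_zero]
      · refine integral_congr_ae (Eventually.of_forall fun x => ?_)
        simp only [inner_smul_right, real_inner_comm]
      · intro x hx
        have : g x = 0 := image_eq_zero_of_notMem_tsupport fun hx' => hx (hgA hx')
        simp [this]
    rw [hset, hset] at e
    simp only [Pi.sub_apply, inner_sub_right]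
    rw [integral_sub ((hint h.locInt_curl).const_inner c) ((hint h'.locInt_curl).const_inner c), e,
      sub_self]
  rw [EventuallyEq, ae_restrict_iff' hA.measurableSet]
  filter_upwards [key] with x hx hxA
  exact sub_eq_zero.1 (hx hxA)

/-- The field `V` is weakly divergence free in `A`. -/
def DivFree (A : Set E3) (V : E3 → E3) : Prop :=
  ∀ φ : E3 → ℝ, ContDiff ℝ ∞ φ → HasCompactSupport φ → tsupport φ ⊆ A →
    ∫ x in A, inner ℝ (V x) (gradient φ x) = 0

/-- The tangential trace `n × V` vanishes on `∂A`, in the usual weak sense: Green's formula for the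
curl holds without boundary term, for test fields that are smooth up to the boundary. -/
def ZeroTangentialTrace (A : Set E3) (V : E3 → E3) : Prop :=
  ∀ Φ : E3 → E3, ContDiff ℝ ∞ Φ → HasCompactSupport Φ →
    ∫ x in A, inner ℝ (V x) (curl Φ x) = ∫ x in A, inner ℝ (weakCurl A V x) (Φ x)

/-- Membership in the space `X_p` of all `V ∈ L^p(A, ℝ³)` with `curl V ∈ L^p(A, ℝ³)`,
`div V = 0` in `A` and `n × V = 0` on `∂A`. -/
structure MemX (A : Set E3) (p : ℝ) (V : E3 → E3) : Prop where
  memLp : MemLp V (ENNReal.ofReal p) (volume.restrict A)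
  exists_curl : ∃ J, HasWeakCurl A V J
  memLp_curl : MemLp (weakCurl A V) (ENNReal.ofReal p) (volume.restrict A)
  divFree : DivFree A V
  zeroTrace : ZeroTangentialTrace A V

/-- The Hilbert space `L²(A, ℝ³)`. -/
abbrev L2 (A : Set E3) : Type := Lp E3 2 (volume.restrict A)

/-- The functional `V ↦ ∫_A (1/p) ρ_Δ(curl V)^p + lam |V - U₀|²` on `X_p`, extended by `+∞` to
`L²(A, ℝ³)`. -/
noncomputable def powerFunctional (A Δ : Set E3) (lam : ℝ) (U₀ : L2 A) (p : ℝ) (V : L2 A) :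
    ℝ≥0∞ :=
  open Classical in
  if MemX A p V then
    ∫⁻ x in A, ENNReal.ofReal (1 / p * gauge Δ (weakCurl A V x) ^ p + lam * ‖V x - U₀ x‖ ^ 2)
  else ⊤

/-- The indicator function `I_Δ` of convex analysis: `0` on `Δ` and `+∞` off `Δ`. -/
noncomputable def convexIndicator (Δ : Set E3) (ξ : E3) : ℝ≥0∞ :=
  open Classical in if ξ ∈ Δ then 0 else ⊤

/-- The functional `V ↦ ∫_A I_Δ(curl V) + lam |V - U₀|²` on `X_2`, extended by `+∞` to
`L²(A, ℝ³)`. -/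
noncomputable def limitFunctional (A Δ : Set E3) (lam : ℝ) (U₀ : L2 A) (V : L2 A) : ℝ≥0∞ :=
  open Classical in
  if MemX A 2 V then
    ∫⁻ x in A, (convexIndicator Δ (weakCurl A V x) + ENNReal.ofReal (lam * ‖V x - U₀ x‖ ^ 2))
  else ⊤

/-- The family of functionals `F p` on the topological space `X` `Γ`-converges to `Flim` as
`p → ∞`. -/
def GammaConverges {X : Type*} [TopologicalSpace X] (F : ℝ → X → ℝ≥0∞) (Flim : X → ℝ≥0∞) : Prop :=
  (∀ V : X, ∃ Vp : ℝ → X, Tendsto Vp atTop (𝓝 V) ∧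
    limsup (fun p => F p (Vp p)) atTop ≤ Flim V) ∧
  (∀ (V : X) (Vp : ℝ → X), Tendsto Vp atTop (𝓝 V) →
    Flim V ≤ liminf (fun p => F p (Vp p)) atTop)

end HardSC

/-!
The lower bound is a compactness argument.  If the energies stay bounded along some `p → ∞`, then
the `L^p` norms of the gauge of the curls are at most `(p M)^(1/p)`, so the curls are bounded in
`L²` and have a weak limit along an ultrafilter.  The weak limit inherits Green's formula and the
divergence condition, hence it is the curl of the limit field.  On every measurable `E ⊆ A` and for
every `a > 1`, the integral over `E` of the gauge of the curls is at most `a |E| + o(1)`; tested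
against countably many half-spaces that cut out `Δ`, this shows that the limit curl takes values in
`Δ` (`memX_two_of_frequently_powerFunctional_le`).  The fidelity term is continuous in `L²`.

For the recovery family it suffices to approximate a field `V ∈ X_2` with curl in `Δ`, in `L²`, by
fields that lie in *all* the `X_p` and have curl in `Δ`, for on such fields the curl term of the
`p`-energy is at most `|A| / p` (`exists_memX_forall_close`).  The vanishing tangential trace means
that the extension of `V` by zero has the extension by zero of `curl V` as its curl on the whole
space.  Mollify that extension and pull it back, as a 1-form, by `x ↦ x + t N x`, where `N` is a
smooth field pointing out of `A` along `∂A`: the result is a test field `W` supported in `A`.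
Mollification keeps the curl in the convex set `Δ`, and the pullback changes it by `O(t)`, which is
absorbed by first multiplying `V` by a constant `s < 1` (`IsC11.exists_test_field_close`).

The field `W` need not be divergence free.  Let `u` solve `Δu = div W` in `A`, `u = 0` off `A`.
Then `W - ∇u` is divergence free and has the same curl and tangential trace as `W`.  It is also
at least as close to `V` as `W` is: `W - ∇u - V` is divergence free, hence orthogonal to `∇u`
(`DivFree.inner_gradient_eq_zero`), so that its norm is at most that of `W - V`.  It belongs to all
`X_p` because `u` is Lipschitz.  This regularity
(`exists_lipschitz_dirichlet`) comes from the uniform exterior balls of a `C^{1,1}` domain: Gaussian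
barriers bound the solutions of the finite difference problem by a multiple of the distance to
`∂A`, the discrete maximum principle applied to the difference of a solution and a translate of it
turns this into a Lipschitz bound independent of the mesh size, and `u` is a limit of these
solutions.
-/

namespace HardSC

open Metric Set
open scoped Convolution

/-! ### Local defining functions, exterior cones and exterior balls -/

/-- Near a boundary point, a `C^{1,1}` open set is the positivity set of a function `g` with
Lipschitz gradient `G`, bounded away from zero. -/
theorem IsC11.exists_definingFunction {A : Set E3} (hAo : IsOpen A) (hA : IsC11 A) {x₀ : E3}
    (hx₀ : x₀ ∈ frontier A) :
    ∃ (r : ℝ) (g : E3 → ℝ) (G : E3 → E3) (K m : ℝ), 0 < r ∧ 0 < m ∧ 0 < K ∧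
      (∀ x ∈ ball x₀ r, x ∈ A ↔ 0 < g x) ∧
      (∀ x ∈ ball x₀ r, x ∈ frontier A → g x = 0) ∧
      (∀ x ∈ ball x₀ r, m ≤ ‖G x‖) ∧
      (∀ x ∈ ball x₀ r, ∀ y ∈ ball x₀ r, ‖G x - G y‖ ≤ K * ‖x - y‖) ∧
      (∀ x ∈ ball x₀ r, ∀ y ∈ ball x₀ r,
        |g y - g x - inner ℝ (G x) (y - x)| ≤ K * ‖y - x‖ ^ 2) := by
  obtain ⟨r, ψ, hr, hsrc, hψ, ⟨K, hK⟩, hψs, -, hpos, hzero⟩ := hA x₀ hx₀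
  have hx₀s : x₀ ∈ ψ.source := by rw [hsrc]; exact mem_ball_self hr
  set π : E3 →L[ℝ] ℝ := EuclideanSpace.proj (2 : Fin 3) with hπ
  have hπn : ‖π‖ ≤ 1 := by
    refine ContinuousLinearMap.opNorm_le_bound _ zero_le_one fun x => ?_
    rw [one_mul]; exact PiLp.norm_apply_le x 2
  have hdiff : ∀ x ∈ ψ.source, DifferentiableAt ℝ ψ x := fun x hx =>
    (hψ.differentiableOn one_ne_zero).differentiableAt (ψ.open_source.mem_nhds hx)
  set g : E3 → ℝ := fun x => ψ x 2 with hg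
  set D : E3 → E3 →L[ℝ] ℝ := fun x => π.comp (fderiv ℝ ψ x) with hD
  set G : E3 → E3 := fun x => (InnerProductSpace.toDual ℝ E3).symm (D x) with hG
  have hgD : ∀ x ∈ ψ.source, HasFDerivAt g (D x) x := fun x hx =>
    π.hasFDerivAt.comp x (hdiff x hx).hasFDerivAt
  have hDK : ∀ x ∈ ψ.source, ∀ y ∈ ψ.source, ‖D x - D y‖ ≤ K * ‖x - y‖ := by
    intro x hx y hy
    have h1 := hK.dist_le_mul x hx y hy
    rw [dist_eq_norm, dist_eq_norm] at h1
    have : D x - D y = π.comp (fderiv ℝ ψ x - fderiv ℝ ψ y) := by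
      simp [hD, ContinuousLinearMap.comp_sub]
    rw [this]
    calc _ ≤ ‖π‖ * ‖fderiv ℝ ψ x - fderiv ℝ ψ y‖ := ContinuousLinearMap.opNorm_comp_le _ _
      _ ≤ 1 * ‖fderiv ℝ ψ x - fderiv ℝ ψ y‖ := by gcongr
      _ ≤ _ := by rw [one_mul]; exact h1
  have hGK : ∀ x ∈ ψ.source, ∀ y ∈ ψ.source, ‖G x - G y‖ ≤ K * ‖x - y‖ := by
    intro x hx y hy
    have : G x - G y = (InnerProductSpace.toDual ℝ E3).symm (D x - D y) := by simp [hG]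
    rw [this, LinearIsometryEquiv.norm_map]
    exact hDK x hx y hy
  have hGin : ∀ x v, inner ℝ (G x) v = D x v := by
    intro x v; simp [hG]
  -- the gradient does not vanish at `x₀`
  have hG0 : G x₀ ≠ 0 := by
    intro h0
    have hDz : D x₀ = 0 := by
      have := congrArg (InnerProductSpace.toDual ℝ E3) h0
      simpa [hG] using this
    have hy : ψ x₀ ∈ ψ.target := ψ.map_source hx₀s
    have hsd : DifferentiableAt ℝ ψ.symm (ψ x₀) :=
      (hψs.differentiableOn one_ne_zero).differentiableAt (ψ.open_target.mem_nhds hy)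
    have h1 : HasFDerivAt (fun y => ψ (ψ.symm y))
        ((fderiv ℝ ψ x₀).comp (fderiv ℝ ψ.symm (ψ x₀))) (ψ x₀) := by
      refine HasFDerivAt.comp (ψ x₀) ?_ hsd.hasFDerivAt
      rw [ψ.left_inv hx₀s]
      exact (hdiff x₀ hx₀s).hasFDerivAt
    have h2 : HasFDerivAt (fun y => ψ (ψ.symm y)) (ContinuousLinearMap.id ℝ E3) (ψ x₀) := by
      refine (hasFDerivAt_id (ψ x₀)).congr_of_eventuallyEq ?_
      filter_upwards [ψ.open_target.mem_nhds hy] with y hy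
      exact ψ.right_inv hy
    have h3 := congrArg (fun L : E3 →L[ℝ] E3 => π (L (EuclideanSpace.single 2 1))) (h1.unique h2)
    have h4 := congrArg (fun L : E3 →L[ℝ] ℝ =>
      L (fderiv ℝ ψ.symm (ψ x₀) (EuclideanSpace.single 2 1))) hDz
    simp [hD, hπ] at h3 h4
    rw [h4] at h3
    exact zero_ne_one h3
  have hm : 0 < ‖G x₀‖ := norm_pos_iff.2 hG0
  obtain ⟨ρ, hρ, hρt⟩ := Metric.isOpen_iff.1 ψ.open_target _ (ψ.map_source hx₀s)
  obtain ⟨r₁, hr₁, hr₁b⟩ := Metric.mem_nhds_iff.1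
    ((ψ.continuousAt hx₀s).preimage_mem_nhds (ball_mem_nhds _ hρ))
  set K' : ℝ := K + 1 with hK'
  have hK'pos : 0 < K' := by positivity
  set r₂ := min (min r r₁) (‖G x₀‖ / (2 * K')) with hr₂
  have hr₂pos : 0 < r₂ := by positivity
  have hr₂r : ball x₀ r₂ ⊆ ψ.source := by
    rw [hsrc]; exact ball_subset_ball ((min_le_left _ _).trans (min_le_left _ _))
  have hr₂r₁ : ball x₀ r₂ ⊆ ball x₀ r₁ :=
    ball_subset_ball ((min_le_left _ _).trans (min_le_right _ _))
  have hKK' : ∀ t : ℝ, 0 ≤ t → K * t ≤ K' * t := fun t ht => by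
    rw [hK']; nlinarith
  refine ⟨r₂, g, G, K', ‖G x₀‖ / 2, hr₂pos, by positivity, hK'pos, ?_, ?_, ?_, ?_, ?_⟩
  · intro x hx
    have hxs := hr₂r hx
    refine ⟨fun hxA => hpos x ⟨hsrc ▸ hxs, hxA⟩, fun hgx => ?_⟩
    -- the upper half of a ball in the chart is connected and avoids the boundary of `A`
    set H : Set E3 := ball (ψ x₀) ρ ∩ {y | 0 < π y} with hH
    have hHc : Convex ℝ H := (convex_ball _ _).inter (convex_halfSpace_gt π.isLinear 0)
    have hHt : H ⊆ ψ.target := inter_subset_left.trans hρt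
    have hpre : IsPreconnected (ψ.symm '' H) :=
      hHc.isPreconnected.image _ (ψ.continuousOn_symm.mono hHt)
    have hmem : ∀ z ∈ ball x₀ r₂, 0 < g z → z ∈ ψ.symm '' H := fun z hz hgz =>
      ⟨ψ z, ⟨hr₁b (hr₂r₁ hz), hgz⟩, ψ.left_inv (hr₂r hz)⟩
    obtain ⟨a, haA, har⟩ := Metric.mem_closure_iff.1 (frontier_subset_closure hx₀) r₂ hr₂pos
    have har' : a ∈ ball x₀ r₂ := by rwa [mem_ball, dist_comm]
    have hsub : ψ.symm '' H ⊆ A := by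
      refine hpre.subset_left_of_subset_union hAo isClosed_closure.isOpen_compl
        (disjoint_compl_right_iff_subset.2 subset_closure) ?_
        ⟨a, hmem a har' (hpos a ⟨hsrc ▸ hr₂r har', haA⟩), haA⟩
      rintro _ ⟨y, hy, rfl⟩
      by_contra hcon
      simp only [mem_union, mem_compl_iff, not_or, not_not] at hcon
      have hfr : ψ.symm y ∈ frontier A := by
        rw [frontier, hAo.interior_eq]; exact ⟨hcon.2, hcon.1⟩
      have := hzero (ψ.symm y) ⟨hsrc ▸ ψ.map_target (hHt hy), hfr⟩
      rw [ψ.right_inv (hHt hy)] at this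
      exact absurd this (ne_of_gt hy.2)
    exact hsub (hmem x hx hgx)
  · intro x hx hxf
    exact hzero x ⟨hsrc ▸ hr₂r hx, hxf⟩
  · intro x hx
    have h1 := hGK x (hr₂r hx) x₀ hx₀s
    have h2 : ‖x - x₀‖ < ‖G x₀‖ / (2 * K') := by
      rw [← dist_eq_norm]; exact (mem_ball.1 hx).trans_le (min_le_right _ _)
    have h3 : K' * ‖x - x₀‖ ≤ ‖G x₀‖ / 2 := by
      calc _ ≤ K' * (‖G x₀‖ / (2 * K')) := by gcongr
        _ = _ := by field_simp
    have h4 := norm_sub_norm_le (G x₀) (G x)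
    rw [norm_sub_rev] at h4
    linarith [hKK' _ (norm_nonneg (x - x₀))]
  · intro x hx y hy
    exact (hGK x (hr₂r hx) y (hr₂r hy)).trans (hKK' _ (norm_nonneg _))
  · intro x hx y hy
    have hseg : segment ℝ x y ⊆ ψ.source :=
      ((convex_ball x₀ r₂).segment_subset hx hy).trans hr₂r
    have := (convex_segment x y).norm_image_sub_le_of_norm_hasFDerivWithin_le
      (f := fun z => g z - D x z) (f' := fun z => D z - D x) (C := K * ‖y - x‖)
      (fun z hz => ((hgD z (hseg hz)).sub (D x).hasFDerivAt).hasFDerivWithinAt)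
      (fun z hz => (hDK z (hseg hz) x (hr₂r hx)).trans (by
        gcongr
        exact norm_sub_le_of_mem_segment hz))
      (left_mem_segment ℝ x y) (right_mem_segment ℝ x y)
    rw [Real.norm_eq_abs] at this
    rw [hGin, map_sub]
    calc _ = |g y - (D x) y - (g x - (D x) x)| := by congr 1; ring
      _ ≤ K * ‖y - x‖ * ‖y - x‖ := this
      _ = K * ‖y - x‖ ^ 2 := by ring
      _ ≤ _ := hKK' _ (by positivity)

/-- Uniform exterior cone property: near a boundary point, the complement of `A` is stable under
small translations in directions close to `-ν`. -/
theorem IsC11.exists_exterior_cone {A : Set E3} (hAo : IsOpen A) (hA : IsC11 A) {x₀ : E3}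
    (hx₀ : x₀ ∈ frontier A) :
    ∃ (ν : E3) (r c s₀ : ℝ), 0 < r ∧ 0 < c ∧ 0 < s₀ ∧
      ∀ x ∈ ball x₀ r, x ∉ A → ∀ s, 0 ≤ s → s ≤ s₀ → ∀ v, ‖v - ν‖ ≤ c → x - s • v ∉ A := by
  obtain ⟨r, g, G, K, m, hr, hm, hK, hiff, -, hGm, hGK, hT⟩ := hA.exists_definingFunction hAo hx₀
  set ν := G x₀
  have hx₀r : x₀ ∈ ball x₀ r := mem_ball_self hr
  have hν : m ≤ ‖ν‖ := hGm x₀ hx₀r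
  have hνpos : 0 < ‖ν‖ := hm.trans_le hν
  set c := ‖ν‖ / 4
  -- all the error terms below are at most a fraction of `s * ‖ν‖ ^ 2`
  refine ⟨ν, min (r / 2) (‖ν‖ / (8 * K)), c, min (r / (4 * ‖ν‖)) (1 / (16 * K)),
    by positivity, by positivity, by positivity, ?_⟩
  intro x hx hxA s hs hss v hv
  have hxr : x ∈ ball x₀ (r / 2) := ball_subset_ball (min_le_left _ _) hx
  have hxr' : x ∈ ball x₀ r := ball_subset_ball (by linarith) hxr
  have hvn : ‖v‖ ≤ 2 * ‖ν‖ := by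
    have := norm_le_norm_add_norm_sub' v ν
    have hc : c = ‖ν‖ / 4 := rfl
    linarith
  have hs1 : s * ‖ν‖ ≤ r / 4 := by
    have := hss.trans (min_le_left _ _)
    rw [le_div_iff₀ (by positivity)] at this
    linarith
  have hs2 : s * K ≤ 1 / 16 := by
    have := hss.trans (min_le_right _ _)
    rw [le_div_iff₀ (by positivity)] at this
    linarith
  have hsv : ‖s • v‖ ≤ 2 * (s * ‖ν‖) := by
    rw [norm_smul, Real.norm_of_nonneg hs]; nlinarith
  have hy : x - s • v ∈ ball x₀ r := by
    rw [mem_ball, dist_eq_norm] at hxr ⊢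
    have : x - s • v - x₀ = (x - x₀) - s • v := by abel
    rw [this]
    have := norm_sub_le (x - x₀) (s • v)
    linarith
  rw [hiff _ hy, not_lt]
  have hgx : g x ≤ 0 := by
    rw [hiff x hxr', not_lt] at hxA; exact hxA
  have hT1 := hT x hxr' _ hy
  have e1 : x - s • v - x = -(s • v) := by abel
  rw [e1, norm_neg, inner_neg_right, inner_smul_right] at hT1
  have h1 : ‖G x - ν‖ ≤ ‖ν‖ / 8 := by
    refine (hGK x hxr' x₀ hx₀r).trans ?_
    have : ‖x - x₀‖ < ‖ν‖ / (8 * K) := by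
      rw [← dist_eq_norm]; exact (mem_ball.1 hx).trans_le (min_le_right _ _)
    calc _ ≤ K * (‖ν‖ / (8 * K)) := by gcongr
      _ = _ := by field_simp
  have h2 : ‖ν‖ ^ 2 / 2 ≤ inner ℝ (G x) v := by
    have e : inner ℝ (G x) v = inner ℝ ν ν + inner ℝ ν (v - ν) + inner ℝ (G x - ν) v := by
      simp only [inner_sub_left, inner_sub_right]; ring
    have a1 := abs_le.1 (abs_real_inner_le_norm ν (v - ν))
    have a2 := abs_le.1 (abs_real_inner_le_norm (G x - ν) v)
    have b1 : ‖ν‖ * ‖v - ν‖ ≤ ‖ν‖ * (‖ν‖ / 4) := by gcongr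
    have b2 : ‖G x - ν‖ * ‖v‖ ≤ ‖ν‖ / 8 * (2 * ‖ν‖) := by gcongr
    rw [e, real_inner_self_eq_norm_sq]
    nlinarith [a1.1, a2.1]
  have h3 : K * ‖s • v‖ ^ 2 ≤ s * (‖ν‖ ^ 2 / 4) := by
    calc K * ‖s • v‖ ^ 2 ≤ K * (2 * (s * ‖ν‖)) ^ 2 := by gcongr
      _ = 4 * (s * K) * (s * ‖ν‖ ^ 2) := by ring
      _ ≤ 4 * (1 / 16) * (s * ‖ν‖ ^ 2) := by gcongr
      _ = _ := by ring
  have h4 : s * (‖ν‖ ^ 2 / 2) ≤ s * inner ℝ (G x) v := by gcongr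
  have h5 := (abs_le.1 hT1).2
  nlinarith [mul_nonneg hs (sq_nonneg ‖ν‖)]

/-- Uniform exterior ball property of bounded `C^{1,1}` open sets. -/
theorem IsC11.exists_exterior_ball {A : Set E3} (hAo : IsOpen A) (hAb : Bornology.IsBounded A)
    (hA : IsC11 A) :
    ∃ s : ℝ, 0 < s ∧ ∀ x₀ ∈ frontier A, ∃ y, ‖x₀ - y‖ = s ∧ ∀ x ∈ A, s ≤ ‖x - y‖ := by
  have hloc : ∀ z ∈ frontier A, ∃ r s : ℝ, 0 < r ∧ 0 < s ∧ ∀ x₀ ∈ frontier A ∩ ball z r,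
      ∀ s', 0 < s' → s' ≤ s → ∃ y, ‖x₀ - y‖ = s' ∧ ∀ x ∈ A, s' ≤ ‖x - y‖ := by
    intro z hz
    obtain ⟨r, g, G, K, m, hr, hm, hK, hiff, hfr, hGm, hGK, hT⟩ :=
      hA.exists_definingFunction hAo hz
    refine ⟨r / 2, min (r / 4) (m / (2 * K)), by positivity, by positivity, ?_⟩
    rintro x₀ ⟨hx₀, hx₀z⟩ s' hs' hss
    have hx₀r : x₀ ∈ ball z r := ball_subset_ball (by linarith) hx₀z
    have hGpos : 0 < ‖G x₀‖ := hm.trans_le (hGm x₀ hx₀r)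
    set n := (‖G x₀‖)⁻¹ • G x₀ with hn
    have hnn : ‖n‖ = 1 := by rw [hn, norm_smul, norm_inv, norm_norm, inv_mul_cancel₀ hGpos.ne']
    have hGn : G x₀ = ‖G x₀‖ • n := by rw [hn, smul_smul, mul_inv_cancel₀ hGpos.ne', one_smul]
    refine ⟨x₀ - s' • n, by simp [norm_smul, hnn, abs_of_pos hs'], fun x hxA => ?_⟩
    by_contra hlt
    push Not at hlt
    have e1 : x - (x₀ - s' • n) = (x - x₀) + s' • n := by abel
    rw [e1] at hlt
    have hd : ‖x - x₀‖ < 2 * s' := by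
      have := norm_sub_le ((x - x₀) + s' • n) (s' • n)
      rw [add_sub_cancel_right, norm_smul, hnn, Real.norm_of_nonneg hs'.le] at this
      linarith
    have hxr : x ∈ ball z r := by
      have h1 := mem_ball.1 hx₀z
      have h2 := dist_triangle x x₀ z
      rw [dist_eq_norm x x₀] at h2
      have := hss.trans (min_le_left _ _)
      rw [mem_ball]; linarith
    have hsq : ‖(x - x₀) + s' • n‖ ^ 2 < s' ^ 2 := by gcongr
    rw [norm_add_sq_real, norm_smul, hnn, inner_smul_right, Real.norm_of_nonneg hs'.le] at hsq
    have h1 := (abs_le.1 (hT x₀ hx₀r x hxr)).2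
    rw [hfr x₀ hx₀r hx₀, hGn, inner_smul_left] at h1
    have h2 : 0 < g x := (hiff x hxr).1 hxA
    have h3 := hGm x₀ hx₀r
    have h4 : s' * (2 * K) ≤ m := by
      have := hss.trans (min_le_right _ _)
      rwa [le_div_iff₀ (by positivity)] at this
    simp only [conj_trivial] at h1
    set q := inner ℝ (x - x₀) n
    rw [real_inner_comm] at h1
    change g x - 0 - ‖G x₀‖ * q ≤ _ at h1
    have hX : ‖x - x₀‖ ^ 2 < -(2 * s' * q) := by nlinarith
    have hq : q < 0 := by nlinarith [sq_nonneg ‖x - x₀‖]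
    have h5 : K * ‖x - x₀‖ ^ 2 ≤ K * (-(2 * s' * q)) := by gcongr
    have h6 : ‖G x₀‖ * q ≤ m * q := mul_le_mul_of_nonpos_right h3 hq.le
    nlinarith
  choose! r s hr hs hball using hloc
  have hcomp : IsCompact (frontier A) :=
    Metric.isCompact_of_isClosed_isBounded isClosed_frontier
      (hAb.closure.subset frontier_subset_closure)
  obtain ⟨F, hF, hcov⟩ := hcomp.elim_nhds_subcover (fun z => ball z (r z))
    (fun z hz => ball_mem_nhds z (hr z hz))
  obtain ⟨s', hs', hle⟩ : ∃ s' : ℝ, 0 < s' ∧ ∀ z ∈ F, s' ≤ s z := by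
    rcases F.eq_empty_or_nonempty with rfl | hne
    · exact ⟨1, one_pos, by simp⟩
    · refine ⟨F.inf' hne s, (Finset.lt_inf'_iff _).2 fun z hz => hs z (hF z hz),
        fun z hz => Finset.inf'_le _ hz⟩
  refine ⟨s', hs', fun x₀ hx₀ => ?_⟩
  obtain ⟨z, hzF, hxz⟩ := mem_iUnion₂.1 (hcov hx₀)
  exact hball z (hF z hzF) x₀ ⟨hx₀, hxz⟩ s' hs' (hle z hzF)

/-! ### An outward vector field -/

/-- A smooth vector field `N` pointing out of `A` along `∂A`, uniformly: small displacements along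
`N`, up to a proportional error, keep the complement of `A` inside itself. -/
theorem IsC11.exists_outward_field {A : Set E3} (hAo : IsOpen A) (hAb : Bornology.IsBounded A)
    (hA : IsC11 A) :
    ∃ (N : E3 → E3) (c t₀ : ℝ), ContDiff ℝ ∞ N ∧ HasCompactSupport N ∧ 0 < c ∧ 0 < t₀ ∧
      ∀ t, 0 < t → t ≤ t₀ → ∀ x ∉ A, ∀ w, ‖w‖ ≤ c * t → x + t • N x + w ∉ A := by
  have hloc : ∀ z ∈ frontier A, ∃ (ν : E3) (r c s₀ : ℝ), 0 < r ∧ 0 < c ∧ 0 < s₀ ∧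
      ∀ x ∈ ball z r, x ∉ A → ∀ s, 0 ≤ s → s ≤ s₀ → ∀ v, ‖v - ν‖ ≤ c → x - s • v ∉ A :=
    fun z hz => hA.exists_exterior_cone hAo hz
  choose! ν r c s₀ hr hc hs₀ hcone using hloc
  have hcomp : IsCompact (frontier A) :=
    Metric.isCompact_of_isClosed_isBounded isClosed_frontier
      (hAb.closure.subset frontier_subset_closure)
  obtain ⟨F, hF, hcov⟩ := hcomp.elim_nhds_subcover (fun z => ball z (r z / 4))
    (fun z hz => ball_mem_nhds z (by linarith [hr z hz]))
  have hbump : ∀ z : E3, ∃ χ : E3 → ℝ, ContDiff ℝ ∞ χ ∧ HasCompactSupport χ ∧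
      (∀ x, 0 ≤ χ x) ∧ (∀ x, χ x ≤ 1) ∧
      (z ∈ frontier A → (∀ x ∈ ball z (r z / 4), χ x = 1) ∧ ∀ x, x ∉ ball z (r z / 2) → χ x = 0) := by
    intro z
    by_cases hz : z ∈ frontier A
    · have hrz := hr z hz
      let b : ContDiffBump z := ⟨r z / 4, r z / 2, by linarith, by linarith⟩
      refine ⟨b, b.contDiff, b.hasCompactSupport, fun x => b.nonneg, fun x => b.le_one,
        fun _ => ⟨fun x hx => b.one_of_mem_closedBall (ball_subset_closedBall hx), fun x hx => ?_⟩⟩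
      exact b.zero_of_le_dist (not_lt.1 hx)
    · exact ⟨0, contDiff_const, HasCompactSupport.zero, by simp, by simp, fun h => absurd h hz⟩
  choose χ hχs hχc hχ0 hχ1 hχb using hbump
  obtain ⟨m, hm, hle⟩ : ∃ m : ℝ, 0 < m ∧ ∀ z ∈ F, m ≤ r z / 2 ∧ m ≤ c z ∧ m ≤ s₀ z := by
    rcases F.eq_empty_or_nonempty with rfl | hne
    · exact ⟨1, one_pos, by simp⟩
    · refine ⟨F.inf' hne fun z => min (r z / 2) (min (c z) (s₀ z)),
        (Finset.lt_inf'_iff _).2 fun z hz => ?_, fun z hz => ?_⟩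
      · have := hr z (hF z hz)
        have := hc z (hF z hz)
        have := hs₀ z (hF z hz)
        positivity
      · have := Finset.inf'_le (fun z => min (r z / 2) (min (c z) (s₀ z))) hz
        simp only [le_min_iff] at this
        exact this
  obtain ⟨ρ, hρ, hρU⟩ := hcomp.exists_thickening_subset_open
    (isOpen_biUnion fun z (_ : z ∈ F) => isOpen_ball (x := z) (ε := r z / 4)) hcov
  -- `N` is minus the sum of the inner directions `ν z`, cut off near the points `z` of a finite net
  -- of the boundary
  set B : ℝ := ∑ z ∈ F, ‖ν z‖ with hB
  have hB0 : 0 ≤ B := Finset.sum_nonneg fun z _ => norm_nonneg _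
  have hdisp : ∀ G ⊆ F, ∀ x, ‖∑ z ∈ G, χ z x • ν z‖ ≤ B := by
    intro G hG x
    refine (norm_sum_le _ _).trans ((Finset.sum_le_sum fun z _ => ?_).trans
      (Finset.sum_le_sum_of_subset_of_nonneg hG fun z _ _ => norm_nonneg _))
    rw [norm_smul, Real.norm_of_nonneg (hχ0 z x)]
    exact mul_le_of_le_one_left (norm_nonneg _) (hχ1 z x)
  set t₀ := min (min (m / (2 * (B + 1))) m) (ρ / (2 * (B + m))) with ht₀
  refine ⟨fun x => -∑ z ∈ F, χ z x • ν z, m, t₀, ?_, ?_, hm, by positivity, ?_⟩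
  · exact (ContDiff.sum fun z _ => (hχs z).smul contDiff_const).neg
  · refine HasCompactSupport.neg ?_
    refine HasCompactSupport.intro
      (K := ⋃ z ∈ F, tsupport (χ z)) (F.isCompact_biUnion fun z _ => hχc z) fun x hx => ?_
    refine Finset.sum_eq_zero fun z hz => ?_
    rw [image_eq_zero_of_notMem_tsupport (f := χ z), zero_smul]
    exact fun h => hx (mem_biUnion hz h)
  · intro t ht htt x hxA w hw
    have ht1 : t * B < m := by
      have := (htt.trans (min_le_left _ _)).trans (min_le_left _ _)
      rw [le_div_iff₀ (by positivity)] at this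
      nlinarith
    have ht2 : t ≤ m := (htt.trans (min_le_left _ _)).trans (min_le_right _ _)
    have ht3 : t * (B + m) < ρ := by
      have := htt.trans (min_le_right _ _)
      rw [le_div_iff₀ (by positivity)] at this
      linarith
    have hnear : ∀ G ⊆ F, ‖t • ∑ z ∈ G, χ z x • ν z‖ ≤ t * B := by
      intro G hG
      rw [norm_smul, Real.norm_of_nonneg ht.le]
      exact mul_le_mul_of_nonneg_left (hdisp G hG x) ht.le
    have hball : ∀ G ⊆ F, ∀ z ∈ F, x ∈ ball z (r z / 2) →
        x - t • ∑ z ∈ G, χ z x • ν z ∈ ball z (r z) := by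
      intro G hG z hz hxz
      rw [mem_ball, dist_eq_norm] at hxz ⊢
      have e : x - t • ∑ z ∈ G, χ z x • ν z - z = (x - z) - t • ∑ z ∈ G, χ z x • ν z := by abel
      rw [e]
      have h1 := norm_sub_le (x - z) (t • ∑ z ∈ G, χ z x • ν z)
      have h2 := hnear G hG
      have h3 := (hle z hz).1
      linarith
    -- the displacement is performed one summand at a time: each one stays off `A` by the cone
    -- property at `z` with the length `t * χ z x`
    have hstep : ∀ G ⊆ F, x - t • ∑ z ∈ G, χ z x • ν z ∉ A := by
      intro G
      induction G using Finset.induction_on with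
      | empty => intro _; simpa using hxA
      | insert z G hzG ih =>
        intro hG
        have hzF : z ∈ F := hG (Finset.mem_insert_self _ _)
        have hGF : G ⊆ F := (Finset.subset_insert _ _).trans hG
        have hprev := ih hGF
        by_cases hxz : x ∈ ball z (r z / 2)
        · have h1 := hcone z (hF z hzF) _ (hball G hGF z hzF hxz) hprev (t * χ z x)
            (mul_nonneg ht.le (hχ0 z x))
            ((mul_le_of_le_one_right ht.le (hχ1 z x)).trans (ht2.trans (hle z hzF).2.2))
            (ν z) (by simpa using (hc z (hF z hzF)).le)
          have e : x - t • ∑ z ∈ insert z G, χ z x • ν z =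
              x - t • ∑ z ∈ G, χ z x • ν z - (t * χ z x) • ν z := by
            rw [Finset.sum_insert hzG, smul_add, smul_smul]; abel
          rwa [e]
        · rw [Finset.sum_insert hzG, (hχb z (hF z hzF)).2 x hxz, zero_smul, zero_add]
          exact hprev
    by_cases hxU : x ∈ ⋃ z ∈ F, ball z (r z / 4)
    · -- a summand with coefficient `1` is left for the end: its full cone absorbs the error `w`
      obtain ⟨z, hzF, hxz⟩ := mem_iUnion₂.1 hxU
      have hGF : F.erase z ⊆ F := Finset.erase_subset _ _
      have hrz := hr z (hF z hzF)
      have h1 := hcone z (hF z hzF) _ (hball _ hGF z hzF (ball_subset_ball (by linarith) hxz))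
        (hstep _ hGF) t ht.le (ht2.trans (hle z hzF).2.2) (ν z - t⁻¹ • w) (by
          rw [sub_sub_cancel_left, norm_neg, norm_smul, norm_inv, Real.norm_of_nonneg ht.le,
            inv_mul_le_iff₀ ht]
          calc ‖w‖ ≤ m * t := hw
            _ ≤ c z * t := by gcongr; exact (hle z hzF).2.1
            _ = t * c z := mul_comm _ _)
      have e : x + t • -∑ z ∈ F, χ z x • ν z + w =
          x - t • ∑ z ∈ F.erase z, χ z x • ν z - t • (ν z - t⁻¹ • w) := by
        rw [← Finset.add_sum_erase F _ hzF, (hχb z (hF z hzF)).1 x hxz, one_smul, smul_sub,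
          smul_smul, mul_inv_cancel₀ ht.ne', one_smul, smul_neg, smul_add]
        abel
      exact e ▸ h1
    · -- `x` is at distance at least `ρ` from the boundary, more than the total displacement
      have hfar : ∀ y ∈ frontier A, ρ ≤ dist x y := by
        intro y hy
        by_contra h
        exact hxU (hρU (mem_thickening_iff.2 ⟨y, hy, not_le.1 h⟩))
      have hsub : ball x ρ ⊆ Aᶜ := by
        have hcl : ball x ρ ⊆ (closure A)ᶜ := by
          refine (convex_ball x ρ).isPreconnected.subset_left_of_subset_union
            isClosed_closure.isOpen_compl hAo
            (disjoint_compl_left_iff_subset.2 subset_closure) ?_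
            ⟨x, mem_ball_self hρ, fun hx => ?_⟩
          · intro y hy
            by_contra hcon
            simp only [mem_union, mem_compl_iff, not_or, not_not] at hcon
            have := hfar y (by rw [frontier, hAo.interior_eq]; exact hcon)
            rw [mem_ball, dist_comm] at hy
            linarith
          · have := hfar x (by rw [frontier, hAo.interior_eq]; exact ⟨hx, hxA⟩)
            rw [dist_self] at this
            linarith
        exact hcl.trans (compl_subset_compl.2 subset_closure)
      refine hsub ?_
      rw [mem_ball, dist_eq_norm]
      have e : x + t • -∑ z ∈ F, χ z x • ν z + w - x = w - t • ∑ z ∈ F, χ z x • ν z := by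
        rw [smul_neg]; abel
      change ‖x + t • -∑ z ∈ F, χ z x • ν z + w - x‖ < ρ
      rw [e]
      have h1 := norm_sub_le w (t • ∑ z ∈ F, χ z x • ν z)
      have h2 := hnear F subset_rfl
      linarith

/-- A function vanishing off `A` has zero derivative at every point off `A`: at boundary points it
vanishes along an open cone of directions. -/
theorem IsC11.fderiv_eq_zero_of_notMem {A : Set E3} (hAo : IsOpen A) (hA : IsC11 A) {u : E3 → ℝ}
    (hu : ∀ x ∉ A, u x = 0) {x : E3} (hx : x ∉ A) : fderiv ℝ u x = 0 := by
  by_cases hd : DifferentiableAt ℝ u x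
  swap
  · exact fderiv_zero_of_not_differentiableAt hd
  by_cases hxc : x ∈ closure A
  · have hxf : x ∈ frontier A := by rw [frontier, hAo.interior_eq]; exact ⟨hxc, hx⟩
    obtain ⟨ν, r, c, s₀, hr, hc, hs₀, hcone⟩ := hA.exists_exterior_cone hAo hxf
    have hv : ∀ v, ‖v - ν‖ ≤ c → fderiv ℝ u x v = 0 := by
      intro v hv
      have h1 : HasDerivAt (fun s : ℝ => u (x - s • v)) (fderiv ℝ u x (-v)) 0 := by
        have hL : HasDerivAt (fun s : ℝ => x - s • v) (-v) 0 := by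
          simpa using ((hasDerivAt_id (0 : ℝ)).smul_const v).const_sub x
        have hd' : HasFDerivAt u (fderiv ℝ u x) (x - (0 : ℝ) • v) := by
          simpa using hd.hasFDerivAt
        exact hd'.comp_hasDerivAt (0 : ℝ) hL
      have h2 : HasDerivWithinAt (fun s : ℝ => u (x - s • v)) 0 (Ici 0) 0 := by
        refine (hasDerivWithinAt_const (0 : ℝ) (Ici 0) (0 : ℝ)).congr_of_eventuallyEq_of_mem ?_
          (by simp)
        filter_upwards [inter_mem_nhdsWithin (Ici (0 : ℝ)) (Iic_mem_nhds hs₀)] with s hs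
        exact hu _ (hcone x (mem_ball_self hr) hx s hs.1 hs.2 v hv)
      have h3 := (uniqueDiffWithinAt_Ici (0 : ℝ)).eq_deriv _ h1.hasDerivWithinAt h2
      simpa using h3
    -- a linear form vanishing on a ball around `ν` is zero
    ext w
    by_cases hw : w = 0
    · simp [hw]
    have hwn : 0 < ‖w‖ := norm_pos_iff.2 hw
    have h1 := hv ν (by simpa using hc.le)
    have h2 := hv (ν + (c / ‖w‖) • w) (by
      rw [add_sub_cancel_left, norm_smul, Real.norm_of_nonneg (by positivity),
        div_mul_cancel₀ _ hwn.ne'])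
    rw [map_add, h1, zero_add, map_smul, smul_eq_mul] at h2
    have h3 : c / ‖w‖ ≠ 0 := by positivity
    simpa [h3] using h2
  · have : u =ᶠ[𝓝 x] fun _ => (0 : ℝ) := by
      filter_upwards [isClosed_closure.isOpen_compl.mem_nhds hxc] with y hy
      exact hu y fun h => hy (subset_closure h)
    rw [this.fderiv_eq, fderiv_fun_const]; rfl

/-! ### The finite difference Dirichlet problem and the discrete maximum principle -/

/-- The average of `u` over the six neighbours of `x` at distance `h` along the coordinate axes. -/
noncomputable def nbrAvg (h : ℝ) (u : E3 → ℝ) (x : E3) : ℝ :=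
  (∑ i : Fin 3, (u (x + h • EuclideanSpace.single i 1) + u (x - h • EuclideanSpace.single i 1))) / 6

theorem nbrAvg_mono {h : ℝ} {u v : E3 → ℝ} {x : E3}
    (huv : ∀ i : Fin 3, u (x + h • EuclideanSpace.single i 1) ≤ v (x + h • EuclideanSpace.single i 1) ∧
      u (x - h • EuclideanSpace.single i 1) ≤ v (x - h • EuclideanSpace.single i 1)) :
    nbrAvg h u x ≤ nbrAvg h v x := by
  unfold nbrAvg
  gcongr with i
  exacts [(huv i).1, (huv i).2]

theorem nbrAvg_sub (h : ℝ) (u v : E3 → ℝ) (x : E3) :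
    nbrAvg h (fun y => u y - v y) x = nbrAvg h u x - nbrAvg h v x := by
  simp only [nbrAvg, Fin.sum_univ_three]; ring

theorem nbrAvg_add (h : ℝ) (u v : E3 → ℝ) (x : E3) :
    nbrAvg h (fun y => u y + v y) x = nbrAvg h u x + nbrAvg h v x := by
  simp only [nbrAvg, Fin.sum_univ_three]; ring

theorem nbrAvg_const_mul (h c : ℝ) (u : E3 → ℝ) (x : E3) :
    nbrAvg h (fun y => c * u y) x = c * nbrAvg h u x := by
  simp only [nbrAvg, Fin.sum_univ_three]; ring

theorem nbrAvg_const (h c : ℝ) (x : E3) : nbrAvg h (fun _ => c) x = c := by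
  simp only [nbrAvg, Fin.sum_univ_three]; ring

theorem nbrAvg_neg (h : ℝ) (u : E3 → ℝ) (x : E3) :
    nbrAvg h (fun y => -u y) x = -nbrAvg h u x := by
  simp only [nbrAvg, Fin.sum_univ_three]; ring

theorem nbrAvg_translate (h : ℝ) (u : E3 → ℝ) (k x : E3) :
    nbrAvg h (fun y => u (y + k)) x = nbrAvg h u (x + k) := by
  simp only [nbrAvg, sub_eq_add_neg, add_right_comm]

theorem norm_add_smul_single_sq (x : E3) (h : ℝ) (i : Fin 3) :
    ‖x + h • EuclideanSpace.single i (1 : ℝ)‖ ^ 2 = ‖x‖ ^ 2 + 2 * h * x i + h ^ 2 := by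
  rw [norm_add_sq_real, inner_smul_right, norm_smul, EuclideanSpace.inner_single_right]
  simp; ring

theorem norm_sub_smul_single_sq (x : E3) (h : ℝ) (i : Fin 3) :
    ‖x - h • EuclideanSpace.single i (1 : ℝ)‖ ^ 2 = ‖x‖ ^ 2 - 2 * h * x i + h ^ 2 := by
  rw [norm_sub_sq_real, inner_smul_right, norm_smul, EuclideanSpace.inner_single_right]
  simp; ring

theorem norm_smul_single (h : ℝ) (i : Fin 3) :
    ‖h • EuclideanSpace.single i (1 : ℝ)‖ = |h| := by
  simp [norm_smul]

theorem nbrAvg_norm_sq (h : ℝ) (x : E3) :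
    nbrAvg h (fun y => ‖y‖ ^ 2) x = ‖x‖ ^ 2 + h ^ 2 := by
  simp only [nbrAvg, norm_add_smul_single_sq, norm_sub_smul_single_sq, Fin.sum_univ_three]; ring

/-- Discrete maximum principle for strict subsolutions.  The margin `δ` makes a point where `v` is
close to its supremum sufficient, as the supremum need not be attained. -/
theorem le_zero_of_lt_nbrAvg {S : Set E3} {h δ M : ℝ} {v : E3 → ℝ} (hδ : 0 < δ)
    (hM : ∀ x ∈ S, v x ≤ M) (hsub : ∀ x ∈ S, v x + δ ≤ nbrAvg h v x)
    (hbd : ∀ x ∈ S, ∀ z ∉ S, ‖z - x‖ = |h| → v z ≤ 0) :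
    ∀ x ∈ S, v x ≤ 0 := by
  intro x₀ hx₀
  by_contra hpos
  push Not at hpos
  have hne : (v '' S).Nonempty := ⟨_, x₀, hx₀, rfl⟩
  have hba : BddAbove (v '' S) := ⟨M, by rintro _ ⟨x, hx, rfl⟩; exact hM x hx⟩
  set m := sSup (v '' S) with hm
  have hle : ∀ x ∈ S, v x ≤ m := fun x hx => le_csSup hba ⟨x, hx, rfl⟩
  have hm0 : 0 < m := hpos.trans_le (hle x₀ hx₀)
  obtain ⟨_, ⟨x, hx, rfl⟩, hlt⟩ := exists_lt_of_lt_csSup hne (show m - δ < m by linarith)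
  have hnb : ∀ z, ‖z - x‖ = |h| → v z ≤ m := fun z hz => by
    by_cases hzS : z ∈ S
    · exact hle z hzS
    · exact (hbd x hx z hzS hz).trans hm0.le
  have := nbrAvg_mono (h := h) (u := v) (v := fun _ => m) (x := x) fun i =>
    ⟨hnb _ (by rw [add_sub_cancel_left, norm_smul_single]),
      hnb _ (by rw [sub_sub_cancel_left, norm_neg, norm_smul_single])⟩
  rw [nbrAvg_const] at this
  linarith [hsub x hx]

/-- `u` solves the finite difference Dirichlet problem with mesh `h` for `Δu = f` in `A`,
`u = 0` off `A`.  There is no grid: the equation is imposed at every point of `A`. -/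
structure IsDiscreteSol (A : Set E3) (f : E3 → ℝ) (h : ℝ) (u : E3 → ℝ) : Prop where
  zero : ∀ x ∉ A, u x = 0
  eq : ∀ x ∈ A, u x = nbrAvg h u x - h ^ 2 / 6 * f x

theorem IsDiscreteSol.neg {A : Set E3} {f : E3 → ℝ} {h : ℝ} {u : E3 → ℝ}
    (hu : IsDiscreteSol A f h u) : IsDiscreteSol A (fun x => -f x) h fun x => -u x where
  zero x hx := by rw [hu.zero x hx, neg_zero]
  eq x hx := by rw [nbrAvg_neg, hu.eq x hx]; ring

/-- Solutions of the finite difference problem, by monotone iteration between two paraboloids. -/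
theorem exists_isDiscreteSol {A : Set E3} (hAm : MeasurableSet A) {R : ℝ}
    (hAR : ∀ x ∈ A, ‖x‖ + 1 ≤ R) {f : E3 → ℝ} (hf : Measurable f) {M : ℝ} (hM : ∀ x, |f x| ≤ M)
    {h : ℝ} (hh : 0 ≤ h) (hh1 : h ≤ 1) :
    ∃ u : E3 → ℝ, Measurable u ∧ (∀ x, |u x| ≤ M * R ^ 2) ∧ IsDiscreteSol A f h u := by
  classical
  have hM0 : 0 ≤ M := (abs_nonneg _).trans (hM 0)
  -- `q` satisfies `nbrAvg h q = q - M * h ^ 2`, and `M * h ^ 2` exceeds the source `h ^ 2 / 6 * f`,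
  -- so that `b` and `-b` are a super- and a subsolution
  set q : E3 → ℝ := fun x => M * (R ^ 2 - ‖x‖ ^ 2) with hq
  set b : E3 → ℝ := A.indicator q with hb
  have hqA : ∀ x ∈ A, ∀ z, ‖z - x‖ ≤ h → 0 ≤ q z := by
    intro x hx z hz
    have h1 : ‖z‖ ≤ R := by
      have := norm_le_norm_add_norm_sub' z x
      linarith [hAR x hx]
    have : ‖z‖ ^ 2 ≤ R ^ 2 := by gcongr
    exact mul_nonneg hM0 (by linarith)
  have hb0 : ∀ x, 0 ≤ b x := by
    intro x
    by_cases hx : x ∈ A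
    · simpa [hb, hx] using hqA x hx x (by simpa using hh)
    · simp [hb, hx]
  have hbq : ∀ x ∈ A, nbrAvg h b x ≤ q x - M * h ^ 2 := by
    intro x hx
    have hle : ∀ z, ‖z - x‖ ≤ h → b z ≤ q z := fun z hz => by
      by_cases hzA : z ∈ A
      · simp [hb, hzA]
      · simpa [hb, hzA] using hqA x hx z hz
    have h1 : nbrAvg h b x ≤ nbrAvg h q x := nbrAvg_mono fun i =>
      ⟨hle _ (by rw [add_sub_cancel_left, norm_smul_single, abs_of_nonneg hh]),
        hle _ (by rw [sub_sub_cancel_left, norm_neg, norm_smul_single, abs_of_nonneg hh])⟩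
    have h2 : nbrAvg h q x = q x - M * h ^ 2 := by
      rw [hq, nbrAvg_const_mul, nbrAvg_sub, nbrAvg_norm_sq, nbrAvg_const]; ring
    linarith
  set T : (E3 → ℝ) → E3 → ℝ := fun u => A.indicator fun x => nbrAvg h u x - h ^ 2 / 6 * f x with hT
  have hTmono : Monotone T := by
    intro u v huv x
    by_cases hx : x ∈ A
    · simp only [hT, indicator_of_mem hx]
      have := nbrAvg_mono (h := h) (x := x) fun i => ⟨huv _, huv _⟩
      linarith
    · simp [hT, hx]
  have hTb : T b ≤ b := by
    intro x
    by_cases hx : x ∈ A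
    · simp only [hT, hb, indicator_of_mem hx]
      have h1 := hbq x hx
      have h2 := (abs_le.1 (hM x)).1
      rw [hb] at h1
      nlinarith [sq_nonneg h, mul_nonneg (sq_nonneg h) hM0]
    · simp [hT, hb, hx]
  have hTb' : (fun x => -b x) ≤ T fun x => -b x := by
    intro x
    by_cases hx : x ∈ A
    · simp only [hT, hb, indicator_of_mem hx, nbrAvg_neg]
      have h1 := hbq x hx
      have h2 := (abs_le.1 (hM x)).2
      rw [hb] at h1
      nlinarith [sq_nonneg h, mul_nonneg (sq_nonneg h) hM0]
    · simp [hT, hb, hx]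
  set s : ℕ → E3 → ℝ := fun n => T^[n] b with hs
  have hsanti : Antitone s := by
    refine antitone_nat_of_succ_le fun n => ?_
    simp only [hs, Function.iterate_succ_apply]
    exact hTmono.iterate n hTb
  have hslow : ∀ n, (fun x => -b x) ≤ s n := by
    intro n
    induction n with
    | zero => intro x; simp only [hs, Function.iterate_zero, id]; linarith [hb0 x]
    | succ n ih =>
      refine hTb'.trans ?_
      simp only [hs, Function.iterate_succ_apply'] at ih ⊢
      exact hTmono ih
  have hsub : ∀ n, s n ≤ b := fun n => hsanti (Nat.zero_le n)
  have hsm : ∀ n, Measurable (s n) := by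
    have hbm : Measurable b := by
      refine Measurable.indicator ?_ hAm
      exact (by fun_prop : Continuous q).measurable
    intro n
    induction n with
    | zero => exact hbm
    | succ n ih =>
      simp only [hs, Function.iterate_succ_apply'] at ih ⊢
      refine Measurable.indicator ?_ hAm
      unfold nbrAvg
      refine Measurable.sub (Measurable.div_const (Finset.measurable_sum _ fun i _ => ?_) _)
        (hf.const_mul _)
      exact (ih.comp (measurable_id.add_const _)).add (ih.comp (measurable_id.sub_const _))
  have hlim : ∀ x, ∃ l, Tendsto (fun n => s n x) atTop (𝓝 l) := fun x =>
    ⟨_, tendsto_atTop_ciInf (fun m n hmn => hsanti hmn x)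
      ⟨-b x, by rintro _ ⟨n, rfl⟩; exact hslow n x⟩⟩
  choose u hu using hlim
  have hul : ∀ x, -b x ≤ u x := fun x => ge_of_tendsto' (hu x) fun n => hslow n x
  have huu : ∀ x, u x ≤ b x := fun x => le_of_tendsto' (hu x) fun n => hsub n x
  refine ⟨u, measurable_of_tendsto_metrizable hsm (tendsto_pi_nhds.2 hu), fun x => ?_, ⟨?_, ?_⟩⟩
  · have hbM : b x ≤ M * R ^ 2 := by
      by_cases hx : x ∈ A
      · simp only [hb, indicator_of_mem hx, hq]
        exact mul_le_mul_of_nonneg_left (by linarith [sq_nonneg ‖x‖]) hM0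
      · simp only [hb, indicator_of_notMem hx]; positivity
    exact abs_le.2 ⟨by linarith [hul x], by linarith [huu x]⟩
  · intro x hx
    have h1 := hul x
    have h2 := huu x
    simp only [hb, indicator_of_notMem hx] at h1 h2
    linarith
  · intro x hx
    have h1 : Tendsto (fun n => s (n + 1) x) atTop (𝓝 (u x)) := (hu x).comp (tendsto_add_atTop_nat 1)
    have h2 : Tendsto (fun n => s (n + 1) x) atTop (𝓝 (nbrAvg h u x - h ^ 2 / 6 * f x)) := by
      simp only [hs, Function.iterate_succ_apply', hT, indicator_of_mem hx]
      refine Tendsto.sub_const ?_ _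
      unfold nbrAvg
      refine Tendsto.div_const (tendsto_finsetSum _ fun i _ => ?_) _
      exact (hu _).add (hu _)
    exact tendsto_nhds_unique h1 h2

theorem one_add_sq_div_two_le_cosh (t : ℝ) : 1 + t ^ 2 / 2 ≤ Real.cosh t := by
  have h1 : Real.cosh t = 1 + 2 * Real.sinh (t / 2) ^ 2 := by
    have := Real.cosh_two_mul (t / 2)
    rw [mul_div_cancel₀ _ two_ne_zero, Real.cosh_sq] at this
    linarith
  have h2 : (t / 2) ^ 2 ≤ Real.sinh (t / 2) ^ 2 := by
    rw [sq_le_sq, Real.abs_sinh]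
    exact Real.self_le_sinh_iff.2 (abs_nonneg _)
  rw [h1]; linarith

/-- The function `x ↦ exp (-α |x|²)` is a strict discrete subsolution where `α |x|² ≥ 4`. -/
theorem nbrAvg_gaussian_ge {α h : ℝ} (hα : 0 < α) (hh : α * h ^ 2 ≤ 1 / 4) {x : E3}
    (hx : 4 ≤ α * ‖x‖ ^ 2) :
    Real.exp (-(α * ‖x‖ ^ 2)) * (1 + α * h ^ 2) ≤
      nbrAvg h (fun y => Real.exp (-(α * ‖y‖ ^ 2))) x := by
  have hterm : ∀ i : Fin 3, Real.exp (-(α * ‖x‖ ^ 2)) *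
      (2 * (1 - α * h ^ 2) + 3 * α ^ 2 * h ^ 2 * x i ^ 2) ≤
      Real.exp (-(α * ‖x + h • EuclideanSpace.single i (1 : ℝ)‖ ^ 2)) +
        Real.exp (-(α * ‖x - h • EuclideanSpace.single i (1 : ℝ)‖ ^ 2)) := by
    intro i
    rw [norm_add_smul_single_sq, norm_sub_smul_single_sq]
    have e1 : Real.exp (-(α * (‖x‖ ^ 2 + 2 * h * x i + h ^ 2))) +
        Real.exp (-(α * (‖x‖ ^ 2 - 2 * h * x i + h ^ 2))) =
        Real.exp (-(α * ‖x‖ ^ 2)) *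
          (Real.exp (-(α * h ^ 2)) * (2 * Real.cosh (2 * α * h * x i))) := by
      have e2 : -(α * (‖x‖ ^ 2 + 2 * h * x i + h ^ 2)) =
          -(α * ‖x‖ ^ 2) + (-(α * h ^ 2) + -(2 * α * h * x i)) := by ring
      have e3 : -(α * (‖x‖ ^ 2 - 2 * h * x i + h ^ 2)) =
          -(α * ‖x‖ ^ 2) + (-(α * h ^ 2) + 2 * α * h * x i) := by ring
      rw [Real.cosh_eq, e2, e3]
      simp only [Real.exp_add]
      ring
    rw [e1]
    refine mul_le_mul_of_nonneg_left ?_ (Real.exp_pos _).le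
    have h1 : 1 - α * h ^ 2 ≤ Real.exp (-(α * h ^ 2)) := by
      have := Real.add_one_le_exp (-(α * h ^ 2)); linarith
    have h2 : 1 + (2 * α * h * x i) ^ 2 / 2 ≤ Real.cosh (2 * α * h * x i) :=
      one_add_sq_div_two_le_cosh _
    have h3 : (1 - α * h ^ 2) * (2 * (1 + (2 * α * h * x i) ^ 2 / 2)) ≤
        Real.exp (-(α * h ^ 2)) * (2 * Real.cosh (2 * α * h * x i)) := by
      have : 0 ≤ 1 - α * h ^ 2 := by linarith
      gcongr
    refine le_trans ?_ h3
    have h4 : 0 ≤ α ^ 2 * h ^ 2 * x i ^ 2 := by positivity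
    nlinarith
  have hsum := Finset.sum_le_sum fun i (_ : i ∈ Finset.univ) => hterm i
  have hx2 : ‖x‖ ^ 2 = x 0 ^ 2 + x 1 ^ 2 + x 2 ^ 2 := by
    rw [EuclideanSpace.norm_sq_eq, Fin.sum_univ_three]; simp
  unfold nbrAvg
  rw [le_div_iff₀ (by norm_num)]
  refine le_trans ?_ hsum
  rw [← Finset.mul_sum, mul_assoc]
  refine mul_le_mul_of_nonneg_left ?_ (Real.exp_pos _).le
  rw [Fin.sum_univ_three]
  have h5 : 4 * (α * h ^ 2) ≤ α * h ^ 2 * (α * (x 0 ^ 2 + x 1 ^ 2 + x 2 ^ 2)) := by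
    rw [← hx2, mul_comm 4]; gcongr
  nlinarith

/-! ### Uniform Lipschitz estimates for finite difference solutions -/

/-- One-sided boundary estimate at a point `x₀` touched by an exterior ball, by comparison with a
Gaussian barrier centred at the centre of that ball. -/
theorem IsDiscreteSol.le_of_exterior_ball {A : Set E3} {s D M : ℝ} (hs : 0 < s) (hD : 0 < D)
    (hM : 0 ≤ M) :
    ∃ C h₀ : ℝ, 0 < C ∧ 0 < h₀ ∧ ∀ (f : E3 → ℝ) (h : ℝ) (u : E3 → ℝ) (x₀ y : E3) (B : ℝ),
      0 < h → h ≤ h₀ → (∀ x, |f x| ≤ M) → (∀ x, u x ≤ B) → IsDiscreteSol A f h u →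
      ‖x₀ - y‖ = s → (∀ x ∈ A, s ≤ ‖x - y‖ ∧ ‖x - y‖ ≤ D) →
      ∀ x ∈ A, u x ≤ C * (‖x - x₀‖ + h) := by
  -- `α` makes the Gaussian subharmonic outside the ball; `Λ` makes the Laplacian of the barrier
  -- dominate `f` on `A`, where the Gaussian is at least `E`
  set α : ℝ := 4 / s ^ 2 with hα
  have hαpos : 0 < α := by positivity
  have hαs : α * s ^ 2 = 4 := by rw [hα]; field_simp
  set E : ℝ := Real.exp (-(α * D ^ 2)) with hE
  have hEpos : 0 < E := Real.exp_pos _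
  set Λ : ℝ := (M + 1) / (α * E) with hΛ
  have hΛpos : 0 < Λ := by positivity
  have hΛE : Λ * (α * E) = M + 1 := by rw [hΛ]; field_simp
  refine ⟨Λ * (2 * α * D), s / 4, by positivity, by positivity, ?_⟩
  intro f h u x₀ y B hh hh₀ hf hB hu hx₀ hA
  have hαh : α * h ^ 2 ≤ 1 / 4 := by
    calc α * h ^ 2 ≤ α * (s / 4) ^ 2 := by gcongr
      _ = (α * s ^ 2) / 16 := by ring
      _ = 1 / 4 := by rw [hαs]; norm_num
  -- `w` vanishes on the sphere through `x₀`; a neighbour of a point of `A` may lie inside the ball,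
  -- where `w` is negative, but not below `-2 * α * D * h`
  set w : E3 → ℝ := fun z => Real.exp (-(α * s ^ 2)) - Real.exp (-(α * ‖z + -y‖ ^ 2)) with hw
  have hwavg : ∀ x ∈ A, nbrAvg h w x ≤ w x - α * h ^ 2 * E := by
    intro x hx
    obtain ⟨h1, h2⟩ := hA x hx
    rw [sub_eq_add_neg] at h1 h2
    have h3 := nbrAvg_gaussian_ge hαpos hαh (x := x + -y) (by rw [← hαs]; gcongr)
    have h4 : nbrAvg h w x = Real.exp (-(α * s ^ 2)) -
        nbrAvg h (fun z => Real.exp (-(α * ‖z‖ ^ 2))) (x + -y) := by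
      rw [hw, nbrAvg_sub, nbrAvg_const, ← nbrAvg_translate]
    have h5 : E ≤ Real.exp (-(α * ‖x + -y‖ ^ 2)) := Real.exp_le_exp.2 (by
      have : α * ‖x + -y‖ ^ 2 ≤ α * D ^ 2 := by gcongr
      linarith)
    have h6 : α * h ^ 2 * E ≤ α * h ^ 2 * Real.exp (-(α * ‖x + -y‖ ^ 2)) := by gcongr
    rw [h4]
    simp only [hw]
    linarith
  have hwlow : ∀ x ∈ A, ∀ z, ‖z - x‖ = |h| → -(2 * α * D * h) ≤ w z := by
    intro x hx z hz
    rw [abs_of_pos hh] at hz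
    obtain ⟨h1, h2⟩ := hA x hx
    have h3 : s ^ 2 - 2 * D * h ≤ ‖z + -y‖ ^ 2 := by
      have e : z + -y = (x - y) + (z - x) := by abel
      have h4 := (abs_le.1 (abs_real_inner_le_norm (x - y) (z - x))).1
      rw [e, norm_add_sq_real, hz]
      rw [hz] at h4
      have : s ^ 2 ≤ ‖x - y‖ ^ 2 := by gcongr
      have : ‖x - y‖ * h ≤ D * h := by gcongr
      nlinarith [sq_nonneg h]
    have h4 : Real.exp (-(α * ‖z + -y‖ ^ 2)) ≤ Real.exp (-(α * s ^ 2) + 2 * α * D * h) :=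
      Real.exp_le_exp.2 (by nlinarith)
    have h5 : 0 ≤ 2 * α * D * h := by positivity
    simp only [hw]
    by_cases hle : ‖z + -y‖ ^ 2 ≤ s ^ 2
    · -- `exp (-b) - exp (-a) ≤ a - b` for `0 ≤ b ≤ a`
      have h6 := Real.add_one_le_exp (-(α * s ^ 2 - α * ‖z + -y‖ ^ 2))
      have h7 : Real.exp (-(α * s ^ 2)) = Real.exp (-(α * ‖z + -y‖ ^ 2)) *
          Real.exp (-(α * s ^ 2 - α * ‖z + -y‖ ^ 2)) := by rw [← Real.exp_add]; congr 1; ring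
      have h8 : Real.exp (-(α * ‖z + -y‖ ^ 2)) ≤ 1 := Real.exp_le_one_iff.2 (by
        have : 0 ≤ α * ‖z + -y‖ ^ 2 := by positivity
        linarith)
      have h9 : 0 ≤ α * (s ^ 2 - ‖z + -y‖ ^ 2) := mul_nonneg hαpos.le (by linarith)
      have h10 : α * (s ^ 2 - ‖z + -y‖ ^ 2) ≤ 2 * α * D * h := by nlinarith
      rw [h7]
      nlinarith [Real.exp_pos (-(α * ‖z + -y‖ ^ 2))]
    · push Not at hle
      have : Real.exp (-(α * ‖z + -y‖ ^ 2)) ≤ Real.exp (-(α * s ^ 2)) := Real.exp_le_exp.2 (by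
        have : α * s ^ 2 ≤ α * ‖z + -y‖ ^ 2 := by gcongr
        linarith)
      linarith
  have hwup : ∀ x ∈ A, w x ≤ 2 * α * D * ‖x - x₀‖ := by
    intro x hx
    obtain ⟨h1, h2⟩ := hA x hx
    have h3 : ‖x - y‖ - s ≤ ‖x - x₀‖ := by
      have := norm_sub_norm_le (x - y) (x₀ - y)
      rwa [hx₀, sub_sub_sub_cancel_right] at this
    have h4 := Real.add_one_le_exp (-(α * ‖x - y‖ ^ 2 - α * s ^ 2))
    have h5 : Real.exp (-(α * ‖x - y‖ ^ 2)) = Real.exp (-(α * s ^ 2)) *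
        Real.exp (-(α * ‖x - y‖ ^ 2 - α * s ^ 2)) := by rw [← Real.exp_add]; congr 1; ring
    have h6 : Real.exp (-(α * s ^ 2)) ≤ 1 := Real.exp_le_one_iff.2 (by
      have : 0 ≤ α * s ^ 2 := by positivity
      linarith)
    have h7 : 0 ≤ α * (‖x - y‖ ^ 2 - s ^ 2) := mul_nonneg hαpos.le (by nlinarith)
    have h8 : w x ≤ α * (‖x - y‖ ^ 2 - s ^ 2) := by
      simp only [hw, ← sub_eq_add_neg]
      rw [h5]
      nlinarith [Real.exp_pos (-(α * s ^ 2))]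
    refine h8.trans ?_
    have h9 : ‖x - y‖ ^ 2 - s ^ 2 ≤ 2 * D * ‖x - x₀‖ := by
      have e : ‖x - y‖ ^ 2 - s ^ 2 = (‖x - y‖ + s) * (‖x - y‖ - s) := by ring
      have : ‖x - y‖ + s ≤ 2 * D := by linarith
      rw [e]
      calc _ ≤ (‖x - y‖ + s) * ‖x - x₀‖ := by gcongr
        _ ≤ _ := by gcongr
    calc _ ≤ α * (2 * D * ‖x - x₀‖) := by gcongr
      _ = _ := by ring
  have key := le_zero_of_lt_nbrAvg (S := A) (h := h) (δ := h ^ 2 * (5 / 6)) (M := B)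
    (v := fun z => u z - Λ * (w z + 2 * α * D * h)) (by positivity) ?_ ?_ ?_
  · intro x hx
    have h1 := key x hx
    have h2 := hwup x hx
    calc u x ≤ Λ * (w x + 2 * α * D * h) := by linarith
      _ ≤ Λ * (2 * α * D * ‖x - x₀‖ + 2 * α * D * h) := by gcongr
      _ = _ := by ring
  · intro x hx
    have h1 := hwlow x hx
    have h2 : 0 ≤ w x + 2 * α * D * h := by
      have : 0 ≤ w x := by
        simp only [hw, ← sub_eq_add_neg, sub_nonneg]
        refine Real.exp_le_exp.2 ?_
        have : α * s ^ 2 ≤ α * ‖x - y‖ ^ 2 := by have := (hA x hx).1; gcongr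
        linarith
      positivity
    have := mul_nonneg hΛpos.le h2
    have := hB x
    linarith
  · intro x hx
    have h1 := hwavg x hx
    have h2 := (abs_le.1 (hf x)).1
    have h3 : Λ * nbrAvg h w x ≤ Λ * w x - h ^ 2 * (M + 1) := by
      calc _ ≤ Λ * (w x - α * h ^ 2 * E) := by gcongr
        _ = Λ * w x - h ^ 2 * (Λ * (α * E)) := by ring
        _ = _ := by rw [hΛE]
    rw [nbrAvg_sub, nbrAvg_const_mul, nbrAvg_add, nbrAvg_const]
    rw [hu.eq x hx]
    nlinarith [sq_nonneg h, mul_nonneg (sq_nonneg h) hM]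
  · intro x hx z hz hzx
    have h1 := hwlow x hx z hzx
    simp only [hu.zero z hz]
    have := mul_nonneg hΛpos.le (show 0 ≤ w z + 2 * α * D * h by linarith)
    linarith

/-- A segment from a point of an open set to a point of its complement meets the boundary. -/
theorem exists_mem_frontier_segment {A : Set E3} (hA : IsOpen A) {x z : E3} (hx : x ∈ A)
    (hz : z ∉ A) : ∃ y ∈ frontier A, ‖x - y‖ ≤ ‖z - x‖ := by
  by_contra hcon
  push Not at hcon
  have hsub : segment ℝ x z ⊆ A := by
    refine (convex_segment x z).isPreconnected.subset_left_of_subset_union hA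
      isClosed_closure.isOpen_compl (disjoint_compl_right_iff_subset.2 subset_closure) ?_
      ⟨x, left_mem_segment ℝ x z, hx⟩
    intro y hy
    by_contra hy'
    simp only [mem_union, mem_compl_iff, not_or, not_not] at hy'
    have h1 := hcon y (by rw [frontier, hA.interior_eq]; exact ⟨hy'.2, hy'.1⟩)
    have h2 := norm_sub_le_of_mem_segment hy
    rw [norm_sub_rev] at h2
    linarith
  exact hz (hsub (right_mem_segment ℝ x z))

/-- Uniform Lipschitz estimate, up to the mesh size, for the finite difference problem: the
difference of a solution and its translate is small off `A` by the boundary estimate, hence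
everywhere by the maximum principle. -/
theorem IsDiscreteSol.exists_abs_sub_le {A : Set E3} (hAo : IsOpen A) {R : ℝ}
    (hAR : ∀ x ∈ A, ‖x‖ + 1 ≤ R) {s : ℝ} (hs : 0 < s)
    (hball : ∀ x₀ ∈ frontier A, ∃ y, ‖x₀ - y‖ = s ∧ ∀ x ∈ A, s ≤ ‖x - y‖)
    {f : E3 → ℝ} {M L : ℝ} (hM : ∀ x, |f x| ≤ M) (hL : ∀ x y, |f x - f y| ≤ L * ‖x - y‖) :
    ∃ C h₀ : ℝ, 0 < C ∧ 0 < h₀ ∧ ∀ (h : ℝ) (u : E3 → ℝ) (B : ℝ), 0 < h → h ≤ h₀ →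
      (∀ x, |u x| ≤ B) → IsDiscreteSol A f h u → ∀ x z, |u x - u z| ≤ C * (‖x - z‖ + h) := by
  rcases A.eq_empty_or_nonempty with rfl | ⟨a, ha⟩
  · refine ⟨1, 1, one_pos, one_pos, fun h u B hh _ _ hu x z => ?_⟩
    rw [hu.zero x (notMem_empty _), hu.zero z (notMem_empty _), sub_zero, abs_zero]
    positivity
  have hM0 : 0 ≤ M := (abs_nonneg _).trans (hM 0)
  have hR1 : 1 ≤ R := by linarith [hAR a ha, norm_nonneg a]
  have hL0 : 0 ≤ L := by
    have := (abs_nonneg _).trans (hL (EuclideanSpace.single 0 1) 0)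
    simpa using this
  obtain ⟨C, h₀, hC, hh₀, hbar⟩ :=
    IsDiscreteSol.le_of_exterior_ball (A := A) hs (show 0 < 2 * R + s by positivity) hM0
  -- estimate between a point of `A` and a point off `A`
  have hbd : ∀ (h : ℝ) (u : E3 → ℝ) (B : ℝ), 0 < h → h ≤ h₀ → (∀ x, |u x| ≤ B) →
      IsDiscreteSol A f h u → ∀ x, ∀ z ∉ A, |u x - u z| ≤ C * (‖x - z‖ + h) := by
    intro h u B hh hhh hB hu x z hz
    rw [hu.zero z hz, sub_zero]
    by_cases hx : x ∈ A
    swap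
    · rw [hu.zero x hx, abs_zero]; positivity
    obtain ⟨x₀, hx₀, hle⟩ := exists_mem_frontier_segment hAo hx hz
    obtain ⟨y, hy, hyA⟩ := hball x₀ hx₀
    have hx₀R : ‖x₀‖ ≤ R := by
      have : closure A ⊆ closedBall 0 R := closure_minimal (fun x hx => by
        simpa using (by linarith [hAR x hx] : ‖x‖ ≤ R)) isClosed_closedBall
      simpa using this (frontier_subset_closure hx₀)
    have hyA' : ∀ x ∈ A, s ≤ ‖x - y‖ ∧ ‖x - y‖ ≤ 2 * R + s := fun x hx => by
      refine ⟨hyA x hx, ?_⟩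
      have e : x - y = x - x₀ + (x₀ - y) := by abel
      have h1 := norm_add_le (x - x₀) (x₀ - y)
      have h2 := norm_sub_le x x₀
      rw [e]
      linarith [hAR x hx]
    have h1 := hbar f h u x₀ y B hh hhh hM (fun x => (le_abs_self _).trans (hB x)) hu hy hyA' x hx
    have h2 := hbar (fun x => -f x) h (fun x => -u x) x₀ y B hh hhh (by simpa using hM)
      (fun x => (neg_le_abs _).trans (hB x)) hu.neg hy hyA' x hx
    have h3 : C * (‖x - x₀‖ + h) ≤ C * (‖x - z‖ + h) := by
      rw [norm_sub_rev x z]; gcongr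
    exact abs_le.2 ⟨by linarith, by linarith⟩
  refine ⟨C + L * R ^ 2 + R ^ 2, min h₀ 1, by positivity, by positivity, ?_⟩
  intro h u B hh hhh hB hu
  have hhh₀ := hhh.trans (min_le_left _ _)
  have hh1 := hhh.trans (min_le_right _ _)
  have hC' : ∀ d : ℝ, 0 ≤ d → C * (d + h) + (L * d + h) * R ^ 2 ≤
      (C + L * R ^ 2 + R ^ 2) * (d + h) := by
    intro d hd
    have : 0 ≤ L * R ^ 2 * h := by positivity
    have : 0 ≤ R ^ 2 * d := by positivity
    nlinarith
  have hCle : ∀ d : ℝ, 0 ≤ d → C * (d + h) ≤ (C + L * R ^ 2 + R ^ 2) * (d + h) := by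
    intro d hd
    gcongr
    have : 0 ≤ L * R ^ 2 := by positivity
    nlinarith [sq_nonneg R]
  have honeside : ∀ (σ : ℝ), |σ| = 1 → ∀ k x, x ∈ A → x + k ∈ A →
      σ * (u (x + k) - u x) ≤ (C + L * R ^ 2 + R ^ 2) * (‖k‖ + h) := by
    intro σ hσ k x hx hxk
    -- `f (x + k) - f x` is at most `L * ‖k‖`, which the paraboloid with coefficient `κ` compensates;
    -- the extra `h` in `κ` provides strictness
    set κ := L * ‖k‖ + h with hκ
    have hκ0 : 0 ≤ κ := by positivity
    have hin : ∀ x ∈ A, ∀ z, ‖z - x‖ = |h| → 0 ≤ R ^ 2 - ‖z‖ ^ 2 := by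
      intro x hx z hz
      rw [abs_of_pos hh] at hz
      have : ‖z‖ ≤ R := by
        have := norm_le_norm_add_norm_sub' z x
        linarith [hAR x hx]
      have : ‖z‖ ^ 2 ≤ R ^ 2 := by gcongr
      linarith
    have hσle : ∀ t : ℝ, σ * t ≤ |t| := fun t => by
      have := le_abs_self (σ * t)
      rwa [abs_mul, hσ, one_mul] at this
    have key := le_zero_of_lt_nbrAvg (S := {x | x ∈ A ∧ x + k ∈ A}) (h := h) (δ := h ^ 3 / 2)
      (M := 2 * B)
      (v := fun z => σ * (u (z + k) - u z) - (C * (‖k‖ + h) + κ * (R ^ 2 - ‖z‖ ^ 2)))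
      (by positivity) ?_ ?_ ?_
    · have h1 := key x ⟨hx, hxk⟩
      have h2 : κ * (R ^ 2 - ‖x‖ ^ 2) ≤ κ * R ^ 2 := by gcongr; nlinarith [sq_nonneg ‖x‖]
      have h3 := hC' ‖k‖ (norm_nonneg k)
      linarith
    · rintro x ⟨hx, hxk⟩
      have h1 := hσle (u (x + k) - u x)
      have h2 := abs_sub (u (x + k)) (u x)
      have h3 := hB (x + k)
      have h4 := hB x
      have h5 : 0 ≤ R ^ 2 - ‖x‖ ^ 2 := by
        have : ‖x‖ ≤ R := by linarith [hAR x hx]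
        have : ‖x‖ ^ 2 ≤ R ^ 2 := by gcongr
        linarith
      have h6 : 0 ≤ C * (‖k‖ + h) + κ * (R ^ 2 - ‖x‖ ^ 2) := by positivity
      linarith
    · rintro x ⟨hx, hxk⟩
      have h1 := hu.eq x hx
      have h2 := hu.eq _ hxk
      have h3 : σ * -(f (x + k) - f x) ≤ L * ‖k‖ := by
        refine (hσle _).trans ?_
        rw [abs_neg]
        simpa using hL (x + k) x
      rw [nbrAvg_sub, nbrAvg_const_mul, nbrAvg_sub, nbrAvg_translate, nbrAvg_add, nbrAvg_const,
        nbrAvg_const_mul, nbrAvg_sub, nbrAvg_const, nbrAvg_norm_sq]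
      have h4 : σ * (u (x + k) - u x) =
          σ * (nbrAvg h u (x + k) - nbrAvg h u x) + h ^ 2 / 6 * (σ * -(f (x + k) - f x)) := by
        rw [h1, h2]; ring
      have h5 : h ^ 2 / 6 * (σ * -(f (x + k) - f x)) ≤ h ^ 2 / 6 * (L * ‖k‖) := by gcongr
      have h6 : κ * h ^ 2 = h ^ 2 * (L * ‖k‖) + h ^ 3 := by rw [hκ]; ring
      have h7 : 0 ≤ h ^ 2 * (L * ‖k‖) := by positivity
      have h8 : 0 < h ^ 3 := by positivity
      rw [h4]
      nlinarith
    · rintro x ⟨hx, hxk⟩ z hz hzx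
      have h1 := hσle (u (z + k) - u z)
      have h2 : |u (z + k) - u z| ≤ C * (‖k‖ + h) := by
        by_cases hzA : z ∈ A
        · have hzk : z + k ∉ A := fun h => hz ⟨hzA, h⟩
          have := hbd h u B hh hhh₀ hB hu z _ hzk
          rw [abs_sub_comm]
          simpa using this
        · have := hbd h u B hh hhh₀ hB hu (z + k) z hzA
          simpa using this
      have h3 := mul_nonneg hκ0 (hin x hx z hzx)
      linarith
  intro x z
  by_cases hz : z ∈ A
  swap
  · exact (hbd h u B hh hhh₀ hB hu x z hz).trans (hCle _ (norm_nonneg _))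
  by_cases hx : x ∈ A
  swap
  · rw [abs_sub_comm, norm_sub_rev]
    exact (hbd h u B hh hhh₀ hB hu z x hx).trans (hCle _ (norm_nonneg _))
  have h1 := honeside 1 (by simp) (x - z) z hz (by simpa using hx)
  have h2 := honeside (-1) (by simp) (x - z) z hz (by simpa using hx)
  rw [add_sub_cancel] at h1 h2
  exact abs_le.2 ⟨by linarith, by linarith⟩

/-! ### Lipschitz solutions of the Dirichlet problem -/

/-- The Laplacian, as the sum of the iterated partial derivatives. -/
noncomputable def lap (φ : E3 → ℝ) (x : E3) : ℝ :=
  ∑ i : Fin 3, fderiv ℝ (fun y => fderiv ℝ φ y (EuclideanSpace.single i 1)) x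
    (EuclideanSpace.single i 1)

theorem contDiff_fderiv_apply {F : Type*} [NormedAddCommGroup F] [NormedSpace ℝ F] {φ : E3 → F}
    (hφ : ContDiff ℝ ∞ φ) (v : E3) : ContDiff ℝ ∞ fun y => fderiv ℝ φ y v :=
  (hφ.fderiv_right (m := ∞) (by simp)).clm_apply contDiff_const

theorem hasCompactSupport_fderiv_apply {F : Type*} [NormedAddCommGroup F] [NormedSpace ℝ F]
    {φ : E3 → F} (hφ : HasCompactSupport φ) (v : E3) :
    HasCompactSupport fun y => fderiv ℝ φ y v := hφ.fderiv_apply ℝ v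

theorem exists_lipschitz_of_contDiff {F : Type*} [NormedAddCommGroup F] [NormedSpace ℝ F]
    {φ : E3 → F} (hφ : ContDiff ℝ ∞ φ) (hc : HasCompactSupport φ) :
    ∃ K : ℝ≥0, LipschitzWith K φ :=
  (hφ.of_le (by simp) : ContDiff ℝ 1 φ).lipschitzWith_of_hasCompactSupport hc one_ne_zero

theorem continuous_lap {φ : E3 → ℝ} (hφ : ContDiff ℝ ∞ φ) : Continuous (lap φ) := by
  unfold lap
  exact continuous_finsetSum _ fun i _ =>
    (contDiff_fderiv_apply (contDiff_fderiv_apply hφ _) _).continuous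

/-- Second differences along a line, divided by `h ^ 2`, approximate the second derivative uniformly. -/
theorem exists_abs_secondDiff_sub_le {φ : E3 → ℝ} (hφ : ContDiff ℝ ∞ φ) (hc : HasCompactSupport φ)
    (e : E3) (he : ‖e‖ = 1) :
    ∃ K : ℝ, 0 ≤ K ∧ ∀ x, ∀ h, 0 ≤ h →
      |φ (x + h • e) + φ (x - h • e) - 2 * φ x -
        h ^ 2 * fderiv ℝ (fun y => fderiv ℝ φ y e) x e| ≤ K * h ^ 3 := by
  set ψ : E3 → ℝ := fun y => fderiv ℝ φ y e with hψ
  set χ : E3 → ℝ := fun y => fderiv ℝ ψ y e with hχ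
  have hψs : ContDiff ℝ ∞ ψ := contDiff_fderiv_apply hφ e
  have hχs : ContDiff ℝ ∞ χ := contDiff_fderiv_apply hψs e
  obtain ⟨K, hK⟩ := exists_lipschitz_of_contDiff hχs
    (hasCompactSupport_fderiv_apply (hasCompactSupport_fderiv_apply hc e) e)
  have hline : ∀ (g : E3 → ℝ), ContDiff ℝ ∞ g → ∀ (x : E3) (t : ℝ),
      HasDerivAt (fun t : ℝ => g (x + t • e)) (fderiv ℝ g (x + t • e) e) t ∧
      HasDerivAt (fun t : ℝ => g (x - t • e)) (-fderiv ℝ g (x - t • e) e) t := by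
    intro g hg x t
    have hd : ∀ y, HasFDerivAt g (fderiv ℝ g y) y := fun y =>
      (hg.differentiable (by simp) y).hasFDerivAt
    constructor
    · have hL : HasDerivAt (fun t : ℝ => x + t • e) e t := by
        simpa using ((hasDerivAt_id t).smul_const e).const_add x
      exact (hd _).comp_hasDerivAt t hL
    · have hL : HasDerivAt (fun t : ℝ => x - t • e) (-e) t := by
        simpa using ((hasDerivAt_id t).smul_const e).const_sub x
      rw [← map_neg]; exact (hd _).comp_hasDerivAt t hL
  refine ⟨2 * K, by positivity, fun x h hh => ?_⟩
  have hχK : ∀ t, |t| ≤ h → |χ (x + t • e) - χ x| ≤ K * h := by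
    intro t ht
    have := hK.dist_le_mul (x + t • e) x
    rw [Real.dist_eq, dist_eq_norm, add_sub_cancel_left, norm_smul, he, mul_one] at this
    exact this.trans (by gcongr; exact ht)
  have h1 : ∀ t ∈ Icc 0 h, |ψ (x + t • e) - ψ (x - t • e) - 2 * t * χ x| ≤ 2 * K * h ^ 2 := by
    intro t ht
    have := (convex_Icc (0 : ℝ) h).norm_image_sub_le_of_norm_hasDerivWithin_le
      (f := fun t => ψ (x + t • e) - ψ (x - t • e) - 2 * t * χ x)
      (f' := fun t => χ (x + t • e) - -χ (x - t • e) - 2 * χ x) (C := 2 * (K * h))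
      (fun t _ => by
        have := ((hline ψ hψs x t).1.sub (hline ψ hψs x t).2).sub
          (((hasDerivAt_id t).const_mul 2).mul_const (χ x))
        simp only [mul_one] at this
        exact this.hasDerivWithinAt)
      (fun t ht => by
        rw [Real.norm_eq_abs]
        have a1 := abs_le.1 (hχK t (by rw [abs_of_nonneg ht.1]; exact ht.2))
        have a2 := abs_le.1 (hχK (-t) (by rw [abs_neg, abs_of_nonneg ht.1]; exact ht.2))
        rw [neg_smul, ← sub_eq_add_neg] at a2
        exact abs_le.2 ⟨by linarith [a1.1, a2.1], by linarith [a1.2, a2.2]⟩)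
      (left_mem_Icc.2 hh) ht
    simp only [zero_smul, add_zero, sub_zero, sub_self, mul_zero, zero_mul, Real.norm_eq_abs] at this
    rw [abs_of_nonneg ht.1] at this
    refine this.trans ?_
    calc 2 * (K * h) * t ≤ 2 * (K * h) * h := by gcongr; exact ht.2
      _ = _ := by ring
  have := (convex_Icc (0 : ℝ) h).norm_image_sub_le_of_norm_hasDerivWithin_le
      (f := fun t => φ (x + t • e) + φ (x - t • e) - t ^ 2 * χ x)
      (f' := fun t => ψ (x + t • e) + -ψ (x - t • e) - 2 * t * χ x) (C := 2 * K * h ^ 2)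
      (fun t _ => by
        have := ((hline φ hφ x t).1.add (hline φ hφ x t).2).sub
          ((hasDerivAt_pow 2 t).mul_const (χ x))
        simp only [Nat.cast_ofNat, Nat.add_one_sub_one, pow_one] at this
        exact this.hasDerivWithinAt)
      (fun t ht => by rw [Real.norm_eq_abs, ← sub_eq_add_neg]; exact h1 t ht)
      (left_mem_Icc.2 hh) (right_mem_Icc.2 hh)
  simp only [zero_smul, add_zero, sub_zero, Real.norm_eq_abs, abs_of_nonneg hh] at this
  calc _ = |φ (x + h • e) + φ (x - h • e) - h ^ 2 * χ x - (φ x + φ x - 0 ^ 2 * χ x)| := by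
        congr 1; ring
    _ ≤ 2 * K * h ^ 2 * h := this
    _ = _ := by ring

/-- Consistency of the finite difference Laplacian. -/
theorem exists_abs_nbrAvg_sub_lap_le {φ : E3 → ℝ} (hφ : ContDiff ℝ ∞ φ) (hc : HasCompactSupport φ) :
    ∃ K : ℝ, 0 ≤ K ∧ ∀ x, ∀ h, 0 < h → |6 / h ^ 2 * (nbrAvg h φ x - φ x) - lap φ x| ≤ K * h := by
  choose K hK0 hK using fun i : Fin 3 => exists_abs_secondDiff_sub_le hφ hc
    (EuclideanSpace.single i (1 : ℝ)) (by simp)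
  refine ⟨∑ i, K i, Finset.sum_nonneg fun i _ => hK0 i, fun x h hh => ?_⟩
  have e : 6 / h ^ 2 * (nbrAvg h φ x - φ x) - lap φ x = (∑ i : Fin 3,
      (φ (x + h • EuclideanSpace.single i 1) + φ (x - h • EuclideanSpace.single i 1) - 2 * φ x -
        h ^ 2 * fderiv ℝ (fun y => fderiv ℝ φ y (EuclideanSpace.single i 1)) x
          (EuclideanSpace.single i 1))) / h ^ 2 := by
    have : h ≠ 0 := hh.ne'
    simp only [nbrAvg, lap, Fin.sum_univ_three]
    field_simp
    ring
  rw [e, abs_div, abs_of_pos (by positivity : 0 < h ^ 2), div_le_iff₀ (by positivity)]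
  refine (Finset.abs_sum_le_sum_abs _ _).trans ((Finset.sum_le_sum fun i _ =>
    hK i x h hh.le).trans ?_)
  rw [← Finset.sum_mul, mul_assoc]
  exact le_of_eq (by ring)

/-- The discrete Laplacian is symmetric. -/
theorem integral_mul_nbrAvg {u φ : E3 → ℝ} {B : ℝ} (hu : Measurable u) (hB : ∀ x, |u x| ≤ B)
    (hφ : Continuous φ) (hc : HasCompactSupport φ) (h : ℝ) :
    ∫ x, u x * nbrAvg h φ x = ∫ x, nbrAvg h u x * φ x := by
  have hφi : Integrable φ := hφ.integrable_of_hasCompactSupport hc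
  have hint : ∀ a b : E3, Integrable fun x => u (x + a) * φ (x + b) := by
    intro a b
    refine (hφi.comp_add_right b).bdd_mul (c := B)
      (hu.comp (measurable_add_const a)).aestronglyMeasurable ?_
    exact Eventually.of_forall fun x => hB _
  have hshift : ∀ a : E3, ∫ x, u x * φ (x + a) = ∫ x, u (x + -a) * φ x := by
    intro a
    rw [← integral_add_right_eq_self (fun x => u (x + -a) * φ x) a]
    simp
  have h0 : ∀ a, Integrable fun x => u x * φ (x + a) := fun a => by simpa using hint 0 a
  have h0' : ∀ a, Integrable fun x => u (x + a) * φ x := fun a => by simpa using hint a 0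
  simp only [nbrAvg, Fin.sum_univ_three, mul_div_assoc', mul_add, add_mul, div_mul_eq_mul_div,
    sub_eq_add_neg]
  rw [integral_div, integral_div]
  congr 1
  repeat rw [integral_add (by
    first
      | exact h0 _ | exact h0' _
      | exact (h0 _).add (h0 _) | exact (h0' _).add (h0' _)
      | exact ((h0 _).add (h0 _)).add ((h0 _).add (h0 _))
      | exact ((h0' _).add (h0' _)).add ((h0' _).add (h0' _))) (by
    first
      | exact h0 _ | exact h0' _
      | exact (h0 _).add (h0 _) | exact (h0' _).add (h0' _))]
  simp only [hshift, neg_neg]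
  ring

/-- **Dirichlet problem with bounded gradient.**  In a bounded open set with the uniform exterior
ball property, `Δu = f` has a Lipschitz solution (in the sense of distributions) vanishing off `A`,
for bounded Lipschitz `f`: it is a limit of finite difference solutions. -/
theorem exists_lipschitz_dirichlet {A : Set E3} (hAo : IsOpen A) (hAb : Bornology.IsBounded A)
    {s : ℝ} (hs : 0 < s)
    (hball : ∀ x₀ ∈ frontier A, ∃ y, ‖x₀ - y‖ = s ∧ ∀ x ∈ A, s ≤ ‖x - y‖)
    {f : E3 → ℝ} {M : ℝ} {L : ℝ≥0} (hM : ∀ x, |f x| ≤ M) (hL : LipschitzWith L f) :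
    ∃ (u : E3 → ℝ) (C : ℝ≥0), LipschitzWith C u ∧ (∀ x ∉ A, u x = 0) ∧
      ∀ φ : E3 → ℝ, ContDiff ℝ ∞ φ → HasCompactSupport φ → tsupport φ ⊆ A →
        ∫ x in A, u x * lap φ x = ∫ x in A, f x * φ x := by
  obtain ⟨R₀, hR₀⟩ := hAb.exists_norm_le
  set R := R₀ + 1
  have hAR : ∀ x ∈ A, ‖x‖ + 1 ≤ R := fun x hx => by linarith [hR₀ x hx]
  have hL' : ∀ x y, |f x - f y| ≤ L * ‖x - y‖ := fun x y => by
    simpa [Real.dist_eq, dist_eq_norm] using hL.dist_le_mul x y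
  obtain ⟨C, h₀, hC, hh₀, hest⟩ := IsDiscreteSol.exists_abs_sub_le hAo hAR hs hball hM hL'
  set h : ℕ → ℝ := fun n => min h₀ 1 * (1 / ((n : ℝ) + 1)) with hh
  have hm : 0 < min h₀ 1 := by positivity
  have hhpos : ∀ n, 0 < h n := fun n => by positivity
  have hhle : ∀ n, h n ≤ min h₀ 1 := fun n => by
    refine mul_le_of_le_one_right hm.le ?_
    rw [div_le_one (by positivity)]
    linarith [(Nat.cast_nonneg n : (0 : ℝ) ≤ n)]
  have hhlim : Tendsto h atTop (𝓝 0) := by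
    simpa [hh] using (tendsto_one_div_add_atTop_nhds_zero_nat (𝕜 := ℝ)).const_mul (min h₀ 1)
  choose u hum huB hus using fun n => exists_isDiscreteSol hAo.measurableSet hAR
    hL.continuous.measurable hM (hhpos n).le ((hhle n).trans (min_le_right _ _))
  have huest : ∀ n x z, |u n x - u n z| ≤ C * (‖x - z‖ + h n) := fun n =>
    hest (h n) (u n) _ (hhpos n) ((hhle n).trans (min_le_left _ _)) (huB n) (hus n)
  -- an ultrafilter limit replaces the extraction of a subsequence
  set U : Ultrafilter ℕ := Filter.hyperfilter ℕ with hU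
  have hUle : (U : Filter ℕ) ≤ atTop := Nat.hyperfilter_le_atTop
  have hlim : ∀ x, ∃ l, Tendsto (fun n => u n x) U (𝓝 l) := by
    intro x
    have hmem : ∀ n, u n x ∈ Icc (-(M * R ^ 2)) (M * R ^ 2) := fun n => abs_le.1 (huB n x)
    obtain ⟨l, -, hl⟩ := (isCompact_Icc (a := -(M * R ^ 2)) (b := M * R ^ 2)).ultrafilter_le_nhds
      (U.map fun n => u n x) (by
        rw [Filter.le_principal_iff]
        exact Filter.mem_map.2 (Filter.univ_mem' hmem))
    exact ⟨l, hl⟩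
  choose v hv using hlim
  have hhU : Tendsto h U (𝓝 0) := hhlim.mono_left hUle
  have hvest : ∀ x z, |v x - v z| ≤ C * ‖x - z‖ := by
    intro x z
    have h1 : Tendsto (fun n => |u n x - u n z|) U (𝓝 |v x - v z|) := ((hv x).sub (hv z)).abs
    have h2 : Tendsto (fun n => C * (‖x - z‖ + h n)) U (𝓝 (C * (‖x - z‖ + 0))) :=
      (tendsto_const_nhds.add hhU).const_mul C
    rw [add_zero] at h2
    exact le_of_tendsto_of_tendsto' h1 h2 fun n => huest n x z
  have hvlip : LipschitzWith C.toNNReal v := LipschitzWith.of_dist_le_mul fun x z => by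
    rw [Real.dist_eq, dist_eq_norm, Real.coe_toNNReal _ hC.le]; exact hvest x z
  have hv0 : ∀ x ∉ A, v x = 0 := by
    intro x hx
    refine tendsto_nhds_unique (hv x) ?_
    simp only [(hus _).zero x hx]
    exact tendsto_const_nhds
  have hvB : ∀ x, |v x| ≤ M * R ^ 2 := fun x => le_of_tendsto' (hv x).abs fun n => huB n x
  have hAtb := Metric.totallyBounded_iff.1
    (hAb.isCompact_closure.totallyBounded.subset subset_closure)
  -- equicontinuity up to the mesh size makes the convergence uniform
  have hunif : ∀ ε > 0, ∀ᶠ n in (U : Filter ℕ), ∀ x ∈ A, |u n x - v x| ≤ ε := by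
    intro ε hε
    obtain ⟨t, htf, htc⟩ := hAtb (ε / (8 * C)) (by positivity)
    have h1 : ∀ᶠ n in (U : Filter ℕ), ∀ y ∈ t, |u n y - v y| < ε / 4 := by
      rw [Filter.eventually_all_finite htf]
      intro y _
      have := Metric.tendsto_nhds.1 (hv y) (ε / 4) (by positivity)
      simpa [Real.dist_eq] using this
    have h2 : ∀ᶠ n in (U : Filter ℕ), h n < ε / (4 * C) :=
      hhU.eventually_lt_const (by positivity)
    filter_upwards [h1, h2] with n hn1 hn2 x hx
    obtain ⟨y, hy, hxy⟩ := mem_iUnion₂.1 (htc hx)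
    rw [mem_ball, dist_eq_norm] at hxy
    have a1 : |u n x - u n y| ≤ 3 * ε / 8 := by
      refine (huest n x y).trans ?_
      calc _ ≤ C * (ε / (8 * C) + ε / (4 * C)) := by gcongr
        _ = _ := by field_simp; ring
    have a2 : |v x - v y| ≤ ε / 8 := by
      refine (hvest x y).trans ?_
      calc _ ≤ C * (ε / (8 * C)) := by gcongr
        _ = _ := by field_simp
    have a3 := hn1 y hy
    rw [abs_le] at *
    rw [abs_lt] at a3
    constructor <;> linarith [a1.1, a1.2, a2.1, a2.2, a3.1, a3.2]
  refine ⟨v, C.toNNReal, hvlip, hv0, fun φ hφ hφc hφA => ?_⟩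
  obtain ⟨K, hK0, hK⟩ := exists_abs_nbrAvg_sub_lap_le hφ hφc
  have hφ0 : ∀ x ∉ A, φ x = 0 := fun x hx =>
    image_eq_zero_of_notMem_tsupport fun h => hx (hφA h)
  -- exact identity for the discrete solutions
  have hdisc : ∀ n, ∫ x in A, u n x * (6 / h n ^ 2 * (nbrAvg (h n) φ x - φ x)) =
      ∫ x in A, f x * φ x := by
    intro n
    have hφi : Integrable φ := hφ.continuous.integrable_of_hasCompactSupport hφc
    have hb : ∀ g : E3 → ℝ, Measurable g → (∀ x, |g x| ≤ M * R ^ 2) →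
        Integrable fun x => g x * φ x := fun g hg hgB =>
      hφi.bdd_mul (c := M * R ^ 2) hg.aestronglyMeasurable (Eventually.of_forall hgB)
    have havgc : Continuous (nbrAvg (h n) φ) := by
      have := hφ.continuous
      unfold nbrAvg; fun_prop
    have havgm : Measurable (nbrAvg (h n) (u n)) := by
      unfold nbrAvg
      refine Measurable.div_const (Finset.measurable_sum _ fun i _ => ?_) _
      exact ((hum n).comp (measurable_id.add_const _)).add
        ((hum n).comp (measurable_id.sub_const _))
    have havgB : ∀ x, |nbrAvg (h n) (u n) x| ≤ M * R ^ 2 := by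
      intro x
      have h1 := nbrAvg_mono (h := h n) (u := u n) (v := fun _ => M * R ^ 2) (x := x)
        fun i => ⟨(abs_le.1 (huB n _)).2, (abs_le.1 (huB n _)).2⟩
      have h2 := nbrAvg_mono (h := h n) (u := fun _ => -(M * R ^ 2)) (v := u n) (x := x)
        fun i => ⟨(abs_le.1 (huB n _)).1, (abs_le.1 (huB n _)).1⟩
      rw [nbrAvg_const] at h1 h2
      exact abs_le.2 ⟨h2, h1⟩
    have havgs : Integrable (nbrAvg (h n) φ) := by
      unfold nbrAvg
      refine Integrable.div_const (integrable_finsetSum _ fun i _ => ?_) _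
      exact (hφi.comp_add_right _).add (hφi.comp_sub_right _)
    have hi1 : Integrable fun x => u n x * nbrAvg (h n) φ x :=
      havgs.bdd_mul (c := M * R ^ 2) (hum n).aestronglyMeasurable (Eventually.of_forall (huB n))
    have e1 : ∫ x in A, u n x * (6 / h n ^ 2 * (nbrAvg (h n) φ x - φ x)) =
        ∫ x, 6 / h n ^ 2 * (u n x * nbrAvg (h n) φ x - u n x * φ x) := by
      rw [setIntegral_eq_integral_of_forall_compl_eq_zero]
      · exact integral_congr_ae (Eventually.of_forall fun x => by ring)
      · intro x hx; rw [(hus n).zero x hx, zero_mul]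
    rw [e1, integral_const_mul, integral_sub hi1 (hb _ (hum n) (huB n)),
      integral_mul_nbrAvg (hum n) (huB n) hφ.continuous hφc,
      ← integral_sub (hb _ havgm havgB) (hb _ (hum n) (huB n)), ← integral_const_mul,
      setIntegral_eq_integral_of_forall_compl_eq_zero (fun x hx => by rw [hφ0 x hx, mul_zero])]
    refine integral_congr_ae (Eventually.of_forall fun x => ?_)
    by_cases hx : x ∈ A
    · have := (hus n).eq x hx
      have e2 : nbrAvg (h n) (u n) x - u n x = h n ^ 2 / 6 * f x := by linarith
      have hn0 : h n ≠ 0 := (hhpos n).ne'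
      simp only [← sub_mul, e2]
      field_simp
    · simp [hφ0 x hx]
  have hlapc : Continuous (lap φ) := continuous_lap hφ
  obtain ⟨Λ, hΛ⟩ : ∃ Λ : ℝ, ∀ x ∈ A, |lap φ x| ≤ Λ := by
    obtain ⟨Λ, hΛ⟩ := (hAb.isCompact_closure).exists_bound_of_continuousOn hlapc.continuousOn
    exact ⟨Λ, fun x hx => hΛ x (subset_closure hx)⟩
  -- passage to the limit
  set c := (M * R ^ 2 * K + Λ) * volume.real A with hc
  have hvint : IntegrableOn (fun x => v x * lap φ x) A := by
    have := (hvlip.continuous.mul hlapc).continuousOn (s := closure A)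
    exact (this.integrableOn_compact hAb.isCompact_closure).mono_set subset_closure
  have hdist : ∀ ε > 0, |(∫ x in A, v x * lap φ x) - ∫ x in A, f x * φ x| ≤ ε * c := by
    intro ε hε
    obtain ⟨n, hn1, hn2⟩ := ((hunif ε hε).and (hhU.eventually_le_const hε)).exists
    have hΔc : Continuous fun x => 6 / h n ^ 2 * (nbrAvg (h n) φ x - φ x) := by
      have := hφ.continuous
      unfold nbrAvg; fun_prop
    have huint : IntegrableOn (fun x => u n x * (6 / h n ^ 2 * (nbrAvg (h n) φ x - φ x))) A := by
      have := (hΔc.continuousOn (s := closure A)).integrableOn_compact (μ := volume)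
        hAb.isCompact_closure
      exact (this.mono_set subset_closure).bdd_mul (c := M * R ^ 2) (hum n).aestronglyMeasurable
        (Eventually.of_forall (huB n))
    rw [← hdisc n, ← integral_sub hvint huint, ← Real.norm_eq_abs]
    have hM0 : 0 ≤ M := (abs_nonneg _).trans (hM 0)
    refine (norm_setIntegral_le_of_norm_le_const (C := ε * (M * R ^ 2 * K + Λ))
      hAb.measure_lt_top fun x hx => ?_).trans (le_of_eq (by rw [hc, mul_assoc]))
    have e : v x * lap φ x - u n x * (6 / h n ^ 2 * (nbrAvg (h n) φ x - φ x)) =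
        -((u n x - v x) * lap φ x) -
          u n x * (6 / h n ^ 2 * (nbrAvg (h n) φ x - φ x) - lap φ x) := by ring
    rw [e, Real.norm_eq_abs]
    refine (abs_sub _ _).trans ?_
    rw [abs_neg, abs_mul, abs_mul]
    calc _ ≤ ε * Λ + M * R ^ 2 * (K * ε) := by
          gcongr
          · exact hn1 x hx
          · exact hΛ x hx
          · exact huB n x
          · exact (hK x _ (hhpos n)).trans (by gcongr)
      _ = _ := by ring
  have hlim0 : Tendsto (fun ε : ℝ => ε * c) (𝓝[>] 0) (𝓝 (0 * c)) :=
    ((continuous_id.mul continuous_const).tendsto 0).mono_left nhdsWithin_le_nhds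
  rw [zero_mul] at hlim0
  have := ge_of_tendsto hlim0 (eventually_mem_nhdsWithin.mono hdist)
  exact sub_eq_zero.1 (abs_nonpos_iff.1 this)

/-! ### Mollification of vector fields -/

/-- Mollification of `f` by the normalized bump function `η`. -/
noncomputable def moll {F : Type*} [NormedAddCommGroup F] [NormedSpace ℝ F]
    (η : ContDiffBump (0 : E3)) (f : E3 → F) : E3 → F :=
  η.normed volume ⋆[ContinuousLinearMap.lsmul ℝ ℝ, volume] f

section moll

variable {F : Type*} [NormedAddCommGroup F] [NormedSpace ℝ F] (η : ContDiffBump (0 : E3))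

theorem moll_eq_integral (f : E3 → F) (x : E3) :
    moll η f x = ∫ y, η.normed volume (x - y) • f y := by
  rw [moll, convolution_eq_swap]; rfl

theorem contDiff_moll [CompleteSpace F] {f : E3 → F} (hf : LocallyIntegrable f) :
    ContDiff ℝ ∞ (moll η f) :=
  η.hasCompactSupport_normed.contDiff_convolution_left _ η.contDiff_normed hf

theorem fderiv_moll_apply [CompleteSpace F] {f : E3 → F} (hf : LocallyIntegrable f) (x v : E3) :
    fderiv ℝ (moll η f) x v = ∫ y, fderiv ℝ (η.normed volume) (x - y) v • f y := by
  have h := (η.hasCompactSupport_normed (μ := volume)).hasFDerivAt_convolution_left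
    (ContinuousLinearMap.lsmul ℝ ℝ) η.contDiff_normed hf x
  have hfd : fderiv ℝ (moll η f) x = _ := h.fderiv
  rw [hfd, convolution_eq_swap, ContinuousLinearMap.integral_apply]
  · rfl
  · have hc : ConvolutionExistsAt (fderiv ℝ (η.normed volume)) f x
        (ContinuousLinearMap.precompL E3 (ContinuousLinearMap.lsmul ℝ ℝ)) volume :=
      ((η.hasCompactSupport_normed (μ := volume)).fderiv ℝ).convolutionExists_left _
        ((η.contDiff_normed (μ := volume) (n := 1)).continuous_fderiv one_ne_zero) hf x
    exact hc.integrable_swap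

theorem integrable_fderiv_moll_integrand {f : E3 → F} (hf : LocallyIntegrable f) (x v : E3) :
    Integrable fun y => fderiv ℝ (η.normed volume) (x - y) v • f y := by
  have hc : ConvolutionExistsAt (fderiv ℝ (η.normed volume)) f x
      (ContinuousLinearMap.precompL E3 (ContinuousLinearMap.lsmul ℝ ℝ)) volume :=
    ((η.hasCompactSupport_normed (μ := volume)).fderiv ℝ).convolutionExists_left _
      ((η.contDiff_normed (μ := volume) (n := 1)).continuous_fderiv one_ne_zero) hf x
  exact (ContinuousLinearMap.apply ℝ F v).integrable_comp hc.integrable_swap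

theorem integrable_moll_integrand {f : E3 → F} (hf : LocallyIntegrable f) (x : E3) :
    Integrable fun y => η.normed volume (x - y) • f y := by
  have hc : ConvolutionExistsAt (η.normed volume) f x (ContinuousLinearMap.lsmul ℝ ℝ) volume :=
    (η.hasCompactSupport_normed (μ := volume)).convolutionExists_left _
      η.continuous_normed hf x
  exact hc.integrable_swap

theorem moll_add {f g : E3 → F} (hf : LocallyIntegrable f) (hg : LocallyIntegrable g) :
    moll η (f + g) = moll η f + moll η g := by
  funext x
  simp only [moll_eq_integral, Pi.add_apply, smul_add]
  exact integral_add (integrable_moll_integrand η hf x) (integrable_moll_integrand η hg x)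

theorem moll_eq_zero_of_forall_ball {f : E3 → F} {x : E3} (h : ∀ y ∈ ball x η.rOut, f y = 0) :
    moll η f x = 0 := by
  rw [moll_eq_integral]
  refine integral_eq_zero_of_ae (Eventually.of_forall fun y => ?_)
  by_cases hy : y ∈ ball x η.rOut
  · simp [h y hy]
  · have : x - y ∉ Function.support (η.normed volume) := by
      rw [η.support_normed_eq, mem_ball, dist_zero_right]
      rwa [mem_ball, dist_comm, dist_eq_norm] at hy
    simp [Function.notMem_support.1 this]

theorem lintegral_normed_sub (x : E3) :
    ∫⁻ y, ENNReal.ofReal (η.normed volume (x - y)) = 1 := by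
  rw [lintegral_sub_left_eq_self (fun y => ENNReal.ofReal (η.normed volume y)) x,
    ← ofReal_integral_eq_lintegral_ofReal η.integrable_normed
      (Eventually.of_forall fun y => η.nonneg_normed y), η.integral_normed, ENNReal.ofReal_one]

/-- Mollification is a contraction of `L²`. -/
theorem eLpNorm_moll_le {f : E3 → F} (hf : AEStronglyMeasurable f) :
    eLpNorm (moll η f) 2 volume ≤ eLpNorm f 2 volume := by
  have hm : Measurable fun y => ENNReal.ofReal (η.normed volume y) :=
    η.continuous_normed.measurable.ennreal_ofReal
  have hpt : ∀ x, ‖moll η f x‖ₑ ^ (2 : ℝ) ≤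
      ∫⁻ y, ENNReal.ofReal (η.normed volume (x - y)) * ‖f y‖ₑ ^ (2 : ℝ) := by
    intro x
    -- Cauchy-Schwarz, with the bump function split as the product of two square roots
    have h1 : ‖moll η f x‖ₑ ≤ ∫⁻ y, ENNReal.ofReal (η.normed volume (x - y)) ^ (1 / 2 : ℝ) *
        (ENNReal.ofReal (η.normed volume (x - y)) * ‖f y‖ₑ ^ (2 : ℝ)) ^ (1 / 2 : ℝ) := by
      rw [moll_eq_integral]
      refine (enorm_integral_le_lintegral_enorm _).trans (le_of_eq ?_)
      refine lintegral_congr fun y => ?_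
      rw [enorm_smul, ENNReal.mul_rpow_of_nonneg _ _ (by norm_num), ← mul_assoc,
        ← ENNReal.rpow_add_of_nonneg _ _ (by norm_num) (by norm_num), ← ENNReal.rpow_mul,
        Real.enorm_of_nonneg (η.nonneg_normed _)]
      norm_num
    have h2 := ENNReal.lintegral_mul_norm_pow_le (μ := volume) (p := 1 / 2) (q := 1 / 2)
      (f := fun y => ENNReal.ofReal (η.normed volume (x - y)))
      (g := fun y => ENNReal.ofReal (η.normed volume (x - y)) * ‖f y‖ₑ ^ (2 : ℝ))
      (hm.comp (measurable_const.sub measurable_id)).aemeasurable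
      ((hm.comp (measurable_const.sub measurable_id)).aemeasurable.mul
        (hf.enorm.pow_const _)) (by norm_num) (by norm_num) (by norm_num)
    rw [lintegral_normed_sub, ENNReal.one_rpow, one_mul] at h2
    have h3 := ENNReal.rpow_le_rpow (h1.trans h2) (show (0 : ℝ) ≤ 2 by norm_num)
    rwa [← ENNReal.rpow_mul, one_div, inv_mul_cancel₀ two_ne_zero, ENNReal.rpow_one] at h3
  rw [eLpNorm_eq_lintegral_rpow_enorm_toReal two_ne_zero ENNReal.ofNat_ne_top,
    eLpNorm_eq_lintegral_rpow_enorm_toReal two_ne_zero ENNReal.ofNat_ne_top]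
  refine ENNReal.rpow_le_rpow ?_ (by simp)
  simp only [ENNReal.toReal_ofNat]
  calc _ ≤ ∫⁻ x, ∫⁻ y, ENNReal.ofReal (η.normed volume (x - y)) * ‖f y‖ₑ ^ (2 : ℝ) :=
        lintegral_mono hpt
    _ = ∫⁻ y, ∫⁻ x, ENNReal.ofReal (η.normed volume (x - y)) * ‖f y‖ₑ ^ (2 : ℝ) := by
        refine lintegral_lintegral_swap ?_
        refine AEMeasurable.mul (hm.comp (measurable_fst.sub measurable_snd)).aemeasurable ?_
        exact (hf.enorm.pow_const _).comp_snd
    _ = _ := by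
        refine lintegral_congr fun y => ?_
        have hm' : Measurable fun x => ENNReal.ofReal (η.normed volume (x - y)) :=
          hm.comp (measurable_id.sub_const y)
        rw [lintegral_mul_const _ hm',
          lintegral_sub_right_eq_self (fun x => ENNReal.ofReal (η.normed volume x)) y]
        have := lintegral_normed_sub η 0
        rw [lintegral_sub_left_eq_self (fun y => ENNReal.ofReal (η.normed volume y)) 0] at this
        rw [this, one_mul]

/-- Mollification preserves closed convex constraints. -/
theorem moll_mem_of_convex [CompleteSpace F] {f : E3 → F} (hf : LocallyIntegrable f) {s : Set F}
    (hs : Convex ℝ s) (hsc : IsClosed s) (hfs : ∀ᵐ y, f y ∈ s) (x : E3) : moll η f x ∈ s := by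
  by_contra hx
  obtain ⟨l, u, hl, hu⟩ := geometric_hahn_banach_closed_point hs hsc hx
  have hint := integrable_moll_integrand η hf x
  have h1 : l (moll η f x) = ∫ y, η.normed volume (x - y) * l (f y) := by
    rw [moll_eq_integral, ← l.integral_comp_comm hint]
    simp
  have hρ : Integrable fun y => η.normed volume (x - y) :=
    (η.integrable_normed (μ := volume)).comp_sub_left x
  have h2 : ∫ y, η.normed volume (x - y) * l (f y) ≤ ∫ y, η.normed volume (x - y) * u := by
    refine integral_mono_ae ?_ (hρ.mul_const u) ?_
    · refine (l.integrable_comp hint).congr (Eventually.of_forall fun y => by simp)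
    · filter_upwards [hfs] with y hy
      exact mul_le_mul_of_nonneg_left (hl _ hy).le (η.nonneg_normed _)
  rw [integral_mul_const, integral_sub_left_eq_self (fun y => η.normed volume y), η.integral_normed,
    one_mul] at h2
  linarith

end moll

theorem contDiff_normed_sub (η : ContDiffBump (0 : E3)) (x : E3) :
    ContDiff ℝ ∞ fun y => η.normed volume (x - y) :=
  η.contDiff_normed.comp (contDiff_const.sub contDiff_id)

theorem hasCompactSupport_normed_sub (η : ContDiffBump (0 : E3)) (x : E3) :
    HasCompactSupport fun y => η.normed volume (x - y) :=
  η.hasCompactSupport_normed.comp_homeomorph (Homeomorph.subLeft x)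

theorem fderiv_normed_sub (η : ContDiffBump (0 : E3)) (x y v : E3) :
    fderiv ℝ (fun y => η.normed volume (x - y)) y v = -fderiv ℝ (η.normed volume) (x - y) v := by
  have h1 : HasFDerivAt (η.normed volume) (fderiv ℝ (η.normed volume) (x - y)) (x - y) :=
    ((η.contDiff_normed (μ := volume) (n := 1)).differentiable one_ne_zero _).hasFDerivAt
  have h2 : HasFDerivAt (fun y => η.normed volume (x - y)) _ y :=
    h1.comp y ((hasFDerivAt_id y).const_sub x)
  rw [h2.fderiv]; simp

/-- If `J` is the curl of `f` on the whole space, the mollification of `J` is the classical curl of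
the mollification of `f`. -/
theorem curl_moll (η : ContDiffBump (0 : E3)) {f J : E3 → E3} (hf : LocallyIntegrable f)
    (hJ : LocallyIntegrable J)
    (h : ∀ Φ : E3 → E3, ContDiff ℝ ∞ Φ → HasCompactSupport Φ →
      ∫ x, inner ℝ (f x) (curl Φ x) = ∫ x, inner ℝ (J x) (Φ x)) (x : E3) :
    curl (moll η f) x = moll η J x := by
  have hpd : ∀ i j, pd i j (moll η f) x =
      ∫ y, fderiv ℝ (η.normed volume) (x - y) (EuclideanSpace.single i 1) * f y j := by
    intro i j
    rw [pd, fderiv_moll_apply η hf]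
    exact ((EuclideanSpace.proj j : E3 →L[ℝ] ℝ).integral_comp_comm
      (integrable_fderiv_moll_integrand η hf x _)).symm
  have hpdi : ∀ i j, Integrable fun y =>
      fderiv ℝ (η.normed volume) (x - y) (EuclideanSpace.single i 1) * f y j := fun i j =>
    (EuclideanSpace.proj j : E3 →L[ℝ] ℝ).integrable_comp
      (integrable_fderiv_moll_integrand η hf x (EuclideanSpace.single i 1))
  -- the bump function centred at `x`, times a basis vector, is a test field
  have hcomp : ∀ c : Fin 3, ∫ y, inner ℝ (f y)
      (curl (fun y => η.normed volume (x - y) • EuclideanSpace.single c (1 : ℝ)) y) =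
      moll η J x c := by
    intro c
    have hΦ := h (fun y => η.normed volume (x - y) • EuclideanSpace.single c (1 : ℝ))
      ((contDiff_normed_sub η x).smul contDiff_const)
      (hasCompactSupport_normed_sub η x).smul_right
    rw [hΦ, moll_eq_integral]
    refine Eq.trans ?_ ((EuclideanSpace.proj c : E3 →L[ℝ] ℝ).integral_comp_comm
      (integrable_moll_integrand η hJ x))
    refine integral_congr_ae (Eventually.of_forall fun y => ?_)
    simp [inner_smul_right, EuclideanSpace.inner_single_right]
  have hpdt : ∀ (c i j : Fin 3) (y : E3),
      pd i j (fun y => η.normed volume (x - y) • EuclideanSpace.single c (1 : ℝ)) y =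
      -(fderiv ℝ (η.normed volume) (x - y) (EuclideanSpace.single i 1) *
        (EuclideanSpace.single c (1 : ℝ) : E3) j) := by
    intro c i j y
    have hd : DifferentiableAt ℝ (fun y => η.normed volume (x - y)) y :=
      (contDiff_normed_sub η x).differentiable (by simp) y
    rw [pd, (hd.hasFDerivAt.smul_const (EuclideanSpace.single c (1 : ℝ))).fderiv,
      ContinuousLinearMap.smulRight_apply, fderiv_normed_sub]
    simp
  ext c
  rw [← hcomp c]
  fin_cases c
  all_goals
    simp only [curl, hpd, hpdt]
    simp only [Fin.zero_eta, Fin.mk_one, Fin.reduceFinMk, PiLp.inner_apply, Fin.sum_univ_three]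
    simp only [Fin.isValue, PiLp.single_apply]
    simp
    rw [← integral_sub (hpdi _ _) (hpdi _ _)]
    refine integral_congr_ae (Eventually.of_forall fun y => ?_)
    simp
    try ring

/-! ### Pullback of vector fields -/

/-- The pullback under `Φ` of the vector field `S`, regarded as a `1`-form. -/
noncomputable def pullback (Φ S : E3 → E3) (x : E3) : E3 :=
  ContinuousLinearMap.adjoint (fderiv ℝ Φ x) (S (Φ x))

theorem inner_pullback (Φ S : E3 → E3) (x v : E3) :
    inner ℝ (pullback Φ S x) v = inner ℝ (S (Φ x)) (fderiv ℝ Φ x v) :=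
  ContinuousLinearMap.adjoint_inner_left _ _ _

theorem pullback_apply (Φ S : E3 → E3) (x : E3) (j : Fin 3) :
    pullback Φ S x j = inner ℝ (S (Φ x)) (fderiv ℝ Φ x (EuclideanSpace.single j 1)) := by
  rw [← inner_pullback, EuclideanSpace.inner_single_right]; simp

theorem contDiff_pullback {Φ S : E3 → E3} (hΦ : ContDiff ℝ ∞ Φ) (hS : ContDiff ℝ ∞ S) :
    ContDiff ℝ ∞ (pullback Φ S) := by
  rw [contDiff_euclidean]
  intro j
  simp only [pullback_apply]
  exact (hS.comp hΦ).inner ℝ (contDiff_fderiv_apply hΦ _)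

theorem pd_eq_fderiv {P : E3 → E3} {x : E3} (hP : DifferentiableAt ℝ P x) (i j : Fin 3) :
    pd i j P x = fderiv ℝ (fun y => P y j) x (EuclideanSpace.single i 1) := by
  have h : HasFDerivAt (fun y => P y j) ((EuclideanSpace.proj j : E3 →L[ℝ] ℝ).comp (fderiv ℝ P x)) x :=
    (EuclideanSpace.proj j : E3 →L[ℝ] ℝ).hasFDerivAt.comp x hP.hasFDerivAt
  rw [h.fderiv, pd]; rfl

/-- The exterior derivative commutes with pullback: the second derivatives of `Φ` cancel by
symmetry. -/
theorem pd_pullback_sub {Φ S : E3 → E3} (hΦ : ContDiff ℝ ∞ Φ) (hS : ContDiff ℝ ∞ S) (x : E3)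
    (i j : Fin 3) :
    pd i j (pullback Φ S) x - pd j i (pullback Φ S) x =
      inner ℝ (fderiv ℝ S (Φ x) (fderiv ℝ Φ x (EuclideanSpace.single i 1)))
          (fderiv ℝ Φ x (EuclideanSpace.single j 1)) -
        inner ℝ (fderiv ℝ S (Φ x) (fderiv ℝ Φ x (EuclideanSpace.single j 1)))
          (fderiv ℝ Φ x (EuclideanSpace.single i 1)) := by
  have hP : DifferentiableAt ℝ (pullback Φ S) x :=
    (contDiff_pullback hΦ hS).differentiable (by simp) x
  have hΦd : HasFDerivAt Φ (fderiv ℝ Φ x) x := (hΦ.differentiable (by simp) x).hasFDerivAt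
  have hSd : HasFDerivAt S (fderiv ℝ S (Φ x)) (Φ x) :=
    (hS.differentiable (by simp) _).hasFDerivAt
  have hΦ2 : HasFDerivAt (fderiv ℝ Φ) (fderiv ℝ (fderiv ℝ Φ) x) x :=
    ((hΦ.fderiv_right (m := ∞) (by simp)).differentiable (by simp) x).hasFDerivAt
  have hsymm : IsSymmSndFDerivAt ℝ Φ x :=
    hΦ.contDiffAt.isSymmSndFDerivAt (by
      rw [minSmoothness_of_isRCLikeNormedField]; exact WithTop.coe_le_coe.2 le_top)
  have key : ∀ i j : Fin 3, pd i j (pullback Φ S) x =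
      inner ℝ (S (Φ x)) (fderiv ℝ (fderiv ℝ Φ) x (EuclideanSpace.single i 1)
          (EuclideanSpace.single j 1)) +
        inner ℝ (fderiv ℝ S (Φ x) (fderiv ℝ Φ x (EuclideanSpace.single i 1)))
          (fderiv ℝ Φ x (EuclideanSpace.single j 1)) := by
    intro i j
    rw [pd_eq_fderiv hP]
    simp only [pullback_apply]
    have h1 : HasFDerivAt (fun y => S (Φ y)) ((fderiv ℝ S (Φ x)).comp (fderiv ℝ Φ x)) x :=
      hSd.comp x hΦd
    have h2 : HasFDerivAt (fun y => fderiv ℝ Φ y (EuclideanSpace.single j 1)) _ x :=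
      hΦ2.clm_apply (hasFDerivAt_const (EuclideanSpace.single j (1 : ℝ)) x)
    rw [(h1.inner ℝ h2).fderiv]
    simp [fderivInnerCLM_apply]
  rw [key, key, hsymm.eq (EuclideanSpace.single i 1) (EuclideanSpace.single j 1)]
  ring

/-- The antisymmetric part of a matrix is controlled by its entries. -/
theorem abs_inner_sub_inner_le (M : E3 →L[ℝ] E3) (a b : E3) {κ : ℝ}
    (h : ∀ i j, |inner ℝ (M (EuclideanSpace.single i 1)) (EuclideanSpace.single j (1 : ℝ)) -
      inner ℝ (M (EuclideanSpace.single j 1)) (EuclideanSpace.single i (1 : ℝ))| ≤ κ) :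
    |inner ℝ (M a) b - inner ℝ (M b) a| ≤ 9 * κ * (‖a‖ * ‖b‖) := by
  have hsum : ∀ v : E3, v = ∑ i, v i • EuclideanSpace.single i (1 : ℝ) := fun v => by
    ext j
    simp [Fin.sum_univ_three, PiLp.single_apply]
    fin_cases j <;> simp
  have hab : ∀ a b : E3, inner ℝ (M a) b = ∑ i, ∑ j, a i * b j *
      inner ℝ (M (EuclideanSpace.single i 1)) (EuclideanSpace.single j (1 : ℝ)) := by
    intro a b
    conv_lhs => rw [hsum a, hsum b]
    simp only [map_sum, map_smul, sum_inner, inner_sum, inner_smul_left, inner_smul_right,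
      conj_trivial]
    simp only [Finset.mul_sum]
    rw [Finset.sum_comm]
    exact Finset.sum_congr rfl fun i _ => Finset.sum_congr rfl fun j _ => by ring
  have e : inner ℝ (M a) b - inner ℝ (M b) a = ∑ i, ∑ j, a i * b j *
      (inner ℝ (M (EuclideanSpace.single i 1)) (EuclideanSpace.single j (1 : ℝ)) -
        inner ℝ (M (EuclideanSpace.single j 1)) (EuclideanSpace.single i (1 : ℝ))) := by
    rw [hab a b, hab b a, Finset.sum_comm (f := fun i j => b i * a j * _), ← Finset.sum_sub_distrib]
    refine Finset.sum_congr rfl fun i _ => ?_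
    rw [← Finset.sum_sub_distrib]
    exact Finset.sum_congr rfl fun j _ => by ring
  have hκ : 0 ≤ κ := (abs_nonneg _).trans (h 0 0)
  rw [e]
  refine (Finset.abs_sum_le_sum_abs _ _).trans ?_
  refine (Finset.sum_le_sum fun i _ => Finset.abs_sum_le_sum_abs _ _).trans ?_
  refine (Finset.sum_le_sum fun i _ => Finset.sum_le_sum fun j _ =>
    (show _ ≤ ‖a‖ * ‖b‖ * κ from ?_)).trans ?_
  · rw [abs_mul, abs_mul]
    have h1 : |a i| ≤ ‖a‖ := PiLp.norm_apply_le a i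
    have h2 : |b j| ≤ ‖b‖ := PiLp.norm_apply_le b j
    gcongr
    exact h i j
  · simp only [Finset.sum_const, Finset.card_univ, Fintype.card_fin, nsmul_eq_mul]
    push_cast
    linarith

theorem norm_le_of_forall_abs_le {v : E3} {δ : ℝ} (h : ∀ i, |v i| ≤ δ) : ‖v‖ ≤ 2 * δ := by
  have hδ : 0 ≤ δ := (abs_nonneg _).trans (h 0)
  refine abs_le_of_sq_le_sq' ?_ (by positivity) |>.2
  rw [EuclideanSpace.norm_sq_eq, Fin.sum_univ_three]
  have h' : ∀ i, ‖v i‖ ^ 2 ≤ δ ^ 2 := fun i => by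
    have := h i
    rw [Real.norm_eq_abs]; gcongr
  nlinarith [h' 0, h' 1, h' 2]

/-- Pullback by a map close to the identity changes the curl by a small relative amount. -/
theorem norm_curl_pullback_sub_le {N S : E3 → E3} (hN : ContDiff ℝ ∞ N) (hS : ContDiff ℝ ∞ S)
    {B t : ℝ} (ht : 0 ≤ t) (ht1 : t ≤ 1) {x : E3} (hB : ‖fderiv ℝ N x‖ ≤ B) :
    ‖curl (pullback (fun y => y + t • N y) S) x - curl S (x + t • N x)‖ ≤
      18 * (2 * B + B ^ 2) * t * ‖curl S (x + t • N x)‖ := by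
  set Φ : E3 → E3 := fun y => y + t • N y with hΦdef
  have hΦ : ContDiff ℝ ∞ Φ := contDiff_id.add (hN.const_smul t)
  have hB0 : 0 ≤ B := (norm_nonneg _).trans hB
  have hfd : ∀ v, fderiv ℝ Φ x v = v + t • fderiv ℝ N x v := by
    intro v
    have : HasFDerivAt Φ (ContinuousLinearMap.id ℝ E3 + t • fderiv ℝ N x) x :=
      (hasFDerivAt_id x).add ((hN.differentiable (by simp) x).hasFDerivAt.const_smul t)
    rw [this.fderiv]; rfl
  set M := fderiv ℝ S (Φ x) with hM
  set κ := ‖curl S (Φ x)‖ with hκ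
  set alt : E3 → E3 → ℝ := fun a b => inner ℝ (M a) b - inner ℝ (M b) a with halt
  have hpdS : ∀ i j, pd i j S (Φ x) = inner ℝ (M (EuclideanSpace.single i 1))
      (EuclideanSpace.single j (1 : ℝ)) := fun i j => by
    rw [EuclideanSpace.inner_single_right]; simp [pd, hM]
  have hcomp : ∀ i j, |alt (EuclideanSpace.single i 1) (EuclideanSpace.single j 1)| ≤ κ := by
    have h0 : |curl S (Φ x) 0| ≤ κ := PiLp.norm_apply_le (curl S (Φ x)) 0
    have h1 : |curl S (Φ x) 1| ≤ κ := PiLp.norm_apply_le (curl S (Φ x)) 1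
    have h2 : |curl S (Φ x) 2| ≤ κ := PiLp.norm_apply_le (curl S (Φ x)) 2
    simp [curl] at h0 h1 h2
    have hκ0 : 0 ≤ κ := norm_nonneg _
    intro i j
    simp only [halt, ← hpdS]
    fin_cases i <;> fin_cases j <;> simp <;> first | assumption | (rw [abs_sub_comm]; assumption)
  have hbil : ∀ a b, |alt a b| ≤ 9 * κ * (‖a‖ * ‖b‖) := fun a b => abs_inner_sub_inner_le M a b hcomp
  have hkey : ∀ i j : Fin 3, |(pd i j (pullback Φ S) x - pd j i (pullback Φ S) x) -
      (pd i j S (Φ x) - pd j i S (Φ x))| ≤ 9 * κ * ((2 * B + B ^ 2) * t) := by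
    intro i j
    rw [pd_pullback_sub hΦ hS, hpdS, hpdS, hfd, hfd]
    set a : E3 := EuclideanSpace.single i 1
    set b : E3 := EuclideanSpace.single j 1
    set m := fderiv ℝ N x a
    set n := fderiv ℝ N x b
    have ha : ‖a‖ = 1 := by simp [a]
    have hb : ‖b‖ = 1 := by simp [b]
    have hm : ‖m‖ ≤ B := by
      have := (fderiv ℝ N x).le_of_opNorm_le hB a
      rwa [ha, mul_one] at this
    have hn : ‖n‖ ≤ B := by
      have := (fderiv ℝ N x).le_of_opNorm_le hB b
      rwa [hb, mul_one] at this
    have e : inner ℝ (M (a + t • m)) (b + t • n) - inner ℝ (M (b + t • n)) (a + t • m) -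
        (inner ℝ (M a) b - inner ℝ (M b) a) = t * alt m b + t * alt a n + t ^ 2 * alt m n := by
      simp only [halt, map_add, map_smul, inner_add_left, inner_add_right, inner_smul_left,
        inner_smul_right, conj_trivial]
      ring
    rw [e]
    have hκ0 : 0 ≤ κ := norm_nonneg _
    have k1 : |alt m b| ≤ 9 * κ * (B * 1) := (hbil _ _).trans (by rw [hb]; gcongr)
    have k2 : |alt a n| ≤ 9 * κ * (1 * B) := (hbil _ _).trans (by rw [ha]; gcongr)
    have k3 : |alt m n| ≤ 9 * κ * (B * B) := (hbil _ _).trans (by gcongr)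
    have ht2 : t ^ 2 ≤ t := by nlinarith
    calc _ ≤ |t * alt m b| + |t * alt a n| + |t ^ 2 * alt m n| := abs_add_three _ _ _
      _ = t * |alt m b| + t * |alt a n| + t ^ 2 * |alt m n| := by
        rw [abs_mul, abs_mul, abs_mul, abs_of_nonneg ht, abs_of_nonneg (sq_nonneg t)]
      _ ≤ t * (9 * κ * (B * 1)) + t * (9 * κ * (1 * B)) + t * (9 * κ * (B * B)) := by gcongr
      _ = _ := by ring
  refine (norm_le_of_forall_abs_le (δ := 9 * κ * ((2 * B + B ^ 2) * t)) fun i => ?_).trans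
    (le_of_eq (by ring))
  fin_cases i
  · simpa [curl] using hkey 1 2
  · simpa [curl] using hkey 2 0
  · simpa [curl] using hkey 0 1

/-- Near the identity, `x ↦ x + t N x` is injective and distorts volume by at most a factor `2`. -/
theorem exists_map_add_smul_le {N : E3 → E3} (hN : ContDiff ℝ ∞ N) (hNc : HasCompactSupport N) :
    ∃ τ : ℝ, 0 < τ ∧ ∀ t, 0 ≤ t → t ≤ τ →
      Measure.map (fun x => x + t • N x) volume ≤ (2 : ℝ≥0∞) • (volume : Measure E3) := by
  obtain ⟨K, hK⟩ := exists_lipschitz_of_contDiff hN hNc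
  have hdet : ∀ᶠ L : E3 →L[ℝ] E3 in 𝓝 (ContinuousLinearMap.id ℝ E3), 1 / 2 < |L.det| := by
    have h : Tendsto (fun L : E3 →L[ℝ] E3 => |L.det|) (𝓝 (ContinuousLinearMap.id ℝ E3))
        (𝓝 |(ContinuousLinearMap.id ℝ E3).det|) :=
      (ContinuousLinearMap.continuous_det.abs.tendsto _)
    refine h.eventually_const_lt ?_
    have : (ContinuousLinearMap.id ℝ E3).det = 1 := by
      simp [ContinuousLinearMap.det]
    rw [this]; norm_num
  obtain ⟨ρ, hρ, hρd⟩ := Metric.eventually_nhds_iff.1 hdet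
  have hKpos : (0 : ℝ) < K + 1 := by positivity
  refine ⟨min (1 / (2 * (K + 1))) (ρ / (2 * (K + 1))), by positivity, fun t ht htt => ?_⟩
  have ht1 : t * K ≤ 1 / 2 := by
    have := htt.trans (min_le_left _ _)
    rw [le_div_iff₀ (by positivity)] at this
    nlinarith
  have ht2 : t * K < ρ := by
    have := htt.trans (min_le_right _ _)
    rw [le_div_iff₀ (by positivity)] at this
    nlinarith
  set Φ : E3 → E3 := fun x => x + t • N x
  have hfd : ∀ x, HasFDerivAt Φ (ContinuousLinearMap.id ℝ E3 + t • fderiv ℝ N x) x := fun x =>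
    (hasFDerivAt_id x).add ((hN.differentiable (by simp) x).hasFDerivAt.const_smul t)
  have hΦc : Continuous Φ := continuous_id.add (hN.continuous.const_smul t)
  have hinj : Function.Injective Φ := by
    intro x y hxy
    have h1 : x - y = t • (N y - N x) := by
      have : x + t • N x = y + t • N y := hxy
      rw [smul_sub, sub_eq_sub_iff_add_eq_add, this, add_comm]
    have h2 := hK.dist_le_mul y x
    rw [dist_eq_norm, dist_eq_norm, norm_sub_rev y x] at h2
    have h3 : ‖x - y‖ ≤ t * (K * ‖x - y‖) := by
      calc ‖x - y‖ = t * ‖N y - N x‖ := by rw [h1, norm_smul, Real.norm_of_nonneg ht]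
        _ ≤ _ := by gcongr
    have h4 : ‖x - y‖ = 0 := by nlinarith [norm_nonneg (x - y)]
    exact sub_eq_zero.1 (norm_eq_zero.1 h4)
  have hd : ∀ x, (1 : ℝ≥0∞) ≤ 2 * ENNReal.ofReal
      |(ContinuousLinearMap.id ℝ E3 + t • fderiv ℝ N x).det| := by
    intro x
    have h1 : ‖fderiv ℝ N x‖ ≤ K := norm_fderiv_le_of_lipschitz ℝ hK
    have h2 := hρd (y := ContinuousLinearMap.id ℝ E3 + t • fderiv ℝ N x) (by
      rw [dist_eq_norm, add_sub_cancel_left, norm_smul, Real.norm_of_nonneg ht]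
      refine lt_of_le_of_lt ?_ ht2
      gcongr)
    have h3 : ∀ d : ℝ, 1 / 2 < d → (1 : ℝ≥0∞) ≤ 2 * ENNReal.ofReal d := fun d hd => by
      rw [← ENNReal.ofReal_ofNat, ← ENNReal.ofReal_mul (by norm_num), ENNReal.one_le_ofReal]
      linarith
    exact h3 _ h2
  refine Measure.le_iff.2 fun E hE => ?_
  have hmap := map_withDensity_abs_det_fderiv_eq_addHaar (volume : Measure E3)
    (s := univ) (f := Φ) nullMeasurableSet_univ (fun x _ => (hfd x).hasFDerivWithinAt) hinj.injOn
  rw [Measure.map_apply hΦc.measurable hE, Measure.smul_apply, smul_eq_mul]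
  have hpre : MeasurableSet (Φ ⁻¹' E) := hΦc.measurable hE
  calc volume (Φ ⁻¹' E) = ∫⁻ x in Φ ⁻¹' E, 1 := by rw [lintegral_one, Measure.restrict_apply_univ]
    _ ≤ ∫⁻ x in Φ ⁻¹' E, 2 * ENNReal.ofReal
        |(ContinuousLinearMap.id ℝ E3 + t • fderiv ℝ N x).det| := lintegral_mono fun x => hd x
    _ = 2 * ∫⁻ x in Φ ⁻¹' E, ENNReal.ofReal
        |(ContinuousLinearMap.id ℝ E3 + t • fderiv ℝ N x).det| :=
      lintegral_const_mul' _ _ ENNReal.ofNat_ne_top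
    _ = 2 * Measure.map Φ ((volume.restrict univ).withDensity fun x => ENNReal.ofReal
        |(ContinuousLinearMap.id ℝ E3 + t • fderiv ℝ N x).det|) E := by
      rw [Measure.map_apply hΦc.measurable hE, withDensity_apply _ hpre, Measure.restrict_univ]
    _ ≤ 2 * volume E := by
      rw [hmap]
      gcongr
      exact Measure.restrict_le_self

/-! ### Pulling back mollified fields along an outward displacement -/

theorem fderiv_add_smul_apply {N : E3 → E3} (hN : ContDiff ℝ ∞ N) (t : ℝ) (x : E3) :
    fderiv ℝ (fun y => y + t • N y) x = ContinuousLinearMap.id ℝ E3 + t • fderiv ℝ N x :=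
  ((hasFDerivAt_id x).add
    ((hN.differentiable (by simp) x).hasFDerivAt.const_smul t)).fderiv

theorem pullback_add (Φ S T : E3 → E3) : pullback Φ (S + T) = pullback Φ S + pullback Φ T := by
  funext x; simp [pullback]

/-- Pulling back a mollification along a small outward displacement is close to the identity
in `L²(A)`. -/
theorem exists_eLpNorm_pullback_moll_sub_le {A : Set E3} (hAb : Bornology.IsBounded A)
    {N : E3 → E3} (hN : ContDiff ℝ ∞ N) (hNc : HasCompactSupport N) {f : E3 → E3}
    (hf : MemLp f 2 volume) {ε : ℝ≥0∞} (hε : ε ≠ 0) :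
    ∃ τ : ℝ, 0 < τ ∧ ∀ t, 0 ≤ t → t ≤ τ → ∀ η : ContDiffBump (0 : E3), η.rOut ≤ τ →
      eLpNorm (fun x => pullback (fun y => y + t • N y) (moll η f) x - f x) 2
        (volume.restrict A) ≤ ε := by
  obtain ⟨δ, hδ, hδε⟩ : ∃ δ : ℝ≥0∞, δ ≠ 0 ∧ 4 * δ + (δ + δ) ≤ ε := by
    refine ⟨ε / 6, by simp [hε], ?_⟩
    rw [← two_mul, ← add_mul]
    norm_num
    rw [ENNReal.mul_div_cancel (by norm_num) (by norm_num)]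
  obtain ⟨g, hgc, hfg, hgcont, hgL⟩ := hf.exists_hasCompactSupport_eLpNorm_sub_le
    ENNReal.ofNat_ne_top hδ
  obtain ⟨K, hK⟩ := exists_lipschitz_of_contDiff hN hNc
  obtain ⟨B, hB⟩ := hNc.exists_bound_of_continuous hN.continuous
  obtain ⟨Γ, hΓ⟩ := hgc.exists_bound_of_continuous hgcont
  obtain ⟨τ₁, hτ₁, hmap⟩ := exists_map_add_smul_le hN hNc
  have hB0 : 0 ≤ B := (norm_nonneg _).trans (hB 0)
  have hΓ0 : 0 ≤ Γ := (norm_nonneg _).trans (hΓ 0)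
  -- the uniform accuracy needed for the continuous part
  obtain ⟨θ, hθ, hθδ⟩ : ∃ θ : ℝ, 0 < θ ∧
      (volume.restrict A) univ ^ (2 : ℝ≥0∞).toReal⁻¹ * ENNReal.ofReal θ ≤ δ := by
    have hfin : (volume.restrict A) univ ^ (2 : ℝ≥0∞).toReal⁻¹ ≠ ⊤ :=
      ENNReal.rpow_ne_top_of_nonneg (by simp) (by
        rw [Measure.restrict_apply_univ]; exact hAb.measure_lt_top.ne)
    have hlim : Tendsto (fun θ : ℝ => (volume.restrict A) univ ^ (2 : ℝ≥0∞).toReal⁻¹ *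
        ENNReal.ofReal θ) (𝓝[>] 0) (𝓝 ((volume.restrict A) univ ^ (2 : ℝ≥0∞).toReal⁻¹ *
          ENNReal.ofReal 0)) :=
      ENNReal.Tendsto.const_mul
        ((ENNReal.continuous_ofReal.tendsto 0).mono_left nhdsWithin_le_nhds) (Or.inr hfin)
    rw [ENNReal.ofReal_zero, mul_zero] at hlim
    obtain ⟨θ, h1, h2⟩ := ((hlim.eventually_le_const (pos_iff_ne_zero.2 hδ)).and
      self_mem_nhdsWithin).exists
    exact ⟨θ, h2, h1⟩
  have huc : UniformContinuous g := hgc.uniformContinuous_of_continuous hgcont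
  obtain ⟨ρ, hρ, hρg⟩ := Metric.uniformContinuous_iff.1 huc (θ / 4) (by positivity)
  set τ := min (min τ₁ (1 / (K + 1))) (min (min ρ (ρ / (2 * (B + 1))))
    (θ / (4 * (K + 1) * (Γ + θ)))) with hτ
  refine ⟨τ, by positivity, fun t ht htτ η hη => ?_⟩
  have ht1 : t ≤ τ₁ := htτ.trans ((min_le_left _ _).trans (min_le_left _ _))
  have ht2 : t * K ≤ 1 := by
    have := htτ.trans ((min_le_left _ _).trans (min_le_right _ _))
    rw [le_div_iff₀ (by positivity)] at this
    nlinarith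
  have ht3 : t * B < ρ := by
    have := htτ.trans ((min_le_right _ _).trans ((min_le_left _ _).trans (min_le_right _ _)))
    rw [le_div_iff₀ (by positivity)] at this
    nlinarith
  have ht4 : t * K * (Γ + θ) ≤ θ / 4 := by
    have := htτ.trans ((min_le_right _ _).trans (min_le_right _ _))
    rw [le_div_iff₀ (by positivity)] at this
    have h0 : 0 ≤ t * (Γ + θ) := by positivity
    nlinarith
  have hηρ : η.rOut ≤ ρ :=
    hη.trans ((min_le_right _ _).trans ((min_le_left _ _).trans (min_le_left _ _)))
  set Φ : E3 → E3 := fun y => y + t • N y with hΦdef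
  have hΦ : ContDiff ℝ ∞ Φ := contDiff_id.add (hN.const_smul t)
  have hDN : ∀ x, ‖fderiv ℝ N x‖ ≤ K := fun x => norm_fderiv_le_of_lipschitz ℝ hK
  have hpb : ∀ (S : E3 → E3) x, pullback Φ S x =
      S (Φ x) + t • ContinuousLinearMap.adjoint (fderiv ℝ N x) (S (Φ x)) := by
    intro S x
    refine ext_inner_right ℝ fun v => ?_
    rw [inner_pullback, hΦdef, fderiv_add_smul_apply hN, inner_add_left, inner_smul_left,
      ContinuousLinearMap.adjoint_inner_left]
    simp [inner_add_right, inner_smul_right]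
  have hadj : ∀ x (v : E3), ‖t • ContinuousLinearMap.adjoint (fderiv ℝ N x) v‖ ≤ t * K * ‖v‖ := by
    intro x v
    rw [norm_smul, Real.norm_of_nonneg ht, mul_assoc]
    refine mul_le_mul_of_nonneg_left ?_ ht
    refine ContinuousLinearMap.le_of_opNorm_le _ ?_ v
    rw [LinearIsometryEquiv.norm_map]; exact hDN x
  have hgi : LocallyIntegrable g := hgcont.locallyIntegrable
  have hd : MemLp (f - g) 2 volume := hf.sub hgL
  have hdi : LocallyIntegrable (f - g) := hd.locallyIntegrable one_le_two
  -- the rough part is controlled by `L²` bounds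
  have hrough : eLpNorm (pullback Φ (moll η (f - g))) 2 (volume.restrict A) ≤ 4 * δ := by
    set S := moll η (f - g)
    have hSc : Continuous S := (contDiff_moll η hdi).continuous
    have h1 : eLpNorm (pullback Φ S) 2 (volume.restrict A) ≤
        ENNReal.ofReal 2 * eLpNorm (S ∘ Φ) 2 volume := by
      refine (eLpNorm_mono_measure _ Measure.restrict_le_self).trans ?_
      refine eLpNorm_le_mul_eLpNorm_of_ae_le_mul (Eventually.of_forall fun x => ?_) 2
      rw [hpb]
      have := hadj x (S (Φ x))
      refine (norm_add_le _ _).trans ?_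
      have : t * K * ‖S (Φ x)‖ ≤ 1 * ‖S (Φ x)‖ := by gcongr
      simp only [Function.comp_apply]
      linarith
    have h2 : eLpNorm (S ∘ Φ) 2 volume ≤ 2 * eLpNorm S 2 volume := by
      rw [← eLpNorm_map_measure hSc.aestronglyMeasurable hΦ.continuous.aemeasurable]
      refine (eLpNorm_mono_measure _ (hmap t ht ht1)).trans ?_
      rw [eLpNorm_smul_measure_of_ne_top ENNReal.ofNat_ne_top, smul_eq_mul]
      gcongr
      conv_rhs => rw [← ENNReal.rpow_one 2]
      exact ENNReal.rpow_le_rpow_of_exponent_le (by norm_num) (by norm_num)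
    have h3 : eLpNorm S 2 volume ≤ δ := (eLpNorm_moll_le η hd.aestronglyMeasurable).trans hfg
    calc _ ≤ ENNReal.ofReal 2 * (2 * δ) := h1.trans (by gcongr; exact h2.trans (by gcongr))
      _ = 4 * δ := by rw [ENNReal.ofReal_ofNat, ← mul_assoc]; norm_num
  -- the continuous part is controlled uniformly
  have hunif : ∀ x, ‖pullback Φ (moll η g) x - g x‖ ≤ θ := by
    intro x
    have h1 : ‖moll η g (Φ x) - g (Φ x)‖ ≤ θ / 4 := by
      rw [← dist_eq_norm]
      exact η.dist_normed_convolution_le hgcont.aestronglyMeasurable fun y hy =>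
        (hρg (lt_of_lt_of_le hy hηρ)).le
    have h2 : ‖g (Φ x) - g x‖ ≤ θ / 4 := by
      rw [← dist_eq_norm]
      refine (hρg ?_).le
      rw [dist_eq_norm, hΦdef, add_sub_cancel_left, norm_smul, Real.norm_of_nonneg ht]
      exact lt_of_le_of_lt (by gcongr; exact hB x) ht3
    have h3 : ‖moll η g (Φ x)‖ ≤ Γ + θ := by
      have := norm_le_norm_add_norm_sub' (moll η g (Φ x)) (g (Φ x))
      linarith [hΓ (Φ x)]
    have h4 := hadj x (moll η g (Φ x))
    have h5 : t * K * ‖moll η g (Φ x)‖ ≤ t * K * (Γ + θ) := by gcongr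
    rw [hpb]
    have e : moll η g (Φ x) + t • ContinuousLinearMap.adjoint (fderiv ℝ N x) (moll η g (Φ x)) - g x =
        (moll η g (Φ x) - g (Φ x)) + (g (Φ x) - g x) +
          t • ContinuousLinearMap.adjoint (fderiv ℝ N x) (moll η g (Φ x)) := by abel
    rw [e]
    refine (norm_add₃_le).trans ?_
    linarith
  have hsmooth : eLpNorm (fun x => pullback Φ (moll η g) x - g x) 2 (volume.restrict A) ≤ δ :=
    (eLpNorm_le_of_ae_bound (Eventually.of_forall hunif)).trans hθδ
  have hsplit : (fun x => pullback Φ (moll η f) x - f x) = pullback Φ (moll η (f - g)) +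
      ((fun x => pullback Φ (moll η g) x - g x) + (g - f)) := by
    have e : moll η f = moll η (f - g) + moll η g := by
      rw [← moll_add η hdi hgi, sub_add_cancel]
    rw [e, pullback_add]
    funext x
    simp only [Pi.add_apply, Pi.sub_apply]
    abel
  have hm1 : AEStronglyMeasurable (pullback Φ (moll η (f - g))) (volume.restrict A) :=
    (contDiff_pullback hΦ (contDiff_moll η hdi)).continuous.aestronglyMeasurable
  have hm2 : AEStronglyMeasurable (fun x => pullback Φ (moll η g) x - g x) (volume.restrict A) :=
    ((contDiff_pullback hΦ (contDiff_moll η hgi)).continuous.sub hgcont).aestronglyMeasurable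
  have hm3 : AEStronglyMeasurable (g - f) (volume.restrict A) :=
    (hgcont.aestronglyMeasurable.sub hf.aestronglyMeasurable).restrict
  rw [hsplit]
  refine (eLpNorm_add_le hm1 (hm2.add hm3) one_le_two).trans ?_
  refine (add_le_add hrough ((eLpNorm_add_le hm2 hm3 one_le_two).trans
    (add_le_add hsmooth ?_))).trans hδε
  rw [eLpNorm_sub_comm]
  exact (eLpNorm_mono_measure _ Measure.restrict_le_self).trans hfg

/-- After displacement along the outward field `N`, the mollification of a function vanishing off
`A` vanishes in a neighbourhood of the complement of `A`. -/
theorem exists_thickening_moll_eq_zero {A : Set E3} {N : E3 → E3} {K : ℝ≥0}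
    (hK : LipschitzWith K N) {c t : ℝ} (hc : 0 < c) (ht : 0 < t)
    (hpush : ∀ x ∉ A, ∀ w, ‖w‖ ≤ c * t → x + t • N x + w ∉ A) :
    ∃ d : ℝ, 0 < d ∧ ∀ η : ContDiffBump (0 : E3), η.rOut ≤ c * t / 2 →
      ∀ {F : Type} [NormedAddCommGroup F] [NormedSpace ℝ F] (f : E3 → F), (∀ x ∉ A, f x = 0) →
        ∀ x ∈ thickening d Aᶜ, moll η f (x + t • N x) = 0 := by
  refine ⟨c * t / (2 * (1 + t * K)), by positivity, fun η hη F _ _ f hf x hx => ?_⟩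
  obtain ⟨z, hz, hxz⟩ := mem_thickening_iff.1 hx
  refine moll_eq_zero_of_forall_ball η fun y hy => hf y ?_
  have e : y = z + t • N z + ((y - (x + t • N x)) + ((x - z) + t • (N x - N z))) := by
    rw [smul_sub]; abel
  rw [e]
  refine hpush z hz _ ?_
  rw [lt_div_iff₀ (by positivity), dist_eq_norm] at hxz
  have h1 : ‖y - (x + t • N x)‖ < c * t / 2 := by
    rw [← dist_eq_norm]; exact lt_of_lt_of_le hy hη
  have h2 : ‖t • (N x - N z)‖ ≤ t * (K * ‖x - z‖) := by
    rw [norm_smul, Real.norm_of_nonneg ht.le]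
    gcongr
    simpa [dist_eq_norm] using hK.dist_le_mul x z
  have h3 := norm_add_le (y - (x + t • N x)) ((x - z) + t • (N x - N z))
  have h4 := norm_add_le (x - z) (t • (N x - N z))
  nlinarith

theorem tsupport_subset_of_thickening {A : Set E3} {F : Type*} [NormedAddCommGroup F]
    {f : E3 → F} {d : ℝ} (hd : 0 < d) (hf : ∀ x ∈ thickening d Aᶜ, f x = 0) : tsupport f ⊆ A := by
  have h1 : tsupport f ⊆ (thickening d Aᶜ)ᶜ :=
    closure_minimal (fun x hx hx' => hx (hf x hx')) isOpen_thickening.isClosed_compl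
  refine h1.trans ?_
  rw [compl_subset_comm]
  exact self_subset_thickening hd _

theorem hasCompactSupport_of_tsupport_subset {A : Set E3} (hAb : Bornology.IsBounded A)
    {F : Type*} [NormedAddCommGroup F] {f : E3 → F} (hf : tsupport f ⊆ A) : HasCompactSupport f :=
  Metric.isCompact_of_isClosed_isBounded (isClosed_tsupport f) (hAb.subset hf)

/-! ### Approximation by test functions and test fields supported in the domain -/

theorem inner_gradient (u : E3 → ℝ) (x v : E3) : inner ℝ (gradient u x) v = fderiv ℝ u x v := by
  simp [gradient]

theorem norm_gradient (u : E3 → ℝ) (x : E3) : ‖gradient u x‖ = ‖fderiv ℝ u x‖ := by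
  simp [gradient]

theorem measurable_gradient (u : E3 → ℝ) : Measurable (gradient u) :=
  (InnerProductSpace.toDual ℝ E3).symm.continuous.measurable.comp (measurable_fderiv ℝ u)

/-- Integration by parts for a Lipschitz function against a test function. -/
theorem integral_fderiv_mul_eq_neg {u ψ : E3 → ℝ} {C : ℝ≥0} (hu : LipschitzWith C u)
    (hψ : ContDiff ℝ ∞ ψ) (hc : HasCompactSupport ψ) (v : E3) :
    ∫ x, fderiv ℝ u x v * ψ x = -∫ x, u x * fderiv ℝ ψ x v := by
  obtain ⟨D, hD⟩ := exists_lipschitz_of_contDiff hψ hc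
  have h := hu.integral_lineDeriv_mul_eq (μ := volume) hD hc v
  have h1 : ∫ x, fderiv ℝ u x v * ψ x = ∫ x, lineDeriv ℝ u x v * ψ x := by
    refine integral_congr_ae ?_
    filter_upwards [hu.ae_differentiableAt (μ := volume)] with x hx
    rw [hx.lineDeriv_eq_fderiv]
  rw [h1, h, ← integral_neg]
  refine integral_congr_ae (Eventually.of_forall fun x => ?_)
  simp only [((hψ.differentiable (by simp)) x).lineDeriv_eq_fderiv, map_neg]
  ring

theorem integrable_mul_of_hasCompactSupport {u ψ : E3 → ℝ} (hu : Continuous u)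
    (hψ : Continuous ψ) (hc : HasCompactSupport ψ) : Integrable fun x => u x * ψ x :=
  (hu.mul hψ).integrable_of_hasCompactSupport hc.mul_left

theorem integrable_fderiv_mul {u ψ : E3 → ℝ} {C : ℝ≥0} (hu : LipschitzWith C u)
    (hψ : Continuous ψ) (hc : HasCompactSupport ψ) (v : E3) :
    Integrable fun x => fderiv ℝ u x v * ψ x := by
  refine (hψ.integrable_of_hasCompactSupport hc).bdd_mul (c := C * ‖v‖)
    (measurable_fderiv_apply_const ℝ u v).aestronglyMeasurable (Eventually.of_forall fun x => ?_)
  exact (fderiv ℝ u x).le_of_opNorm_le (norm_fderiv_le_of_lipschitz ℝ hu) v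

theorem locallyIntegrable_gradient {u : E3 → ℝ} {C : ℝ≥0} (hu : LipschitzWith C u) :
    LocallyIntegrable (gradient u) := by
  have h : MemLp (gradient u) ⊤ volume :=
    memLp_top_of_bound (measurable_gradient u).aestronglyMeasurable C
      (Eventually.of_forall fun x => by
        rw [norm_gradient]; exact norm_fderiv_le_of_lipschitz ℝ hu)
  exact h.locallyIntegrable le_top

/-- Mollification commutes with the gradient of Lipschitz functions. -/
theorem gradient_moll (η : ContDiffBump (0 : E3)) {u : E3 → ℝ} {C : ℝ≥0} (hu : LipschitzWith C u) :
    gradient (moll η u) = moll η (gradient u) := by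
  funext x
  refine ext_inner_right ℝ fun v => ?_
  have hL := locallyIntegrable_gradient hu
  rw [inner_gradient, fderiv_moll_apply η hu.continuous.locallyIntegrable, moll_eq_integral,
    real_inner_comm, ← integral_inner (integrable_moll_integrand η hL x)]
  have h := integral_fderiv_mul_eq_neg hu (contDiff_normed_sub η x)
    (hasCompactSupport_normed_sub η x) v
  simp only [fderiv_normed_sub, mul_neg] at h
  rw [integral_neg, neg_neg] at h
  calc _ = ∫ y, u y * fderiv ℝ (η.normed volume) (x - y) v :=
        integral_congr_ae (Eventually.of_forall fun y => by simp [mul_comm])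
    _ = _ := h.symm
    _ = _ := integral_congr_ae (Eventually.of_forall fun y => by
        simp only [inner_smul_right, real_inner_comm (gradient u y), inner_gradient]; ring)

theorem gradient_comp {Φ : E3 → E3} {w : E3 → ℝ} (hΦ : ContDiff ℝ ∞ Φ) (hw : ContDiff ℝ ∞ w)
    (x : E3) : gradient (fun y => w (Φ y)) x = pullback Φ (gradient w) x := by
  refine ext_inner_right ℝ fun v => ?_
  have h : HasFDerivAt (fun y => w (Φ y)) ((fderiv ℝ w (Φ x)).comp (fderiv ℝ Φ x)) x :=
    (hw.differentiable (by simp) _).hasFDerivAt.comp x (hΦ.differentiable (by simp) x).hasFDerivAt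
  rw [inner_pullback, inner_gradient, inner_gradient, h.fderiv]; rfl

theorem exists_contDiffBump_rOut_le {a b : ℝ} (ha : 0 < a) (hb : 0 < b) :
    ∃ η : ContDiffBump (0 : E3), η.rOut ≤ a ∧ η.rOut ≤ b :=
  ⟨⟨min a b / 2, min a b, by positivity, half_lt_self (by positivity)⟩, min_le_left _ _,
    min_le_right _ _⟩

/-- Lipschitz functions vanishing off `A` are approximated in energy by test functions. -/
theorem IsC11.exists_test_gradient_close {A : Set E3} (hAo : IsOpen A)
    (hAb : Bornology.IsBounded A) (hA : IsC11 A)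
    {u : E3 → ℝ} {C : ℝ≥0} (hu : LipschitzWith C u)
    (hu0 : ∀ x ∉ A, u x = 0) {ε : ℝ≥0∞} (hε : ε ≠ 0) :
    ∃ w : E3 → ℝ, ContDiff ℝ ∞ w ∧ HasCompactSupport w ∧ tsupport w ⊆ A ∧
      eLpNorm (fun x => gradient w x - gradient u x) 2 (volume.restrict A) ≤ ε := by
  obtain ⟨N, c, t₀, hN, hNc, hc, ht₀, hpush⟩ := hA.exists_outward_field hAo hAb
  obtain ⟨K, hK⟩ := exists_lipschitz_of_contDiff hN hNc
  have hgm : MemLp (gradient u) 2 volume := by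
    have h1 : MemLp (gradient u) 2 (volume.restrict A) := by
      have : IsFiniteMeasure (volume.restrict A) := ⟨by
        rw [Measure.restrict_apply_univ]; exact hAb.measure_lt_top⟩
      exact MemLp.of_bound (measurable_gradient u).aestronglyMeasurable C
        (Eventually.of_forall fun x => by
          rw [norm_gradient]; exact norm_fderiv_le_of_lipschitz ℝ hu)
    rw [← memLp_indicator_iff_restrict hAo.measurableSet] at h1
    have h2 : A.indicator (gradient u) = gradient u := by
      refine indicator_eq_self.2 fun x hx => ?_
      by_contra hxA
      exact hx (by rw [gradient, hA.fderiv_eq_zero_of_notMem hAo hu0 hxA, map_zero])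
    rwa [h2] at h1
  obtain ⟨τ, hτ, hclose⟩ := exists_eLpNorm_pullback_moll_sub_le hAb hN hNc hgm hε
  set t := min τ t₀
  have ht : 0 < t := by positivity
  obtain ⟨d, hd, hzero⟩ := exists_thickening_moll_eq_zero hK hc ht
    (hpush t ht (min_le_right _ _))
  obtain ⟨η, hη1, hη2⟩ := exists_contDiffBump_rOut_le hτ (show 0 < c * t / 2 by positivity)
  have hΦ : ContDiff ℝ ∞ fun y => y + t • N y := contDiff_id.add (hN.const_smul t)
  have hms : ContDiff ℝ ∞ (moll η u) := contDiff_moll η hu.continuous.locallyIntegrable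
  have hsup := tsupport_subset_of_thickening (f := fun x => moll η u (x + t • N x)) hd
    (hzero η hη2 u hu0)
  refine ⟨fun x => moll η u (x + t • N x), hms.comp hΦ,
    hasCompactSupport_of_tsupport_subset hAb hsup, hsup, ?_⟩
  have e : ∀ x, gradient (fun x => moll η u (x + t • N x)) x =
      pullback (fun y => y + t • N y) (moll η (gradient u)) x := fun x => by
    rw [← gradient_moll η hu]; exact gradient_comp hΦ hms x
  simp only [e]
  exact hclose t ht.le (min_le_left _ _) η hη1

/-- Fields vanishing off `A` whose curl on the whole space takes values in the convex set `Δ` are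
approximated in `L²(A)` by test fields in `A` with the same constraint on the curl. -/
theorem IsC11.exists_test_field_close {A : Set E3} (hAo : IsOpen A)
    (hAb : Bornology.IsBounded A) (hA : IsC11 A)
    {Δ : Set E3} (hΔ_conv : Convex ℝ Δ) (hΔ_comp : IsCompact Δ)
    (hΔ_zero : 0 ∈ interior Δ) {f J : E3 → E3} (hf : MemLp f 2 volume) (hf0 : ∀ x ∉ A, f x = 0)
    (hJ : LocallyIntegrable J) (hJΔ : ∀ᵐ x, J x ∈ Δ)
    (hcurl : ∀ Φ : E3 → E3, ContDiff ℝ ∞ Φ → HasCompactSupport Φ →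
      ∫ x, inner ℝ (f x) (curl Φ x) = ∫ x, inner ℝ (J x) (Φ x)) {ε : ℝ≥0∞} (hε : ε ≠ 0) :
    ∃ W : E3 → E3, ContDiff ℝ ∞ W ∧ HasCompactSupport W ∧ tsupport W ⊆ A ∧
      (∀ x, gauge Δ (curl W x) ≤ 1) ∧
      eLpNorm (fun x => W x - f x) 2 (volume.restrict A) ≤ ε := by
  obtain ⟨N, c, t₀, hN, hNc, hc, ht₀, hpush⟩ := hA.exists_outward_field hAo hAb
  obtain ⟨K, hK⟩ := exists_lipschitz_of_contDiff hN hNc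
  obtain ⟨r, hr, hrΔ⟩ := Metric.isOpen_iff.1 isOpen_interior 0 hΔ_zero
  replace hrΔ : ball 0 r ⊆ Δ := hrΔ.trans interior_subset
  have hΔnhds : Δ ∈ 𝓝 (0 : E3) := mem_interior_iff_mem_nhds.1 hΔ_zero
  obtain ⟨D, hD⟩ := hΔ_comp.isBounded.exists_norm_le
  have hD0 : 0 ≤ D := (norm_nonneg _).trans (hD 0 (interior_subset hΔ_zero))
  have hgcont : Continuous (gauge Δ) := continuous_gauge hΔ_conv hΔnhds
  have hgle : ∀ v, gauge Δ v ≤ 1 ↔ v ∈ Δ := fun v => by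
    have := gauge_le_one_iff_mem_closure hΔ_conv hΔnhds (x := v)
    rwa [hΔ_comp.isClosed.closure_eq] at this
  have hε2 : ε / 2 ≠ 0 := by simp [hε]
  -- a homothety of ratio `s < 1` makes room for the change of the curl under pullback
  obtain ⟨s, hs0, hs1, hsε⟩ : ∃ s : ℝ, 0 < s ∧ s < 1 ∧
      eLpNorm ((s - 1) • f) 2 volume ≤ ε / 2 := by
    have hlim : Tendsto (fun s : ℝ => ‖s - 1‖ₑ * eLpNorm f 2 volume) (𝓝[<] 1)
        (𝓝 (‖(1 : ℝ) - 1‖ₑ * eLpNorm f 2 volume)) := by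
      refine ENNReal.Tendsto.mul_const ?_ (Or.inr hf.eLpNorm_ne_top)
      exact ((continuous_enorm.comp (continuous_id.sub continuous_const)).tendsto
        (1 : ℝ)).mono_left nhdsWithin_le_nhds
    rw [sub_self, enorm_zero, zero_mul] at hlim
    obtain ⟨s, h1, h2⟩ := ((hlim.eventually_le_const (pos_iff_ne_zero.2 hε2)).and
      (Ioo_mem_nhdsLT (show (0 : ℝ) < 1 by norm_num))).exists
    exact ⟨s, h2.1, h2.2, by rwa [eLpNorm_const_smul]⟩
  obtain ⟨τ, hτ, hclose⟩ := exists_eLpNorm_pullback_moll_sub_le hAb hN hNc (hf.const_smul s) hε2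
  -- the gauge of the curl changes by at most `κ * t`, to be absorbed by `1 - s`
  set κ : ℝ := 18 * (2 * K + (K : ℝ) ^ 2) * D / r with hκ
  set t := min (min τ t₀) (min 1 ((1 - s) / (κ + 1))) with htdef
  have h1s : 0 < 1 - s := by linarith
  have ht : 0 < t := by positivity
  obtain ⟨d, hd, hzero⟩ := exists_thickening_moll_eq_zero hK hc ht
    (hpush t ht ((min_le_left _ _).trans (min_le_right _ _)))
  obtain ⟨η, hη1, hη2⟩ := exists_contDiffBump_rOut_le hτ (show 0 < c * t / 2 by positivity)
  have hΦ : ContDiff ℝ ∞ fun y => y + t • N y := contDiff_id.add (hN.const_smul t)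
  have hfi : LocallyIntegrable (s • f) := (hf.const_smul s).locallyIntegrable one_le_two
  have hJi : LocallyIntegrable (s • J) := hJ.smul s
  have hms : ContDiff ℝ ∞ (moll η (s • f)) := contDiff_moll η hfi
  have hsup := tsupport_subset_of_thickening
    (f := pullback (fun y => y + t • N y) (moll η (s • f))) hd (fun x hx => by
      rw [pullback, hzero η hη2 (s • f) (fun x hx => by simp [hf0 x hx]) x hx, map_zero])
  refine ⟨pullback (fun y => y + t • N y) (moll η (s • f)), contDiff_pullback hΦ hms,
    hasCompactSupport_of_tsupport_subset hAb hsup, hsup, fun x => ?_, ?_⟩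
  · have hcm : ∀ y, curl (moll η (s • f)) y = moll η (s • J) y := by
      refine curl_moll η hfi hJi fun Φ hΦ hΦc => ?_
      simp only [Pi.smul_apply, inner_smul_left, conj_trivial, integral_const_mul]
      rw [hcurl Φ hΦ hΦc]
    have hgs : ∀ y, gauge Δ (curl (moll η (s • f)) y) ≤ s := by
      intro y
      rw [hcm]
      refine moll_mem_of_convex η hJi (s := {v | gauge Δ v ≤ s}) ?_ ?_ ?_ y
      · exact hΔ_conv.setOfPred_gauge_le (interior_subset hΔ_zero)
          (absorbent_nhds_zero hΔnhds) s
      · exact isClosed_le hgcont continuous_const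
      · filter_upwards [hJΔ] with y hy
        change gauge Δ (s • J y) ≤ s
        rw [gauge_smul_of_nonneg hs0.le, smul_eq_mul]
        exact mul_le_of_le_one_right hs0.le ((hgle _).2 hy)
    set y := x + t • N x
    have h1 := norm_curl_pullback_sub_le hN hms ht.le
      ((min_le_right _ _).trans (min_le_left _ _)) (x := x) (norm_fderiv_le_of_lipschitz ℝ hK)
    have h2 : ‖curl (moll η (s • f)) y‖ ≤ D := hD _ ((hgle _).1 ((hgs y).trans hs1.le))
    set a := curl (pullback (fun y => y + t • N y) (moll η (s • f))) x
    set b := curl (moll η (s • f)) y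
    have h3 : r * gauge Δ (a - b) ≤ ‖a - b‖ := mul_gauge_le_norm hrΔ
    have h4 : gauge Δ a ≤ gauge Δ b + gauge Δ (a - b) := by
      have := gauge_add_le hΔ_conv (absorbent_nhds_zero hΔnhds) b (a - b)
      rwa [add_sub_cancel] at this
    have h5 : ‖a - b‖ ≤ r * (κ * t) := by
      refine h1.trans ?_
      calc _ ≤ 18 * (2 * K + (K : ℝ) ^ 2) * t * D := by gcongr
        _ = _ := by rw [hκ]; field_simp
    have h6 : gauge Δ (a - b) ≤ κ * t := le_of_mul_le_mul_left (h3.trans h5) hr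
    have h7 : t * (κ + 1) ≤ 1 - s := by
      have : t ≤ (1 - s) / (κ + 1) := (min_le_right _ _).trans (min_le_right _ _)
      rwa [le_div_iff₀ (by positivity)] at this
    have := hgs y
    nlinarith
  · have e : (fun x => pullback (fun y => y + t • N y) (moll η (s • f)) x - f x) =
        (fun x => pullback (fun y => y + t • N y) (moll η (s • f)) x - (s • f) x) +
          (s - 1) • f := by
      funext x
      rw [Pi.add_apply, Pi.smul_apply, Pi.smul_apply, sub_smul, one_smul]; abel
    rw [e]
    refine (eLpNorm_add_le ?_ (hf.const_smul _).aestronglyMeasurable.restrict one_le_two).trans ?_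
    · exact (contDiff_pullback hΦ hms).continuous.aestronglyMeasurable.sub
        (hf.const_smul s).aestronglyMeasurable.restrict
    · refine (add_le_add (hclose t ht.le ((min_le_left _ _).trans (min_le_left _ _)) η hη1)
        ((eLpNorm_mono_measure _ Measure.restrict_le_self).trans hsε)).trans ?_
      rw [ENNReal.add_halves]

/-! ### Green's formulas -/

theorem isFiniteMeasure_restrict {A : Set E3} (hAb : Bornology.IsBounded A) :
    IsFiniteMeasure (volume.restrict A) :=
  ⟨by rw [Measure.restrict_apply_univ]; exact hAb.measure_lt_top⟩

/-- Green's formula without boundary term, against all test fields on the whole space, encodes both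
the curl in `A` and the vanishing of the tangential trace. -/
theorem memX_of_green {A : Set E3} (hAo : IsOpen A) (hAb : Bornology.IsBounded A) {p : ℝ}
    (hp : 1 ≤ p) {V J : E3 → E3} (hV : MemLp V (ENNReal.ofReal p) (volume.restrict A))
    (hJ : MemLp J (ENNReal.ofReal p) (volume.restrict A))
    (hgreen : ∀ Φ : E3 → E3, ContDiff ℝ ∞ Φ → HasCompactSupport Φ →
      ∫ x in A, inner ℝ (V x) (curl Φ x) = ∫ x in A, inner ℝ (J x) (Φ x))
    (hdiv : DivFree A V) : MemX A p V ∧ weakCurl A V =ᵐ[volume.restrict A] J := by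
  have := isFiniteMeasure_restrict hAb
  have hp' : 1 ≤ ENNReal.ofReal p := ENNReal.one_le_ofReal.2 hp
  have hW : HasWeakCurl A V J :=
    ⟨IntegrableOn.locallyIntegrableOn (hV.integrable hp'),
      IntegrableOn.locallyIntegrableOn (hJ.integrable hp'), fun Φ hΦ hc _ => hgreen Φ hΦ hc⟩
  have hae : weakCurl A V =ᵐ[volume.restrict A] J := (hasWeakCurl_weakCurl hW).ae_eq hAo hW
  refine ⟨⟨hV, ⟨J, hW⟩, hJ.ae_eq hae.symm, hdiv, fun Φ hΦ hc => ?_⟩, hae⟩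
  rw [hgreen Φ hΦ hc]
  refine integral_congr_ae ?_
  filter_upwards [hae] with x hx
  rw [hx]

/-- The divergence of a vector field. -/
noncomputable def divergence (W : E3 → E3) (x : E3) : ℝ := ∑ i : Fin 3, pd i i W x

theorem contDiff_apply {P : E3 → E3} (hP : ContDiff ℝ ∞ P) (j : Fin 3) :
    ContDiff ℝ ∞ fun x => P x j := contDiff_euclidean.1 hP j

theorem hasCompactSupport_apply {P : E3 → E3} (hP : HasCompactSupport P) (j : Fin 3) :
    HasCompactSupport fun x => P x j := hP.comp_left (g := fun v : E3 => v j) rfl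

theorem pd_eq {P : E3 → E3} (hP : ContDiff ℝ ∞ P) (i j : Fin 3) (x : E3) :
    pd i j P x = fderiv ℝ (fun y => P y j) x (EuclideanSpace.single i 1) :=
  pd_eq_fderiv (hP.differentiable (by simp) x) i j

theorem contDiff_pd {P : E3 → E3} (hP : ContDiff ℝ ∞ P) (i j : Fin 3) : ContDiff ℝ ∞ (pd i j P) := by
  have : pd i j P = fun x => fderiv ℝ (fun y => P y j) x (EuclideanSpace.single i 1) :=
    funext (pd_eq hP i j)
  rw [this]
  exact contDiff_fderiv_apply (contDiff_apply hP j) _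

theorem contDiff_curl {P : E3 → E3} (hP : ContDiff ℝ ∞ P) : ContDiff ℝ ∞ (curl P) := by
  rw [contDiff_euclidean]
  intro i
  fin_cases i <;> simp [curl] <;> exact (contDiff_pd hP _ _).sub (contDiff_pd hP _ _)

theorem hasCompactSupport_curl {P : E3 → E3} (hc : HasCompactSupport P) :
    HasCompactSupport (curl P) := by
  refine HasCompactSupport.intro (K := tsupport P) hc fun x hx => ?_
  have h : ∀ i j, pd i j P x = 0 := fun i j => by
    rw [pd, fderiv_of_notMem_tsupport (𝕜 := ℝ) hx]; simp
  simp [curl, h]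

theorem inner_eq_sum (a b : E3) : inner ℝ a b = a 0 * b 0 + a 1 * b 1 + a 2 * b 2 := by
  simp [PiLp.inner_apply, Fin.sum_univ_three, mul_comm]

theorem gradient_apply (u : E3 → ℝ) (x : E3) (i : Fin 3) :
    gradient u x i = fderiv ℝ u x (EuclideanSpace.single i 1) := by
  rw [← inner_gradient, EuclideanSpace.inner_single_right]; simp

/-- Integrability together with vanishing of the integral, a notion stable under sums. -/
def IntegralZero (F : E3 → ℝ) : Prop := Integrable F ∧ ∫ x, F x = 0

theorem IntegralZero.add {F G : E3 → ℝ} (hF : IntegralZero F) (hG : IntegralZero G) :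
    IntegralZero fun x => F x + G x :=
  ⟨hF.1.add hG.1, by rw [integral_add hF.1 hG.1, hF.2, hG.2, add_zero]⟩

theorem IntegralZero.sub {F G : E3 → ℝ} (hF : IntegralZero F) (hG : IntegralZero G) :
    IntegralZero fun x => F x - G x :=
  ⟨hF.1.sub hG.1, by rw [integral_sub hF.1 hG.1, hF.2, hG.2, sub_zero]⟩

/-- `∂ᵢ (u ψ)` has integral zero. -/
theorem integralZero_fderiv_mul {u ψ : E3 → ℝ} {C : ℝ≥0} (hu : LipschitzWith C u)
    (hψ : ContDiff ℝ ∞ ψ) (hc : HasCompactSupport ψ) (i : Fin 3) :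
    IntegralZero fun x => fderiv ℝ u x (EuclideanSpace.single i 1) * ψ x +
      u x * fderiv ℝ ψ x (EuclideanSpace.single i 1) := by
  have h1 := integrable_fderiv_mul hu hψ.continuous hc (EuclideanSpace.single i 1)
  have h2 := integrable_mul_of_hasCompactSupport hu.continuous
    (contDiff_fderiv_apply hψ (EuclideanSpace.single i 1)).continuous
    (hasCompactSupport_fderiv_apply hc _)
  refine ⟨h1.add h2, ?_⟩
  rw [integral_add h1 h2, integral_fderiv_mul_eq_neg hu hψ hc]
  ring

/-- The curl is symmetric on test fields: `div (W × Φ) = Φ · curl W - W · curl Φ`. -/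
theorem integralZero_inner_curl_sub {W Φ : E3 → E3} (hW : ContDiff ℝ ∞ W) (hWc : HasCompactSupport W)
    (hΦ : ContDiff ℝ ∞ Φ) (hΦc : HasCompactSupport Φ) :
    IntegralZero fun x => inner ℝ (W x) (curl Φ x) - inner ℝ (curl W x) (Φ x) := by
  have hD : ∀ a b c : Fin 3, IntegralZero fun x => pd b a W x * Φ x c + W x a * pd b c Φ x := by
    intro a b c
    obtain ⟨K, hK⟩ := exists_lipschitz_of_contDiff (contDiff_apply hW a)
      (hasCompactSupport_apply hWc a)
    simp only [pd_eq hW, pd_eq hΦ]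
    exact integralZero_fderiv_mul hK (contDiff_apply hΦ c) (hasCompactSupport_apply hΦc c) b
  convert ((((hD 0 1 2).sub (hD 0 2 1)).add (hD 1 2 0)).sub (hD 1 0 2)).add (hD 2 0 1) |>.sub
    (hD 2 1 0) using 2 with x
  simp only [inner_eq_sum, curl]
  simp
  ring

/-- Gradients of Lipschitz functions are orthogonal to curls of test fields. -/
theorem integralZero_gradient_curl {u : E3 → ℝ} {C : ℝ≥0} (hu : LipschitzWith C u)
    {Φ : E3 → E3} (hΦ : ContDiff ℝ ∞ Φ) (hΦc : HasCompactSupport Φ) :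
    IntegralZero fun x => inner ℝ (gradient u x) (curl Φ x) := by
  have hcs := contDiff_curl hΦ
  -- the product rule `∂ᵢ (u (curl Φ)ᵢ)`, summed over `i`, and `div curl Φ = 0`
  have hD := fun i => integralZero_fderiv_mul hu (contDiff_apply hcs i)
    (hasCompactSupport_apply (hasCompactSupport_curl hΦc) i) i
  have hdc : ∀ x, fderiv ℝ (fun y => curl Φ y 0) x (EuclideanSpace.single 0 1) +
      fderiv ℝ (fun y => curl Φ y 1) x (EuclideanSpace.single 1 1) +
      fderiv ℝ (fun y => curl Φ y 2) x (EuclideanSpace.single 2 1) = 0 := by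
    intro x
    have hsymm : ∀ (j a b : Fin 3), fderiv ℝ (pd a j Φ) x (EuclideanSpace.single b 1) =
        fderiv ℝ (pd b j Φ) x (EuclideanSpace.single a 1) := by
      intro j a b
      have hq := contDiff_apply hΦ j
      have e : ∀ a b : Fin 3, fderiv ℝ (pd a j Φ) x (EuclideanSpace.single b 1) =
          fderiv ℝ (fderiv ℝ fun y => Φ y j) x (EuclideanSpace.single b 1)
            (EuclideanSpace.single a 1) := by
        intro a b
        have h1 : pd a j Φ = fun y => fderiv ℝ (fun y => Φ y j) y (EuclideanSpace.single a 1) :=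
          funext (pd_eq hΦ a j)
        have h2 : HasFDerivAt (fderiv ℝ fun y => Φ y j) _ x :=
          ((hq.fderiv_right (m := ∞) (by simp)).differentiable (by simp) x).hasFDerivAt
        rw [h1, (h2.clm_apply (hasFDerivAt_const (EuclideanSpace.single a (1 : ℝ)) x)).fderiv]
        simp
      have hs : IsSymmSndFDerivAt ℝ (fun y => Φ y j) x :=
        hq.contDiffAt.isSymmSndFDerivAt (by
          rw [minSmoothness_of_isRCLikeNormedField]; exact WithTop.coe_le_coe.2 le_top)
      rw [e, e, hs.eq]
    have hd : ∀ i j, DifferentiableAt ℝ (pd i j Φ) x := fun i j =>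
      (contDiff_pd hΦ i j).differentiable (by simp) x
    have h0 : (fun y => curl Φ y 0) = pd 1 2 Φ - pd 2 1 Φ := by funext y; simp [curl]
    have h1 : (fun y => curl Φ y 1) = pd 2 0 Φ - pd 0 2 Φ := by funext y; simp [curl]
    have h2 : (fun y => curl Φ y 2) = pd 0 1 Φ - pd 1 0 Φ := by funext y; simp [curl]
    rw [h0, h1, h2, fderiv_sub (hd _ _) (hd _ _), fderiv_sub (hd _ _) (hd _ _),
      fderiv_sub (hd _ _) (hd _ _)]
    simp only [sub_apply]
    rw [hsymm 2 1 0, hsymm 1 2 0, hsymm 0 2 1]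
    ring
  convert ((hD 0).add (hD 1)).add (hD 2) using 2 with x
  rw [inner_eq_sum, gradient_apply, gradient_apply, gradient_apply]
  linear_combination -(u x) * hdc x

/-- `div (φ W)` has integral zero. -/
theorem integralZero_inner_gradient_add {W : E3 → E3} (hW : ContDiff ℝ ∞ W)
    (hWc : HasCompactSupport W) {φ : E3 → ℝ} (hφ : ContDiff ℝ ∞ φ) (hφc : HasCompactSupport φ) :
    IntegralZero fun x => inner ℝ (W x) (gradient φ x) + divergence W x * φ x := by
  have hD : ∀ i : Fin 3, IntegralZero fun x => pd i i W x * φ x +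
      W x i * fderiv ℝ φ x (EuclideanSpace.single i 1) := by
    intro i
    obtain ⟨K, hK⟩ := exists_lipschitz_of_contDiff (contDiff_apply hW i)
      (hasCompactSupport_apply hWc i)
    simp only [pd_eq hW]
    exact integralZero_fderiv_mul hK hφ hφc i
  convert ((hD 0).add (hD 1)).add (hD 2) using 2 with x
  rw [inner_eq_sum, gradient_apply, gradient_apply, gradient_apply, divergence, Fin.sum_univ_three]
  ring

/-- `div (u ∇φ)` has integral zero. -/
theorem integralZero_gradient_gradient_add {u : E3 → ℝ} {C : ℝ≥0} (hu : LipschitzWith C u)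
    {φ : E3 → ℝ} (hφ : ContDiff ℝ ∞ φ) (hφc : HasCompactSupport φ) :
    IntegralZero fun x => inner ℝ (gradient u x) (gradient φ x) + u x * lap φ x := by
  have hD := fun i : Fin 3 => integralZero_fderiv_mul hu
    (contDiff_fderiv_apply hφ (EuclideanSpace.single i 1))
    (hasCompactSupport_fderiv_apply hφc (EuclideanSpace.single i 1)) i
  convert ((hD 0).add (hD 1)).add (hD 2) using 2 with x
  simp only [inner_eq_sum, gradient_apply, lap, Fin.sum_univ_three]
  ring

/-! ### Density in `X_2` of fields lying in every `X_p` -/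

theorem memLp_restrict_of_continuous {A : Set E3} (hAb : Bornology.IsBounded A) {g : E3 → E3}
    (hg : Continuous g) (p : ℝ≥0∞) : MemLp g p (volume.restrict A) := by
  have := isFiniteMeasure_restrict hAb
  obtain ⟨B, hB⟩ := hAb.isCompact_closure.exists_bound_of_continuousOn hg.continuousOn
  have h1 : MemLp g p (volume.restrict (closure A)) := by
    have := isFiniteMeasure_restrict hAb.closure
    refine MemLp.of_bound hg.aestronglyMeasurable B ?_
    exact (ae_restrict_mem isClosed_closure.measurableSet).mono hB
  exact h1.mono_measure (Measure.restrict_mono subset_closure le_rfl)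

theorem memLp_gradient_of_lipschitz {A : Set E3} (hAb : Bornology.IsBounded A) {u : E3 → ℝ}
    {C : ℝ≥0} (hu : LipschitzWith C u) (p : ℝ≥0∞) : MemLp (gradient u) p (volume.restrict A) := by
  have := isFiniteMeasure_restrict hAb
  exact MemLp.of_bound (measurable_gradient u).aestronglyMeasurable C
    (Eventually.of_forall fun x => by
      rw [norm_gradient]; exact norm_fderiv_le_of_lipschitz ℝ hu)

theorem inner_toLp_right {A : Set E3} (V : L2 A) {g : E3 → E3}
    (hg : MemLp g 2 (volume.restrict A)) :
    inner ℝ V (hg.toLp g) = ∫ x in A, inner ℝ (V x) (g x) := by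
  rw [L2.inner_def]
  refine integral_congr_ae ?_
  filter_upwards [hg.coeFn_toLp] with x hx
  rw [hx]

theorem integrable_inner_of_memLp {μ : Measure E3} {f g : E3 → E3} (hf : MemLp f 2 μ)
    (hg : MemLp g 2 μ) : Integrable (fun x => inner ℝ (f x) (g x)) μ := by
  refine (L2.integrable_inner (𝕜 := ℝ) (hf.toLp f) (hg.toLp g)).congr ?_
  filter_upwards [hf.coeFn_toLp, hg.coeFn_toLp] with x h1 h2
  rw [h1, h2]

theorem DivFree.congr {A : Set E3} {V V' : E3 → E3} (h : V =ᵐ[volume.restrict A] V')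
    (hV : DivFree A V) : DivFree A V' := by
  intro φ hφ hc hφA
  rw [← hV φ hφ hc hφA]
  refine integral_congr_ae ?_
  filter_upwards [h] with x hx
  rw [hx]

theorem continuous_gradient {φ : E3 → ℝ} (hφ : ContDiff ℝ ∞ φ) : Continuous (gradient φ) :=
  (InnerProductSpace.toDual ℝ E3).symm.continuous.comp
    ((hφ.of_le (by simp) : ContDiff ℝ 1 φ).continuous_fderiv one_ne_zero)

/-- Divergence free fields are orthogonal to gradients of Lipschitz functions vanishing off `A`. -/
theorem DivFree.inner_gradient_eq_zero {A : Set E3} (hAo : IsOpen A)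
    (hAb : Bornology.IsBounded A) (hA : IsC11 A) {Z : L2 A} (hZ : DivFree A Z) {u : E3 → ℝ}
    {C : ℝ≥0} (hu : LipschitzWith C u) (hu0 : ∀ x ∉ A, u x = 0) :
    inner ℝ Z ((memLp_gradient_of_lipschitz hAb hu 2).toLp (gradient u)) = 0 := by
  set g := (memLp_gradient_of_lipschitz hAb hu 2).toLp (gradient u)
  have hle : ∀ ε > 0, |inner ℝ Z g| ≤ ε * ‖Z‖ := by
    intro ε hε
    obtain ⟨w, hw, hwc, hwA, hwε⟩ := hA.exists_test_gradient_close hAo hAb hu hu0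
      (ε := ENNReal.ofReal ε) (by simpa using hε)
    have hwm := memLp_restrict_of_continuous hAb (continuous_gradient hw) 2
    have h0 : inner ℝ Z (hwm.toLp _) = 0 := by
      rw [inner_toLp_right]; exact hZ w hw hwc hwA
    have h1 : ‖hwm.toLp _ - g‖ ≤ ε := by
      rw [← MemLp.toLp_sub, Lp.norm_toLp]
      exact ENNReal.toReal_le_of_le_ofReal hε.le hwε
    have h2 : inner ℝ Z g = -inner ℝ Z (hwm.toLp _ - g) := by
      rw [inner_sub_right, h0]; ring
    rw [h2, abs_neg, mul_comm]
    exact (abs_real_inner_le_norm _ _).trans (by gcongr)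
  have hlim0 : Tendsto (fun ε : ℝ => ε * ‖Z‖) (𝓝[>] 0) (𝓝 (0 * ‖Z‖)) :=
    ((continuous_id.mul continuous_const).tendsto 0).mono_left nhdsWithin_le_nhds
  rw [zero_mul] at hlim0
  exact abs_nonpos_iff.1 (ge_of_tendsto hlim0 (eventually_mem_nhdsWithin.mono hle))

/-- A field in `X_2` with curl in `Δ` is an `L²` limit of fields lying in all the spaces `X_p`
whose curl is again in `Δ`. -/
theorem exists_memX_forall_close {A : Set E3} (hAo : IsOpen A) (hAb : Bornology.IsBounded A)
    (hA : IsC11 A) {Δ : Set E3} (hΔ_conv : Convex ℝ Δ) (hΔ_comp : IsCompact Δ)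
    (hΔ_zero : 0 ∈ interior Δ) {V : L2 A} (hV : MemX A 2 V)
    (hVΔ : ∀ᵐ x ∂(volume.restrict A), weakCurl A V x ∈ Δ) {ε : ℝ} (hε : 0 < ε) :
    ∃ V' : L2 A, (∀ p : ℝ, 1 ≤ p → MemX A p V') ∧
      (∀ᵐ x ∂(volume.restrict A), gauge Δ (weakCurl A V' x) ≤ 1) ∧ ‖V' - V‖ ≤ ε := by
  have hfin := isFiniteMeasure_restrict hAb
  have hAm := hAo.measurableSet
  set f : E3 → E3 := A.indicator V with hf
  set J : E3 → E3 := A.indicator (weakCurl A V) with hJ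
  have hfm : MemLp f 2 volume := (memLp_indicator_iff_restrict hAm).2 (Lp.memLp V)
  have hJm : MemLp J 2 volume := (memLp_indicator_iff_restrict hAm).2 (by
    simpa using hV.memLp_curl)
  have hind : ∀ (g h : E3 → E3), ∫ x, inner ℝ (A.indicator g x) (h x) =
      ∫ x in A, inner ℝ (g x) (h x) := by
    intro g h
    rw [← integral_indicator hAm]
    refine integral_congr_ae (Eventually.of_forall fun x => ?_)
    by_cases hx : x ∈ A <;> simp [hx]
  have hJΔ : ∀ᵐ x, J x ∈ Δ := by
    filter_upwards [(ae_restrict_iff' hAm).1 hVΔ] with x hx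
    by_cases hxA : x ∈ A
    · simpa [hJ, hxA] using hx hxA
    · simpa [hJ, hxA] using interior_subset hΔ_zero
  obtain ⟨W, hW, hWc, hWA, hWg, hWε⟩ := hA.exists_test_field_close hAo hAb hΔ_conv hΔ_comp hΔ_zero
    hfm (fun x hx => indicator_of_notMem hx _) (hJm.locallyIntegrable one_le_two) hJΔ
    (fun Φ hΦ hΦc => by rw [hind, hind]; exact hV.zeroTrace Φ hΦ hΦc)
    (ε := ENNReal.ofReal ε) (by simpa using hε)
  -- correction of the divergence by the gradient of a Lipschitz function
  obtain ⟨s, hs, hball⟩ := hA.exists_exterior_ball hAo hAb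
  have hdivs : ContDiff ℝ ∞ (divergence W) := ContDiff.sum fun i _ => contDiff_pd hW i i
  have hdivc : HasCompactSupport (divergence W) := by
    refine HasCompactSupport.intro (K := tsupport W) hWc fun x hx => ?_
    refine Finset.sum_eq_zero fun i _ => ?_
    rw [pd, fderiv_of_notMem_tsupport (𝕜 := ℝ) hx]; simp
  obtain ⟨L, hL⟩ := exists_lipschitz_of_contDiff hdivs hdivc
  obtain ⟨M, hM⟩ := hdivc.exists_bound_of_continuous hdivs.continuous
  obtain ⟨u, C, hu, hu0, hueq⟩ := exists_lipschitz_dirichlet hAo hAb hs hball hM hL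
  have hWm : ∀ p, MemLp W p (volume.restrict A) := memLp_restrict_of_continuous hAb hW.continuous
  have hgm : ∀ p, MemLp (gradient u) p (volume.restrict A) := memLp_gradient_of_lipschitz hAb hu
  have hcm : ∀ p, MemLp (curl W) p (volume.restrict A) :=
    memLp_restrict_of_continuous hAb (contDiff_curl hW).continuous
  have hg0 : ∀ x ∉ A, gradient u x = 0 := fun x hx => by
    rw [gradient, hA.fderiv_eq_zero_of_notMem hAo hu0 hx, map_zero]
  have hW0 : ∀ x ∉ A, W x = 0 := fun x hx =>
    image_eq_zero_of_notMem_tsupport fun h => hx (hWA h)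
  set w : L2 A := (hWm 2).toLp W
  set g : L2 A := (hgm 2).toLp (gradient u)
  have hae : (fun x => W x - gradient u x) =ᵐ[volume.restrict A] (w - g : L2 A) := by
    filter_upwards [Lp.coeFn_sub w g, (hWm 2).coeFn_toLp, (hgm 2).coeFn_toLp] with x h1 h2 h3
    rw [h1, Pi.sub_apply, h2, h3]
  have hgreen : ∀ Φ : E3 → E3, ContDiff ℝ ∞ Φ → HasCompactSupport Φ →
      ∫ x in A, inner ℝ ((w - g : L2 A) x) (curl Φ x) = ∫ x in A, inner ℝ (curl W x) (Φ x) := by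
    intro Φ hΦ hΦc
    have h1 := integralZero_inner_curl_sub hW hWc hΦ hΦc
    have h2 := integralZero_gradient_curl hu hΦ hΦc
    have h3 := (h1.sub h2).2
    have hcW : ∀ x ∉ A, curl W x = 0 := fun x hx => by
      have h : ∀ i j, pd i j W x = 0 := fun i j => by
        rw [pd, fderiv_of_notMem_tsupport (𝕜 := ℝ) fun h => hx (hWA h)]; simp
      simp [curl, h]
    have hi1 : IntegrableOn (fun x => inner ℝ (W x - gradient u x) (curl Φ x)) A :=
      (integrable_inner_of_memLp ((hWm 2).sub (hgm 2))
        (memLp_restrict_of_continuous hAb (contDiff_curl hΦ).continuous 2))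
    have hi2 : IntegrableOn (fun x => inner ℝ (curl W x) (Φ x)) A :=
      integrable_inner_of_memLp (hcm 2) (memLp_restrict_of_continuous hAb hΦ.continuous 2)
    have e : ∫ x in A, inner ℝ ((w - g : L2 A) x) (curl Φ x) =
        ∫ x in A, inner ℝ (W x - gradient u x) (curl Φ x) := by
      refine integral_congr_ae ?_
      filter_upwards [hae] with x hx
      rw [← hx]
    rw [e, ← sub_eq_zero, ← integral_sub hi1 hi2, ← h3,
      setIntegral_eq_integral_of_forall_compl_eq_zero]
    · refine integral_congr_ae (Eventually.of_forall fun x => ?_)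
      simp only [inner_sub_left]; ring
    · intro x hx
      simp [hW0 x hx, hg0 x hx, hcW x hx]
  have hdiv : DivFree A (w - g : L2 A) := by
    refine DivFree.congr hae fun φ hφ hφc hφA => ?_
    have h1 := integralZero_inner_gradient_add hW hWc hφ hφc
    have h2 := integralZero_gradient_gradient_add hu hφ hφc
    have h3 := (h1.sub h2).2
    have h4 := hueq φ hφ hφc hφA
    have hφ0 : ∀ x ∉ A, φ x = 0 := fun x hx =>
      image_eq_zero_of_notMem_tsupport fun h => hx (hφA h)
    have hi1 : IntegrableOn (fun x => inner ℝ (W x - gradient u x) (gradient φ x)) A :=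
      (integrable_inner_of_memLp ((hWm 2).sub (hgm 2))
        (memLp_restrict_of_continuous hAb (continuous_gradient hφ) 2))
    have hi2 : IntegrableOn (fun x => divergence W x * φ x) A :=
      (integrable_mul_of_hasCompactSupport hdivs.continuous hφ.continuous hφc).integrableOn
    have hi3 : IntegrableOn (fun x => u x * lap φ x) A :=
      ((hu.continuous.mul (continuous_lap hφ)).continuousOn.integrableOn_compact
        hAb.isCompact_closure).mono_set subset_closure
    have h5 : ∫ x in A, (inner ℝ (W x - gradient u x) (gradient φ x) +
        (divergence W x * φ x - u x * lap φ x)) = 0 := by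
      rw [← h3, setIntegral_eq_integral_of_forall_compl_eq_zero]
      · refine integral_congr_ae (Eventually.of_forall fun x => ?_)
        simp only [inner_sub_left]; ring
      · intro x hx
        simp [hW0 x hx, hg0 x hx, hφ0 x hx, hu0 x hx]
    have h6 : IntegrableOn (fun x => divergence W x * φ x - u x * lap φ x) A := hi2.sub hi3
    rw [integral_add hi1 h6, integral_sub hi2 hi3, h4, sub_self, add_zero] at h5
    exact h5
  have hall : ∀ p : ℝ, 1 ≤ p → MemX A p (w - g : L2 A) ∧
      weakCurl A (w - g : L2 A) =ᵐ[volume.restrict A] curl W := fun p hp =>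
    memX_of_green hAo hAb hp (((hWm _).sub (hgm _)).ae_eq hae) (hcm _) hgreen hdiv
  refine ⟨w - g, fun p hp => (hall p hp).1, ?_, ?_⟩
  · filter_upwards [(hall 1 le_rfl).2] with x hx
    rw [hx]; exact hWg x
  · set Z : L2 A := w - g - V
    have hZ : DivFree A Z := by
      intro φ hφ hφc hφA
      have hm := memLp_restrict_of_continuous hAb (continuous_gradient hφ) 2
      rw [← inner_toLp_right Z hm, inner_sub_left, inner_toLp_right, inner_toLp_right,
        hdiv φ hφ hφc hφA, hV.divFree φ hφ hφc hφA, sub_zero]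
    have h0 : inner ℝ Z g = 0 := hZ.inner_gradient_eq_zero hAo hAb hA hu hu0
    have h1 : ‖w - V‖ ≤ ε := by
      have e : w - V = ((hWm 2).sub (Lp.memLp V)).toLp (W - (V : E3 → E3)) := by
        rw [MemLp.toLp_sub (hWm 2) (Lp.memLp V), Lp.toLp_coeFn]
      rw [e, Lp.norm_toLp]
      refine ENNReal.toReal_le_of_le_ofReal hε.le (le_trans (le_of_eq ?_) hWε)
      refine eLpNorm_congr_ae ?_
      filter_upwards [ae_restrict_mem hAm] with x hx
      simp [hf, hx]
    -- `Z = (w - V) - g` with `g` orthogonal to `Z`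
    have h2 : ‖Z‖ * ‖Z‖ ≤ ‖Z‖ * ‖w - V‖ := by
      have e : inner ℝ Z Z = inner ℝ Z (w - V) := by
        have : Z = (w - V) - g := by simp only [Z]; abel
        conv_lhs => rw [this, inner_sub_right, ← this, h0, sub_zero]
      rw [← real_inner_self_eq_norm_mul_norm, e]
      exact real_inner_le_norm _ _
    rcases (norm_nonneg Z).eq_or_lt with h3 | h3
    · rw [← h3]; exact hε.le
    · exact (le_of_mul_le_mul_left h2 h3).trans h1

/-! ### Compactness of sequences of bounded energy -/

/-- Weak compactness of bounded sets of a Hilbert space, along an ultrafilter. -/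
theorem exists_tendsto_inner_of_bounded {ι H : Type*} [NormedAddCommGroup H] [InnerProductSpace ℝ H]
    [CompleteSpace H] (U : Ultrafilter ι) {j : ι → H} {R : ℝ}
    (hj : ∀ᶠ i in (U : Filter ι), ‖j i‖ ≤ R) :
    ∃ J : H, ∀ φ, Tendsto (fun i => inner ℝ (j i) φ) U (𝓝 (inner ℝ J φ)) := by
  set T : ι → WeakDual ℝ H := fun i =>
    StrongDual.toWeakDual (InnerProductSpace.toDual ℝ H (j i)) with hT
  obtain ⟨L, -, hL⟩ := (WeakDual.isCompact_closedBall (0 : StrongDual ℝ H) R).ultrafilter_le_nhds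
    (U.map T) (by
      rw [Filter.le_principal_iff]
      refine Filter.mem_map.2 (hj.mono fun i hi => ?_)
      simpa [hT] using hi)
  refine ⟨(InnerProductSpace.toDual ℝ H).symm (WeakDual.toStrongDual L), fun φ => ?_⟩
  have h1 : Tendsto (fun i => T i φ) U (𝓝 (L φ)) :=
    ((WeakDual.eval_continuous φ).tendsto L).comp hL
  have h2 : inner ℝ ((InnerProductSpace.toDual ℝ H).symm (WeakDual.toStrongDual L)) φ = L φ := by
    rw [InnerProductSpace.toDual_symm_apply]; rfl
  rw [h2]
  exact h1

/-- Chebyshev-type splitting of a power at the level `a`. -/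
theorem rpow_le_add_rpow_div {γ a p q : ℝ} (hγ : 0 ≤ γ) (ha : 0 < a) (hq : 0 ≤ q) (hqp : q ≤ p) :
    γ ^ q ≤ a ^ q + γ ^ p / a ^ (p - q) := by
  rcases le_or_gt γ a with h | h
  · have h1 : γ ^ q ≤ a ^ q := Real.rpow_le_rpow hγ h hq
    have h2 : 0 ≤ γ ^ p / a ^ (p - q) := by positivity
    linarith
  · have hγ' : 0 < γ := ha.trans h
    have h1 : a ^ (p - q) ≤ γ ^ (p - q) := Real.rpow_le_rpow ha.le h.le (by linarith)
    have h2 : γ ^ q * a ^ (p - q) ≤ γ ^ p := by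
      calc _ ≤ γ ^ q * γ ^ (p - q) := by gcongr
        _ = γ ^ p := by rw [← Real.rpow_add hγ']; congr 1; ring
    have h3 : γ ^ q ≤ γ ^ p / a ^ (p - q) := by rwa [le_div_iff₀ (by positivity)]
    have h4 : 0 ≤ a ^ q := by positivity
    linarith

theorem tendsto_mul_div_rpow_sub {a : ℝ} (ha : 1 < a) (M q : ℝ) :
    Tendsto (fun p : ℝ => p * M / a ^ (p - q)) atTop (𝓝 0) := by
  have h := (tendsto_rpow_mul_exp_neg_mul_atTop_nhds_zero 1 (Real.log a)
    (Real.log_pos ha)).const_mul (M * a ^ q)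
  rw [mul_zero] at h
  refine h.congr fun p => ?_
  have ha0 : 0 < a := by linarith
  rw [Real.rpow_sub ha0, Real.rpow_one, neg_mul, Real.exp_neg, Real.rpow_def_of_pos ha0 p]
  field_simp

section gaugeBounds

variable {Δ : Set E3}

/-- Membership in `Δ` is detected by a countable family of linear functionals bounded by the
gauge. -/
theorem exists_countable_polar (hΔ_conv : Convex ℝ Δ) (hΔ_comp : IsCompact Δ)
    (hΔ_zero : 0 ∈ interior Δ) :
    ∃ c : ℕ → E3, (∀ n ξ, inner ℝ (c n) ξ ≤ gauge Δ ξ) ∧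
      ∀ ξ, (∀ n, inner ℝ (c n) ξ ≤ 1) → ξ ∈ Δ := by
  have hΔnhds : Δ ∈ 𝓝 (0 : E3) := mem_interior_iff_mem_nhds.1 hΔ_zero
  set P : Set E3 := {c | ∀ ξ ∈ Δ, inner ℝ c ξ ≤ 1} with hP
  have hPne : Nonempty P := ⟨⟨0, fun ξ _ => by simp⟩⟩
  refine ⟨fun n => (TopologicalSpace.denseSeq P n : P), fun n ξ => ?_, fun ξ hξ => ?_⟩
  · refine le_of_forall_gt_imp_ge_of_dense fun a ha => ?_
    obtain ⟨b, hb, hba, ζ, hζ, rfl⟩ := exists_lt_of_gauge_lt (absorbent_nhds_zero hΔnhds) ha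
    have h := (TopologicalSpace.denseSeq P n).2 ζ hζ
    change inner ℝ _ (b • ζ) ≤ a
    rw [inner_smul_right]
    nlinarith
  · have hall : ∀ c : P, inner ℝ (c : E3) ξ ≤ 1 := by
      have hcl : IsClosed {c : P | inner ℝ (c : E3) ξ ≤ 1} :=
        isClosed_le (continuous_subtype_val.inner continuous_const) continuous_const
      have hsub : closure (range (TopologicalSpace.denseSeq P)) ⊆ {c : P | inner ℝ (c : E3) ξ ≤ 1} :=
        closure_minimal (by rintro _ ⟨n, rfl⟩; exact hξ n) hcl
      intro c
      exact hsub (TopologicalSpace.denseRange_denseSeq P c)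
    by_contra hcon
    obtain ⟨l, u, hl, hu⟩ := geometric_hahn_banach_closed_point hΔ_conv hΔ_comp.isClosed hcon
    have hu0 : 0 < u := by simpa using hl 0 (interior_subset hΔ_zero)
    set c : E3 := u⁻¹ • (InnerProductSpace.toDual ℝ E3).symm l with hc
    have hcin : ∀ ζ, inner ℝ c ζ = u⁻¹ * l ζ := fun ζ => by simp [hc, inner_smul_left]
    have hcP : c ∈ P := fun ζ hζ => by
      rw [hcin, inv_mul_le_iff₀ hu0, mul_one]; exact (hl ζ hζ).le
    have := hall ⟨c, hcP⟩
    rw [hcin, inv_mul_le_iff₀ hu0, mul_one] at this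
    linarith

/-- An `L^p` bound of size `p M` on `γ` controls the lower powers of `γ` by those of any constant
`a`, up to an error that vanishes as `p → ∞` if `a > 1`. -/
theorem lintegral_rpow_le {μ : Measure E3} {γ : E3 → ℝ} (hγ : ∀ x, 0 ≤ γ x) {p M : ℝ}
    (hM : ∫⁻ x, ENNReal.ofReal (γ x ^ p) ∂μ ≤ ENNReal.ofReal (p * M)) {a q : ℝ} (ha : 0 < a)
    (hq : 0 ≤ q) (hqp : q ≤ p) (E : Set E3) :
    ∫⁻ x in E, ENNReal.ofReal (γ x ^ q) ∂μ ≤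
      ENNReal.ofReal (a ^ q) * μ E + ENNReal.ofReal (p * M / a ^ (p - q)) := by
  have hapos : 0 < a ^ (p - q) := by positivity
  calc ∫⁻ x in E, ENNReal.ofReal (γ x ^ q) ∂μ
      ≤ ∫⁻ x in E, (ENNReal.ofReal (a ^ q) +
          ENNReal.ofReal (a ^ (p - q))⁻¹ * ENNReal.ofReal (γ x ^ p)) ∂μ := by
        refine lintegral_mono fun x => ?_
        rw [← ENNReal.ofReal_mul (by positivity), ← ENNReal.ofReal_add (by positivity)
          (mul_nonneg (by positivity) (Real.rpow_nonneg (hγ x) _))]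
        refine ENNReal.ofReal_le_ofReal ((rpow_le_add_rpow_div (hγ x) ha hq hqp).trans
          (le_of_eq ?_))
        rw [div_eq_inv_mul]
    _ = ENNReal.ofReal (a ^ q) * μ E +
          ENNReal.ofReal (a ^ (p - q))⁻¹ * ∫⁻ x in E, ENNReal.ofReal (γ x ^ p) ∂μ := by
        rw [lintegral_add_left measurable_const, setLIntegral_const,
          lintegral_const_mul' _ _ ENNReal.ofReal_ne_top]
    _ ≤ ENNReal.ofReal (a ^ q) * μ E +
          ENNReal.ofReal (a ^ (p - q))⁻¹ * ENNReal.ofReal (p * M) := by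
        gcongr
        exact (setLIntegral_le_lintegral _ _).trans hM
    _ = _ := by
        rw [← ENNReal.ofReal_mul (by positivity), div_eq_inv_mul]

theorem integral_le_toReal_lintegral_ofReal {μ : Measure E3} {f : E3 → ℝ} (hf : Integrable f μ) :
    ∫ x, f x ∂μ ≤ (∫⁻ x, ENNReal.ofReal (f x) ∂μ).toReal := by
  rw [integral_eq_lintegral_pos_part_sub_lintegral_neg_part hf]
  exact sub_le_self _ ENNReal.toReal_nonneg

end gaugeBounds

/-- Bounded energy for the exponent `p` gives an `L^p` bound on the gauge of the curl. -/
theorem memX_of_powerFunctional_le {A Δ : Set E3} {lam : ℝ} (hlam : 0 < lam) {U₀ V : L2 A}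
    {p M : ℝ} (hp : 0 < p) (h : powerFunctional A Δ lam U₀ p V ≤ ENNReal.ofReal M) :
    MemX A p V ∧ ∫⁻ x in A, ENNReal.ofReal (gauge Δ (weakCurl A V x) ^ p) ≤
      ENNReal.ofReal (p * M) := by
  unfold powerFunctional at h
  split_ifs at h with hX
  · refine ⟨hX, ?_⟩
    have e : ∀ x, ENNReal.ofReal (gauge Δ (weakCurl A V x) ^ p) ≤ ENNReal.ofReal p *
        ENNReal.ofReal (1 / p * gauge Δ (weakCurl A V x) ^ p + lam * ‖V x - U₀ x‖ ^ 2) := by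
      intro x
      rw [← ENNReal.ofReal_mul hp.le]
      refine ENNReal.ofReal_le_ofReal ?_
      have h1 : 0 ≤ p * (lam * ‖V x - U₀ x‖ ^ 2) := by positivity
      rw [mul_add, ← mul_assoc, mul_one_div_cancel hp.ne', one_mul]
      linarith
    refine (lintegral_mono e).trans ?_
    rw [lintegral_const_mul' _ _ ENNReal.ofReal_ne_top, ENNReal.ofReal_mul hp.le]
    gcongr
  · exact absurd h (not_le.2 ENNReal.ofReal_lt_top)

/-- The fidelity term is continuous on `L²`, being the squared norm up to a factor. -/
theorem lintegral_fidelity {A : Set E3} {lam : ℝ} (hlam : 0 < lam) (V U₀ : L2 A) :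
    ∫⁻ x in A, ENNReal.ofReal (lam * ‖V x - U₀ x‖ ^ 2) = ENNReal.ofReal (lam * ‖V - U₀‖ ^ 2) := by
  have h1 : ‖V - U₀‖ ^ 2 = ∫ x in A, ‖V x - U₀ x‖ ^ 2 := by
    rw [← real_inner_self_eq_norm_sq, L2.inner_def]
    refine integral_congr_ae ?_
    filter_upwards [Lp.coeFn_sub V U₀] with x hx
    rw [real_inner_self_eq_norm_sq, hx, Pi.sub_apply]
  have h2 : Integrable (fun x => ‖V x - U₀ x‖ ^ 2) (volume.restrict A) := by
    refine (L2.integrable_inner (𝕜 := ℝ) (V - U₀) (V - U₀)).congr ?_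
    filter_upwards [Lp.coeFn_sub V U₀] with x hx
    rw [real_inner_self_eq_norm_sq, hx, Pi.sub_apply]
  rw [h1, ← integral_const_mul, ofReal_integral_eq_lintegral_ofReal (h2.const_mul lam)
    (Eventually.of_forall fun x => by positivity)]

/-- Compactness: limits of fields with bounded energy along exponents `p → ∞` lie in `X_2`, and
their curl takes values in `Δ`. -/
theorem memX_two_of_frequently_powerFunctional_le {A : Set E3} (hAo : IsOpen A)
    (hAb : Bornology.IsBounded A) {Δ : Set E3} (hΔ_conv : Convex ℝ Δ) (hΔ_comp : IsCompact Δ)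
    (hΔ_zero : 0 ∈ interior Δ) {lam : ℝ} (hlam : 0 < lam) {U₀ V : L2 A} {Vp : ℝ → L2 A}
    (hlim : Tendsto Vp atTop (𝓝 V)) {M : ℝ} (hM₀ : 0 ≤ M)
    (hM : ∃ᶠ p in atTop, powerFunctional A Δ lam U₀ p (Vp p) ≤ ENNReal.ofReal M) :
    MemX A 2 V ∧ ∀ᵐ x ∂(volume.restrict A), weakCurl A V x ∈ Δ := by
  have hfin := isFiniteMeasure_restrict hAb
  set μ : Measure E3 := volume.restrict A with hμ
  have hΔnhds : Δ ∈ 𝓝 (0 : E3) := mem_interior_iff_mem_nhds.1 hΔ_zero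
  obtain ⟨D, hD⟩ := hΔ_comp.isBounded.exists_norm_le
  have hD0 : 0 ≤ D := (norm_nonneg _).trans (hD 0 (interior_subset hΔ_zero))
  have hnorm : ∀ ξ : E3, ‖ξ‖ ≤ (D + 1) * gauge Δ ξ := by
    intro ξ
    have := le_gauge_of_subset_closedBall (absorbent_nhds_zero hΔnhds)
      (show (0 : ℝ) ≤ D + 1 by positivity) (x := ξ)
      (fun y hy => by simpa using (hD y hy).trans (by linarith))
    rwa [div_le_iff₀' (by positivity)] at this
  set P : ℝ → Prop := fun p => powerFunctional A Δ lam U₀ p (Vp p) ≤ ENNReal.ofReal M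
  have hPne : (atTop ⊓ 𝓟 {p | P p}).NeBot := Filter.frequently_mem_iff_neBot.1 hM
  set U : Ultrafilter ℝ := Ultrafilter.of (atTop ⊓ 𝓟 {p | P p})
  have hUle : (U : Filter ℝ) ≤ atTop ⊓ 𝓟 {p | P p} := Ultrafilter.of_le _
  have hUtop : (U : Filter ℝ) ≤ atTop := hUle.trans inf_le_left
  have hUP : ∀ᶠ p in (U : Filter ℝ), P p :=
    (hUle.trans inf_le_right) (Filter.mem_principal_self _)
  set J : ℝ → E3 → E3 := fun p => weakCurl A (Vp p)
  have hbound : ∀ᶠ p in (U : Filter ℝ), 2 ≤ p ∧ MemX A p (Vp p) ∧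
      MemLp (J p) 2 μ ∧ ∫⁻ x, ENNReal.ofReal (gauge Δ (J p x) ^ p) ∂μ ≤ ENNReal.ofReal (p * M) := by
    filter_upwards [hUP, hUtop (eventually_ge_atTop 2)] with p hp hp2
    obtain ⟨h1, h2⟩ := memX_of_powerFunctional_le hlam (by linarith) hp
    refine ⟨hp2, h1, h1.memLp_curl.mono_exponent ?_, h2⟩
    rw [← ENNReal.ofReal_ofNat]
    exact ENNReal.ofReal_le_ofReal hp2
  classical
  set j : ℝ → L2 A := fun p => if h : MemLp (J p) 2 μ then h.toLp (J p) else 0 with hj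
  have hjJ : ∀ p, MemLp (J p) 2 μ → j p =ᵐ[μ] J p := fun p h => by
    simp only [hj, dif_pos h]; exact h.coeFn_toLp
  -- uniform `L²` bound for the curls
  have hjb : ∀ᶠ p in (U : Filter ℝ), ‖j p‖ ≤ (D + 1) ^ 2 * (2 ^ (2 : ℝ) * μ.real univ + 1) + 1 := by
    filter_upwards [hbound, hUtop ((tendsto_mul_div_rpow_sub one_lt_two M 2).eventually_le_const
      zero_lt_one)] with p ⟨hp2, _, hm, hg⟩ hp1
    have h1 : ‖j p‖ ^ 2 = ∫ x, ‖J p x‖ ^ 2 ∂μ := by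
      rw [← real_inner_self_eq_norm_sq, L2.inner_def]
      refine integral_congr_ae ?_
      filter_upwards [hjJ p hm] with x hx
      rw [real_inner_self_eq_norm_sq, hx]
    have hint : Integrable (fun x => ‖J p x‖ ^ 2) μ := by
      refine (integrable_inner_of_memLp hm hm).congr (Eventually.of_forall fun x => ?_)
      exact real_inner_self_eq_norm_sq _
    have h2 := lintegral_rpow_le (fun x => gauge_nonneg (s := Δ) (J p x)) hg (a := 2) (q := 2)
      two_pos (by norm_num) hp2 univ
    have h3 : ∫⁻ x, ENNReal.ofReal (‖J p x‖ ^ 2) ∂μ ≤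
        ENNReal.ofReal ((D + 1) ^ 2 * (2 ^ (2 : ℝ) * μ.real univ + 1)) := by
      calc _ ≤ ∫⁻ x, ENNReal.ofReal ((D + 1) ^ 2) *
            ENNReal.ofReal (gauge Δ (J p x) ^ (2 : ℝ)) ∂μ := by
            refine lintegral_mono fun x => ?_
            rw [← ENNReal.ofReal_mul (by positivity)]
            refine ENNReal.ofReal_le_ofReal ?_
            rw [Real.rpow_two, ← mul_pow]
            gcongr
            exact hnorm _
        _ ≤ ENNReal.ofReal ((D + 1) ^ 2) *
            (ENNReal.ofReal (2 ^ (2 : ℝ)) * μ univ + ENNReal.ofReal 1) := by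
            rw [lintegral_const_mul' _ _ ENNReal.ofReal_ne_top]
            gcongr
            rw [Measure.restrict_univ] at h2
            exact h2.trans (by gcongr)
        _ = _ := by
            rw [← ofReal_measureReal (μ := μ) (s := univ), ← ENNReal.ofReal_mul (by positivity),
              ← ENNReal.ofReal_add (by positivity) (by positivity),
              ← ENNReal.ofReal_mul (by positivity)]
    have h4 : ‖j p‖ ^ 2 ≤ (D + 1) ^ 2 * (2 ^ (2 : ℝ) * μ.real univ + 1) := by
      rw [h1]
      exact (integral_le_toReal_lintegral_ofReal hint).trans
        (ENNReal.toReal_le_of_le_ofReal (by positivity) h3)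
    nlinarith [sq_nonneg (‖j p‖ - 1)]
  obtain ⟨j₀, hj₀⟩ := exists_tendsto_inner_of_bounded U hjb
  have hVU : Tendsto Vp U (𝓝 V) := hlim.mono_left hUtop
  have hVin : ∀ φ : L2 A, Tendsto (fun p => inner ℝ (Vp p) φ) U (𝓝 (inner ℝ V φ)) := fun φ =>
    hVU.inner tendsto_const_nhds
  -- Green's formula and the divergence condition pass to the weak limit
  have hgreen : ∀ Φ : E3 → E3, ContDiff ℝ ∞ Φ → HasCompactSupport Φ →
      ∫ x in A, inner ℝ (V x) (curl Φ x) = ∫ x in A, inner ℝ (j₀ x) (Φ x) := by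
    intro Φ hΦ hΦc
    have hm1 := memLp_restrict_of_continuous hAb (contDiff_curl hΦ).continuous 2
    have hm2 := memLp_restrict_of_continuous hAb hΦ.continuous 2
    rw [← inner_toLp_right V hm1, ← inner_toLp_right j₀ hm2]
    refine tendsto_nhds_unique (hVin _) ((hj₀ (hm2.toLp Φ)).congr' ?_)
    filter_upwards [hbound] with p ⟨_, hX, hm, _⟩
    rw [inner_toLp_right, inner_toLp_right, hX.zeroTrace Φ hΦ hΦc]
    refine integral_congr_ae ?_
    filter_upwards [hjJ p hm] with x hx
    rw [hx]
  have hdiv : DivFree A V := by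
    intro φ hφ hφc hφA
    have hm := memLp_restrict_of_continuous hAb (continuous_gradient hφ) 2
    rw [← inner_toLp_right V hm]
    refine tendsto_nhds_unique (hVin _) (tendsto_const_nhds.congr' ?_)
    filter_upwards [hbound] with p ⟨_, hX, _, _⟩
    rw [inner_toLp_right, hX.divFree φ hφ hφc hφA]
  obtain ⟨hX, hae⟩ := memX_of_green hAo hAb one_le_two
    (by simpa using Lp.memLp V) (by simpa using Lp.memLp j₀) hgreen hdiv
  refine ⟨hX, ?_⟩
  -- the constraint on the curl, tested against countably many half-spaces
  obtain ⟨c, hcg, hcΔ⟩ := exists_countable_polar hΔ_conv hΔ_comp hΔ_zero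
  have hj₀i : Integrable j₀ μ := (Lp.memLp j₀).integrable one_le_two
  have hc1 : ∀ n, ∀ᵐ x ∂μ, inner ℝ (c n) (j₀ x) ≤ 1 := by
    intro n
    refine ae_le_of_forall_setIntegral_le (hj₀i.const_inner (c n)) (integrable_const 1)
      fun E hE hEfin => ?_
    have hlimE : Tendsto (fun p => ∫ x in E, inner ℝ (c n) (j p x) ∂μ) U
        (𝓝 (∫ x in E, inner ℝ (c n) (j₀ x) ∂μ)) := by
      have e : ∀ k : L2 A, ∫ x in E, inner ℝ (c n) (k x) ∂μ =
          inner ℝ k (indicatorConstLp 2 hE hEfin.ne (c n)) := fun k => by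
        rw [real_inner_comm, L2.inner_indicatorConstLp_eq_setIntegral_inner]
      simp only [e]
      exact hj₀ _
    -- `a > 1` is needed for the error `p * M / a ^ (p - 1)` to vanish; `a` then tends to `1`
    have hbd : ∀ a : ℝ, 1 < a → ∫ x in E, inner ℝ (c n) (j₀ x) ∂μ ≤ a * μ.real E := by
      intro a ha
      have hlima : Tendsto (fun p : ℝ => a * μ.real E + p * M / a ^ (p - 1)) U
          (𝓝 (a * μ.real E + 0)) :=
        ((tendsto_mul_div_rpow_sub ha M 1).mono_left hUtop).const_add _
      rw [add_zero] at hlima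
      refine le_of_tendsto_of_tendsto hlimE hlima ?_
      filter_upwards [hbound] with p ⟨hp2, _, hm, hg⟩
      have hr : 0 ≤ p * M / a ^ (p - 1) := by positivity
      have hE1 : ∫ x in E, inner ℝ (c n) (j p x) ∂μ = ∫ x in E, inner ℝ (c n) (J p x) ∂μ := by
        refine integral_congr_ae (ae_restrict_of_ae ?_)
        filter_upwards [hjJ p hm] with x hx
        rw [hx]
      have hJi : Integrable (fun x => inner ℝ (c n) (J p x)) (μ.restrict E) :=
        ((hm.integrable one_le_two).const_inner (c n)).restrict
      rw [hE1]
      refine (integral_le_toReal_lintegral_ofReal hJi).trans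
        (ENNReal.toReal_le_of_le_ofReal (by positivity) ?_)
      calc ∫⁻ x in E, ENNReal.ofReal (inner ℝ (c n) (J p x)) ∂μ
          ≤ ∫⁻ x in E, ENNReal.ofReal (gauge Δ (J p x) ^ (1 : ℝ)) ∂μ :=
            lintegral_mono fun x => ENNReal.ofReal_le_ofReal
              ((hcg n _).trans_eq (Real.rpow_one _).symm)
        _ ≤ ENNReal.ofReal (a ^ (1 : ℝ)) * μ E + ENNReal.ofReal (p * M / a ^ (p - 1)) :=
            lintegral_rpow_le (fun x => gauge_nonneg (s := Δ) (J p x)) hg (by linarith)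
              zero_le_one (by linarith) E
        _ = ENNReal.ofReal (a * μ.real E + p * M / a ^ (p - 1)) := by
            rw [Real.rpow_one, ← ofReal_measureReal (μ := μ) (s := E),
              ← ENNReal.ofReal_mul (by linarith), ← ENNReal.ofReal_add (by positivity) hr]
    have hlim1 : Tendsto (fun a : ℝ => a * μ.real E) (𝓝[>] 1) (𝓝 (1 * μ.real E)) :=
      ((continuous_id.mul continuous_const).tendsto 1).mono_left nhdsWithin_le_nhds
    have := ge_of_tendsto hlim1 (eventually_mem_nhdsWithin.mono hbd)
    simpa using this
  filter_upwards [hae, ae_all_iff.2 hc1] with x hx hxc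
  rw [hx]
  exact hcΔ _ hxc

/-! ### The two inequalities -/

/-- Where the constraint on the curl holds, the limit functional is the fidelity term. -/
theorem limitFunctional_eq_of_mem {A Δ : Set E3} {lam : ℝ} (hlam : 0 < lam) {U₀ V : L2 A}
    (hV : MemX A 2 V) (hVΔ : ∀ᵐ x ∂(volume.restrict A), weakCurl A V x ∈ Δ) :
    limitFunctional A Δ lam U₀ V = ENNReal.ofReal (lam * ‖V - U₀‖ ^ 2) := by
  rw [limitFunctional, if_pos hV, ← lintegral_fidelity hlam]
  refine lintegral_congr_ae ?_
  filter_upwards [hVΔ] with x hx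
  rw [convexIndicator, if_pos hx, zero_add]

theorem memX_two_of_limitFunctional_lt_top {A Δ : Set E3} (hΔ : IsClosed Δ) {lam : ℝ}
    {U₀ V : L2 A} (h : limitFunctional A Δ lam U₀ V < ⊤) :
    MemX A 2 V ∧ ∀ᵐ x ∂(volume.restrict A), weakCurl A V x ∈ Δ := by
  rw [limitFunctional] at h
  split_ifs at h with hX
  swap
  · exact absurd h (lt_irrefl _)
  refine ⟨hX, ?_⟩
  have hm : Measurable (convexIndicator Δ) := by
    classical
    unfold convexIndicator
    exact Measurable.ite hΔ.measurableSet measurable_const measurable_const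
  have hle := (lintegral_mono (μ := volume.restrict A) fun x =>
    (le_self_add : convexIndicator Δ (weakCurl A V x) ≤
      convexIndicator Δ (weakCurl A V x) + ENNReal.ofReal (lam * ‖V x - U₀ x‖ ^ 2))).trans_lt h
  filter_upwards [ae_lt_top' (hm.comp_aemeasurable hX.memLp_curl.1.aemeasurable) hle.ne] with x hx
  by_contra hcon
  simp [convexIndicator, hcon] at hx

theorem ofReal_fidelity_le_powerFunctional {A Δ : Set E3} {lam : ℝ} (hlam : 0 < lam) {p : ℝ}
    (hp : 0 < p) (U₀ V : L2 A) :
    ENNReal.ofReal (lam * ‖V - U₀‖ ^ 2) ≤ powerFunctional A Δ lam U₀ p V := by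
  rw [powerFunctional]
  split_ifs with hX
  · rw [← lintegral_fidelity hlam]
    refine lintegral_mono fun x => ENNReal.ofReal_le_ofReal ?_
    have : 0 ≤ 1 / p * gauge Δ (weakCurl A V x) ^ p :=
      mul_nonneg (by positivity) (Real.rpow_nonneg (gauge_nonneg _) _)
    linarith
  · exact le_top

theorem powerFunctional_le_of_gauge_le_one {A Δ : Set E3} {lam : ℝ} (hlam : 0 < lam) {p : ℝ}
    (hp : 0 < p) {U₀ V : L2 A} (hV : MemX A p V)
    (hg : ∀ᵐ x ∂(volume.restrict A), gauge Δ (weakCurl A V x) ≤ 1) :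
    powerFunctional A Δ lam U₀ p V ≤
      ENNReal.ofReal (1 / p) * volume A + ENNReal.ofReal (lam * ‖V - U₀‖ ^ 2) := by
  rw [powerFunctional, if_pos hV, ← lintegral_fidelity hlam, ← setLIntegral_const,
    ← lintegral_add_left measurable_const]
  refine lintegral_mono_ae ?_
  filter_upwards [hg] with x hx
  rw [← ENNReal.ofReal_add (by positivity) (by positivity)]
  refine ENNReal.ofReal_le_ofReal ?_
  gcongr
  exact mul_le_of_le_one_right (by positivity) (Real.rpow_le_one (gauge_nonneg _) hx hp.le)

theorem tendsto_ofReal_fidelity {A : Set E3} (lam : ℝ) (U₀ : L2 A) {V : L2 A} {Vp : ℝ → L2 A}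
    (h : Tendsto Vp atTop (𝓝 V)) :
    Tendsto (fun p => ENNReal.ofReal (lam * ‖Vp p - U₀‖ ^ 2)) atTop
      (𝓝 (ENNReal.ofReal (lam * ‖V - U₀‖ ^ 2))) :=
  ENNReal.tendsto_ofReal (((h.sub_const U₀).norm.pow 2).const_mul lam)

/-- Recovery families.  One sequence of approximants serves all exponents, so that the `n`-th one is
used for all `p` with `⌊p⌋ = n`. -/
theorem exists_limsup_powerFunctional_le {A : Set E3} (hAo : IsOpen A)
    (hAb : Bornology.IsBounded A) (hA : IsC11 A) {Δ : Set E3} (hΔ_conv : Convex ℝ Δ)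
    (hΔ_comp : IsCompact Δ) (hΔ_zero : 0 ∈ interior Δ) {lam : ℝ} (hlam : 0 < lam) (U₀ V : L2 A) :
    ∃ Vp : ℝ → L2 A, Tendsto Vp atTop (𝓝 V) ∧
      limsup (fun p => powerFunctional A Δ lam U₀ p (Vp p)) atTop ≤
        limitFunctional A Δ lam U₀ V := by
  rcases eq_or_ne (limitFunctional A Δ lam U₀ V) ⊤ with htop | htop
  · exact ⟨fun _ => V, tendsto_const_nhds, htop ▸ le_top⟩
  obtain ⟨hV, hVΔ⟩ := memX_two_of_limitFunctional_lt_top hΔ_comp.isClosed htop.lt_top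
  choose W hWX hWg hWV using fun n : ℕ => exists_memX_forall_close hAo hAb hA hΔ_conv hΔ_comp
    hΔ_zero hV hVΔ (Nat.one_div_pos_of_nat (α := ℝ) (n := n))
  have hW : Tendsto W atTop (𝓝 V) :=
    tendsto_iff_norm_sub_tendsto_zero.2 (squeeze_zero (fun _ => norm_nonneg _) hWV
      tendsto_one_div_add_atTop_nhds_zero_nat)
  have hVp : Tendsto (fun p : ℝ => W ⌊p⌋₊) atTop (𝓝 V) := hW.comp tendsto_nat_floor_atTop
  refine ⟨fun p => W ⌊p⌋₊, hVp, ?_⟩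
  have hinv : Tendsto (fun p : ℝ => ENNReal.ofReal (1 / p) * volume A) atTop (𝓝 0) := by
    have h1 : Tendsto (fun p : ℝ => ENNReal.ofReal (1 / p)) atTop (𝓝 (ENNReal.ofReal 0)) :=
      ENNReal.tendsto_ofReal (tendsto_const_nhds.div_atTop tendsto_id)
    simpa using ENNReal.Tendsto.mul_const h1 (Or.inr hAb.measure_lt_top.ne)
  have hlim := hinv.add (tendsto_ofReal_fidelity lam U₀ hVp)
  rw [zero_add, ← limitFunctional_eq_of_mem hlam hV hVΔ] at hlim
  rw [← hlim.limsup_eq]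
  refine limsup_le_limsup ?_
  filter_upwards [eventually_ge_atTop 1] with p hp
  exact powerFunctional_le_of_gauge_le_one hlam (by linarith) (hWX _ p hp) (hWg _)

theorem memX_two_of_liminf_lt_top {A : Set E3} (hAo : IsOpen A) (hAb : Bornology.IsBounded A)
    {Δ : Set E3} (hΔ_conv : Convex ℝ Δ) (hΔ_comp : IsCompact Δ) (hΔ_zero : 0 ∈ interior Δ)
    {lam : ℝ} (hlam : 0 < lam) {U₀ V : L2 A} {Vp : ℝ → L2 A} (hVp : Tendsto Vp atTop (𝓝 V))
    (h : liminf (fun p => powerFunctional A Δ lam U₀ p (Vp p)) atTop < ⊤) :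
    MemX A 2 V ∧ ∀ᵐ x ∂(volume.restrict A), weakCurl A V x ∈ Δ := by
  obtain ⟨m, hm, hmtop⟩ := exists_between h
  refine memX_two_of_frequently_powerFunctional_le hAo hAb hΔ_conv hΔ_comp hΔ_zero hlam hVp
    (M := m.toReal) (U₀ := U₀) ENNReal.toReal_nonneg ?_
  rw [ENNReal.ofReal_toReal hmtop.ne]
  exact (frequently_lt_of_liminf_lt (by isBoundedDefault) hm).mono fun p hp => hp.le

end HardSC

theorem theoremt (A : Set HardSC.E3) (hA_open : IsOpen A) (hA_bdd : Bornology.IsBounded A)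
    (hA_C11 : HardSC.IsC11 A) (hA_betti : HardSC.secondBetti A = 0)
    (Δ : Set HardSC.E3) (hΔ_conv : Convex ℝ Δ) (hΔ_comp : IsCompact Δ) (hΔ_zero : 0 ∈ interior Δ)
    (lam : ℝ) (hlam : 0 < lam) (U₀ : HardSC.L2 A) :
    HardSC.GammaConverges (HardSC.powerFunctional A Δ lam U₀)
        (HardSC.limitFunctional A Δ lam U₀) ∧
      ∀ (V : HardSC.L2 A) (Vp : ℝ → HardSC.L2 A), Tendsto Vp atTop (𝓝 V) →
        liminf (fun p => HardSC.powerFunctional A Δ lam U₀ p (Vp p)) atTop < ⊤ →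
        HardSC.MemX A 2 V ∧
          ∀ᵐ x ∂(volume.restrict A), gauge Δ (HardSC.weakCurl A V x) ≤ 1 := by
  refine ⟨⟨HardSC.exists_limsup_powerFunctional_le hA_open hA_bdd hA_C11 hΔ_conv hΔ_comp hΔ_zero
    hlam U₀, fun V Vp hVp => ?_⟩, fun V Vp hVp h => ?_⟩
  · rcases eq_or_ne (liminf (fun p => HardSC.powerFunctional A Δ lam U₀ p (Vp p)) atTop) ⊤
      with htop | htop
    · exact htop ▸ le_top
    obtain ⟨hV, hVΔ⟩ := HardSC.memX_two_of_liminf_lt_top hA_open hA_bdd hΔ_conv hΔ_comp hΔ_zero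
      hlam hVp htop.lt_top
    rw [HardSC.limitFunctional_eq_of_mem hlam hV hVΔ,
      ← (HardSC.tendsto_ofReal_fidelity lam U₀ hVp).liminf_eq]
    refine liminf_le_liminf ?_
    filter_upwards [eventually_gt_atTop 0] with p hp
    exact HardSC.ofReal_fidelity_le_powerFunctional hlam hp U₀ _
  · obtain ⟨hV, hVΔ⟩ := HardSC.memX_two_of_liminf_lt_top hA_open hA_bdd hΔ_conv hΔ_comp hΔ_zero
      hlam hVp h
    exact ⟨hV, hVΔ.mono fun x hx => gauge_le_one_of_mem hx⟩
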